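/- Construction. Let $G=(V,E)$ be a finite simple unweighted graph on $n$ vertices, $k\ge 2$ an integer and $r\ge 2$ a real number. Put $h=h(1)=\frac{3\cdot 2^{k-1}-(k+2)}{2^{k+1}-1}$, $h(0)=0$, $h(2)=3h(1)$, $h(i)=2h(i-1)+h(1)-(i-1)$ for $i\ge 3$, and $q_i=n^{-\frac{2^i-1}{2^{k+1}-1}}r^{-h(i)}$. Sample $V=V_0\supseteq V_1\supseteq\cdots\supseteq V_k$ by promoting each vertex of $V_i$ to $V_{i+1}$ independently with probability $\min\{1,q_{i+1}/q_i\}$; put $V_{k+1}=\emptyset$. Let $p_i(u)$ be the vertex of $V_i$ closest to $u$ (ties broken by a fixed linear order on $V$; undefined if none is reachable), and let $\mathcal B_i(u)$ be the set of vertices reachable from $u$ and strictly closer to $u$ than every vertex of $V_i$. Fix shortest paths $P(u,v)$ consistently, i.e. the part of $P(u,v)$ after a vertex $w$ is $P(w,v)$. For $i\ne 1$ let $F_i$ be the union of the paths $P(u,v)$ over all $u,v\in V_i$ with $v\in\mathcal B_{i+1}(u)$ and $\mathrm{dist}(u,v)\le (r+2)^i$, and for $i\ge1$ let $L_i$ be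 the union of all paths $P(u,p_i(u))$, $u\in V$. Path buying: let $\mathcal P$ be the set of pairs $\{u,v\}\subseteq V_1$ with $u\ne v$ and $v\in\mathcal B_2(u)$ or $u\in\mathcal B_2(v)$. Start with $H=F_0\cup L_1$ and examine the pairs of $\mathcal P$ in an arbitrary order; for $\{u,v\}$, the cost of $P(u,v)$ is the number of its edges not in $H$, and its value is the number of pairs $\{x,y\}\in\mathcal P$ such that each of $x,y$ is $p_1(w)$ for some vertex $w$ of $P(u,v)$ at distance at most $1$ from it and $\mathrm{dist}_{H\cup P(u,v)}(x,y)<\mathrm{dist}_H(x,y)$; add $P(u,v)$ to $H$ if its cost is at most $6$ times its value. With $\tilde E$ the final $H$, the spanner $S=S(k,r)$ has edge set $\tilde E\cup L_1\cup\cdots\cup L_k\cup F_2\cup\cdots\cup F_k$. Theorem. We have $h<3/4$. All of the following holds for every such $G$, $k\ge2$, $r\ge 2$ and all choices (order, paths) in the construction. (1) Size. There is a universal constant $C$ such that the expected number of edges of $S(k,r)$ is at most $C\,r^h k\, n^{1+\frac1{2^{k+1}-1}}$ if $r\ge k$, and at most $C(1+2/r)^k r^h k\, n^{1+\frac1{2^{k+1}-1}}$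 for all $r\ge2$. In (2)–(5), for every outcome of the sampling, $S\subseteq G$; $u,v$ are vertices connected in $G$, and $d=\mathrm{dist}_G(u,v)$. (2) There is a universal constant $C$ such that: if $d\ge 2^k$ then $\mathrm{dist}_S(u,v)\le C(3/2)^k d$; if $d\ge 3^k$ then $\mathrm{dist}_S(u,v)\le Ckd$; if $d\ge\ell^k$ for a real $\ell\le r$ with $4\le \ell<k$ then $\mathrm{dist}_S(u,v)\le(5+C/\ell)d$; if $d\ge\ell^k$ for a real $\ell$ with $k\le\ell\le r$ then $\mathrm{dist}_S(u,v)\le\bigl(1+\frac{4k+C}{\ell}\bigr)d$; and if $d\le r^k$ then $\mathrm{dist}_S(u,v)\le d+C(kd^{1-1/k}+3^k)$. (3) For every $\epsilon_0>0$ there is a constant $C=C(\epsilon_0)$, independent of $k$, such that $S(k,r)$ is a $\bigl(1+\epsilon,((4k+C)/\epsilon)^{k-1}\bigr)$-spanner for every $0<\epsilon\le \epsilon_0$ with $(4k+C)/\epsilon<r$, i.e. $\mathrm{dist}_S(u,v)\le(1+\epsilon)d+((4k+C)/\epsilon)^{k-1}$ for all $u,v$. (4) For every $k$ there is a function $o_k(d)\to0$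 ($d\to\infty$), depending on $k$ only, such that $\mathrm{dist}_S(u,v)\le d+(4+o_k(d))k d^{1-1/k}+3^k$ whenever $d\le r^k$. (5) For every $k$ and $\eta>0$ there is $T>0$ such that, for all $r\ge T$ and $d\ge r^k$, $\mathrm{dist}_S(u,v)\le d+(4+\eta)\bigl(\frac{kd}{r}+r^{k-1}\bigr)$, and $\mathrm{dist}_S(u,v)\le d+(4+\eta)\frac{kd}{r}$ if moreover $d\ge T r^k$. -/

import Mathlib

open Filter Topology

universe u

noncomputable section

namespace PathBuying

variable {V : Type u}

/-- A consistent choice of shortest paths in `G`: `step v u` is the vertex that follows `u` on the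
chosen shortest path `P(u,v)`.  Consistency: the part of `P(u,v)` after a vertex `w` is `P(w,v)`. -/
structure ShortestPathRule (G : SimpleGraph V) where
  step : V → V → V
  adj_step : ∀ u v, G.Reachable u v → u ≠ v → G.Adj u (step v u)
  dist_step : ∀ u v, G.Reachable u v → u ≠ v → G.dist (step v u) v + 1 = G.dist u v

/-- An input graph together with the arbitrary choices made by the construction:
shortest paths, and an order in which pairs of vertices are examined when paths are bought. -/
structure Input (V : Type u) where
  G : SimpleGraph V
  paths : ShortestPathRule G
  order : List (V × V)
  order_complete : ∀ p, p ∈ order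

/-- The distance of `u` and `v` in `S` is finite and at most `x`. -/
def DistLE (S : SimpleGraph V) (u v : V) (x : ℝ) : Prop :=
  S.Reachable u v ∧ (S.dist u v : ℝ) ≤ x

variable [Fintype V] [LinearOrder V]

open scoped Classical in
/-- The edges of the chosen shortest path `P(u,v)` (none if `v` cannot be reached from `u`). -/
def pathEdges (I : Input V) (u v : V) : Finset (Sym2 V) :=
  (Finset.range (I.G.dist u v)).image
    fun j => s((I.paths.step v)^[j] u, (I.paths.step v)^[j + 1] u)

open scoped Classical in
/-- The vertices of `P(u,v)`. -/
def pathVerts (I : Input V) (u v : V) : Finset V :=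
  (Finset.range (I.G.dist u v + 1)).image fun j => (I.paths.step v)^[j] u

/-- `w` is the vertex of `A` closest to `u`; ties are broken by the order of the vertices. -/
def IsClosest (I : Input V) (A : Finset V) (u w : V) : Prop :=
  w ∈ A ∧ I.G.Reachable u w ∧ ∀ w' ∈ A, I.G.Reachable u w' →
    I.G.dist u w < I.G.dist u w' ∨ (I.G.dist u w = I.G.dist u w' ∧ w ≤ w')

/-- `v` is reachable from `u` and strictly closer to `u` than every vertex of `A`. -/
def InBall (I : Input V) (A : Finset V) (u v : V) : Prop :=
  I.G.Reachable u v ∧ ∀ w ∈ A, I.G.Reachable u w → I.G.dist u v < I.G.dist u w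

/-- The exponent `h = h(1)` of `r` in the size bound. -/
def hExp (k : ℕ) : ℝ := (3 * 2 ^ (k - 1) - ((k : ℝ) + 2)) / (2 ^ (k + 1) - 1)

/-- The exponents `h(i)` of `1 / r` in the sampling probabilities. -/
def hSeq (k : ℕ) : ℕ → ℝ
  | 0 => 0
  | 1 => hExp k
  | 2 => 3 * hExp k
  | (i + 3) => 2 * hSeq k (i + 2) + hExp k - ((i : ℝ) + 2)

/-- The sampling probability `q_i = n^{-(2^i-1)/(2^{k+1}-1)} r^{-h(i)}`. -/
def sampleProb (n k : ℕ) (r : ℝ) (i : ℕ) : ℝ :=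
  (n : ℝ) ^ (-((2 ^ i - 1 : ℝ) / (2 ^ (k + 1) - 1))) * r ^ (-(hSeq k i))

/-- The probability that a vertex of `V_j` is promoted to `V_{j+1}` (a ratio above one is read
as certain promotion). -/
def promoteProb (n k : ℕ) (r : ℝ) (j : ℕ) : ℝ :=
  min 1 (sampleProb n k r (j + 1) / sampleProb n k r j)

/-- The outcomes of the sampling: `ω u j` tells whether `u`, if it lies in `V_j`, is promoted
to `V_{j+1}`. -/
abbrev Outcome (V : Type u) (k : ℕ) : Type u := V → Fin k → Bool

/-- The sampled sets `V = V_0 ⊇ V_1 ⊇ ⋯ ⊇ V_k`; there are no vertices on levels above `k`. -/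
def levelSet {k : ℕ} (ω : Outcome V k) (i : ℕ) : Finset V :=
  if i ≤ k then Finset.univ.filter fun u => ∀ j : Fin k, j.val < i → ω u j = true else ∅

/-- The probability of an outcome: all promotions are independent. -/
def outcomeProb {k : ℕ} (r : ℝ) (ω : Outcome V k) : ℝ :=
  ∏ u : V, ∏ j : Fin k,
    if ω u j = true then promoteProb (Fintype.card V) k r j
    else 1 - promoteProb (Fintype.card V) k r j

open scoped Classical in
/-- The union of the paths `P(u, p_i(u))` over all vertices `u`, where `p_i(u)` is the vertex
of `V_i` closest to `u`. -/
def linkEdges (I : Input V) {k : ℕ} (ω : Outcome V k) (i : ℕ) : Finset (Sym2 V) :=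
  (Finset.univ.filter fun p : V × V => IsClosest I (levelSet ω i) p.1 p.2).biUnion
    fun p => pathEdges I p.1 p.2

open scoped Classical in
/-- The union of the paths `P(u,v)` over all `u, v ∈ V_i` such that `v` is closer to `u` than
`V_{i+1}` and at distance at most `(r+2)^i` from `u`. -/
def ballEdges (I : Input V) {k : ℕ} (r : ℝ) (ω : Outcome V k) (i : ℕ) : Finset (Sym2 V) :=
  (Finset.univ.filter fun p : V × V => p.1 ∈ levelSet ω i ∧ p.2 ∈ levelSet ω i ∧
      InBall I (levelSet ω (i + 1)) p.1 p.2 ∧ (I.G.dist p.1 p.2 : ℝ) ≤ (r + 2) ^ i).biUnion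
    fun p => pathEdges I p.1 p.2

open scoped Classical in
/-- The pairs `{x, y}` of vertices of `V_1` such that one of them is closer to the other
than `V_2`; each pair is listed once, smaller vertex first. -/
def demandPairs (I : Input V) {k : ℕ} (ω : Outcome V k) : Finset (V × V) :=
  Finset.univ.filter fun p => p.1 < p.2 ∧ p.1 ∈ levelSet ω 1 ∧ p.2 ∈ levelSet ω 1 ∧
    (InBall I (levelSet ω 2) p.1 p.2 ∨ InBall I (levelSet ω 2) p.2 p.1)

/-- The sampled vertex `x ∈ V_1` touches the path `P(u,v)`: some vertex of the path is `x`,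
or is a neighbour of `x` with `x` as its closest vertex of `V_1`. -/
def Touches (I : Input V) {k : ℕ} (ω : Outcome V k) (x u v : V) : Prop :=
  ∃ w ∈ pathVerts I u v, IsClosest I (levelSet ω 1) w x ∧ I.G.dist w x ≤ 1

open scoped Classical in
/-- The cost of `P(u,v)`: the number of its edges that are missing in `H`. -/
def cost (I : Input V) (H : Finset (Sym2 V)) (u v : V) : ℕ :=
  (pathEdges I u v \ H).card

open scoped Classical in
/-- The value of `P(u,v)`: the number of demand pairs touching the path whose distance drops
when the path is added to `H`. -/
def value (I : Input V) {k : ℕ} (ω : Outcome V k) (H : Finset (Sym2 V)) (u v : V) : ℕ :=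
  ((demandPairs I ω).filter fun p => Touches I ω p.1 u v ∧ Touches I ω p.2 u v ∧
    (SimpleGraph.fromEdgeSet (↑(H ∪ pathEdges I u v) : Set (Sym2 V))).edist p.1 p.2 <
      (SimpleGraph.fromEdgeSet (↑H : Set (Sym2 V))).edist p.1 p.2).card

open scoped Classical in
/-- One step of the path-buying algorithm: examine the pair `p` and buy its path if the value
of the path is at least a fixed fraction of its cost. -/
def buyStep (I : Input V) {k : ℕ} (ω : Outcome V k) (H : Finset (Sym2 V)) (p : V × V) :
    Finset (Sym2 V) :=
  if p ∈ demandPairs I ω ∧ cost I H p.1 p.2 ≤ 6 * value I ω H p.1 p.2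
  then H ∪ pathEdges I p.1 p.2 else H

open scoped Classical in
/-- The edges the path-buying algorithm starts from. -/
def initialEdges (I : Input V) {k : ℕ} (r : ℝ) (ω : Outcome V k) : Finset (Sym2 V) :=
  ballEdges I r ω 0 ∪ linkEdges I ω 1

/-- The initial edges together with all edges bought. -/
def boughtEdges (I : Input V) {k : ℕ} (r : ℝ) (ω : Outcome V k) : Finset (Sym2 V) :=
  I.order.foldl (buyStep I ω) (initialEdges I r ω)

open scoped Classical in
/-- The edges of the spanner `S(k,r)`. -/
def spannerEdges (I : Input V) {k : ℕ} (r : ℝ) (ω : Outcome V k) : Finset (Sym2 V) :=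
  boughtEdges I r ω ∪ (Finset.Icc 1 k).biUnion (fun i => linkEdges I ω i) ∪
    (Finset.Icc 2 k).biUnion (fun i => ballEdges I r ω i)

/-- The spanner `S(k,r)` for a given outcome of the sampling. -/
def spanner (I : Input V) {k : ℕ} (r : ℝ) (ω : Outcome V k) : SimpleGraph V :=
  SimpleGraph.fromEdgeSet (↑(spannerEdges I r ω) : Set (Sym2 V))

/-- The expected number of edges of `S(k,r)`. -/
def expectedSize (I : Input V) (k : ℕ) (r : ℝ) : ℝ :=
  ∑ ω : Outcome V k, outcomeProb r ω * ((spanner I r ω).edgeSet.ncard : ℝ)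

/-- The expression `r^h k n^{1+1/(2^{k+1}-1)}`. -/
def sizeBound (n k : ℕ) (r : ℝ) : ℝ :=
  r ^ hExp k * k * (n : ℝ) ^ (1 + 1 / ((2 : ℝ) ^ (k + 1) - 1))

end PathBuying

end

set_option linter.unusedSectionVars false

noncomputable section

/-! Stretch. The unit of the analysis is `Covers G S A D E r`: a pair at distance m ≤ D is joined in
S with error E, unless the level A comes within r of its first vertex. One step of the recursion
passes from a level to the next. Cut a shortest path into segments and advance from both ends until
a break point is near A. If the two fronts meet, every segment was joined directly and only the
errors E add up. Otherwise both fronts hop to vertices of A, which are joined to each other in S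
unless the next level B is not much further away. This is `Layer.covers_step`; since the level above
k is empty, the top level yields an unconditional additive error (`Covers.additive`).

The recursion starts with path buying (`buy_connect`): vertices of V_1 are joined with error 2
unless V_2 is near. A path that misses many edges passes near many vertices of V_1
(`card_missing_lt`). If its ends were still further apart than d + 2, each of these vertices would
form an improved pair with one of the ends, so the path would have been bought (`cost_le_value`).

Unrolling with scales 3^j works for all r ≥ 2 (`small_regime`), with scales L^j for 4 ≤ L ≤ r it
gives the errors of order kd/L (`large_regime`). Segments of decreasing lengths on the second level
(`Layer.covers_arith`) sharpen the leading constant to 4 (`fine_regime`). The stated regimes follow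
by taking L to be the integer part of d^(1/k), of l or of r, plus elementary calculus.

Size. Links to one level form a forest. For fixed u, list the other vertices by distance: v can lie
in the ball of u only if no earlier vertex reached V_{i+1}, so the expected number of pairs is a
geometric sum, at most n q_i² / q_{i+1} in total (`expect_ballPairs`). Multiplied by r^i for the
path lengths when i ≥ 2, these quantities are all equal to r^h n^(1+1/(2^(k+1)-1)); the exponents
h(i) are the solution of these equations. Level 1 pays no length factor: a purchase costs at most 6
edges per improved pair, and a pair can improve only 5 times (`card_boughtEdges_le`). -/

namespace PathBuying

/-! ### Chosen shortest paths and bounds on extended distances. -/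

section ShortestPaths

variable {V : Type u}

/-- The `j`-th vertex of the chosen shortest path `P(u,v)`. -/
def pathVert (I : Input V) (u v : V) (j : ℕ) : V := (I.paths.step v)^[j] u

theorem pathVert_zero (I : Input V) (u v : V) : pathVert I u v 0 = u := rfl

theorem pathVert_succ (I : Input V) (u v : V) (j : ℕ) :
    pathVert I u v (j + 1) = I.paths.step v (pathVert I u v j) := by
  simp only [pathVert, Function.iterate_succ_apply']

theorem pathVert_reachable_dist (I : Input V) {u v : V} (h : I.G.Reachable u v) :
    ∀ j ≤ I.G.dist u v, I.G.Reachable (pathVert I u v j) v ∧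
      I.G.dist (pathVert I u v j) v + j = I.G.dist u v := by
  intro j
  induction j with
  | zero => intro _; exact ⟨h, rfl⟩
  | succ j ih =>
    intro hj
    obtain ⟨hr, hd⟩ := ih (by omega)
    have hne : pathVert I u v j ≠ v := by
      rintro heq
      rw [heq, SimpleGraph.dist_self] at hd
      omega
    have h1 := I.paths.adj_step _ _ hr hne
    have h2 := I.paths.dist_step _ _ hr hne
    rw [pathVert_succ]
    exact ⟨h1.symm.reachable.trans hr, by omega⟩

theorem pathVert_adj (I : Input V) {u v : V} (h : I.G.Reachable u v) {j : ℕ}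
    (hj : j < I.G.dist u v) : I.G.Adj (pathVert I u v j) (pathVert I u v (j + 1)) := by
  obtain ⟨hr, hd⟩ := pathVert_reachable_dist I h j hj.le
  have hne : pathVert I u v j ≠ v := by
    rintro heq
    rw [heq, SimpleGraph.dist_self] at hd
    omega
  rw [pathVert_succ]
  exact I.paths.adj_step _ _ hr hne

theorem pathVert_dist (I : Input V) {u v : V} (h : I.G.Reachable u v) :
    pathVert I u v (I.G.dist u v) = v := by
  obtain ⟨hr, hd⟩ := pathVert_reachable_dist I h _ le_rfl
  exact (hr.dist_eq_zero_iff).1 (by omega)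

theorem reachable_of_dist_pos {G : SimpleGraph V} {u v : V} {j : ℕ} (h : j < G.dist u v) :
    G.Reachable u v := SimpleGraph.Reachable.of_dist_ne_zero (by omega)

theorem edist_le_of_adj_seq {S : SimpleGraph V} {x : ℕ → V} {n : ℕ}
    (h : ∀ j < n, S.Adj (x j) (x (j + 1))) {i j : ℕ} (hij : i ≤ j) (hj : j ≤ n) :
    S.edist (x i) (x j) ≤ ((j - i : ℕ) : ℕ∞) := by
  induction j, hij using Nat.le_induction with
  | base => simp
  | succ j hij ih =>
    refine (SimpleGraph.edist_triangle (v := x j)).trans ?_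
    rw [Nat.sub_add_comm hij, Nat.cast_add]
    refine add_le_add (ih (by omega)) ?_
    rw [SimpleGraph.edist_eq_one_iff_adj.2 (h j (by omega))]
    rfl

theorem edist_eq_coe_dist {G : SimpleGraph V} {u v : V} (h : G.Reachable u v) :
    G.edist u v = (G.dist u v : ℕ∞) := h.coe_dist_eq_edist.symm

/-- Bounds are carried by `edist`, because `dist` is 0 on unreachable pairs; a finite bound on
`edist` includes reachability. -/
theorem edist_le_coe_iff {G : SimpleGraph V} {u v : V} {n : ℕ} :
    G.edist u v ≤ (n : ℕ∞) ↔ G.Reachable u v ∧ G.dist u v ≤ n := by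
  constructor
  · intro h
    have hr : G.Reachable u v :=
      SimpleGraph.reachable_of_edist_ne_top (ne_top_of_le_ne_top (ENat.natCast_ne_top n) h)
    rw [edist_eq_coe_dist hr] at h
    exact ⟨hr, by exact_mod_cast h⟩
  · rintro ⟨hr, h⟩
    rw [edist_eq_coe_dist hr]
    exact_mod_cast h

theorem edist_triangle_le {G : SimpleGraph V} {u v w : V} {a b : ℕ}
    (h1 : G.edist u v ≤ (a : ℕ∞)) (h2 : G.edist v w ≤ (b : ℕ∞)) :
    G.edist u w ≤ ((a + b : ℕ) : ℕ∞) := by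
  push_cast
  exact SimpleGraph.edist_triangle.trans (add_le_add h1 h2)

theorem edist_mono_coe {G : SimpleGraph V} {u v : V} {a b : ℕ}
    (h1 : G.edist u v ≤ (a : ℕ∞)) (h : a ≤ b) : G.edist u v ≤ (b : ℕ∞) :=
  h1.trans (by exact_mod_cast h)

theorem edist_symm_le {G : SimpleGraph V} {u v : V} {a : ℕ}
    (h1 : G.edist u v ≤ (a : ℕ∞)) : G.edist v u ≤ (a : ℕ∞) := by
  rwa [SimpleGraph.edist_comm]

/-- A sequence that moves from `u` to `v` within `n` steps of length at most one. -/
theorem exists_walk_seq {G : SimpleGraph V} {u v : V} {n : ℕ} (h : G.edist u v ≤ (n : ℕ∞)) :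
    ∃ x : ℕ → V, x 0 = u ∧ x n = v ∧
      ∀ i j, i ≤ j → G.edist (x i) (x j) ≤ ((j - i : ℕ) : ℕ∞) := by
  obtain ⟨hr, hd⟩ := edist_le_coe_iff.1 h
  obtain ⟨p, hp⟩ := hr.exists_walk_length_eq_dist
  refine ⟨p.getVert, p.getVert_zero, p.getVert_of_length_le (by omega), ?_⟩
  intro i j hij
  induction j, hij using Nat.le_induction with
  | base => simp
  | succ j hij ih =>
    rw [Nat.sub_add_comm hij]
    refine edist_triangle_le ih ?_
    rcases lt_or_ge j p.length with hj | hj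
    · rw [SimpleGraph.edist_eq_one_iff_adj.2 (p.adj_getVert_succ hj)]
      rfl
    · rw [p.getVert_of_length_le hj, p.getVert_of_length_le (by omega)]
      simp

/-- Some vertex of `A` lies within distance `m` of `u`. -/
def Near (G : SimpleGraph V) (A : Finset V) (u : V) (m : ℕ) : Prop :=
  ∃ w ∈ A, G.edist u w ≤ (m : ℕ∞)

theorem Near.mono {G : SimpleGraph V} {A : Finset V} {u : V} {m m' : ℕ} (h : Near G A u m)
    (hm : m ≤ m') : Near G A u m' := by
  obtain ⟨w, hw, h⟩ := h
  exact ⟨w, hw, edist_mono_coe h hm⟩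

theorem Near.of_edist {G : SimpleGraph V} {A : Finset V} {u v : V} {m a : ℕ} (h : Near G A v m)
    (huv : G.edist u v ≤ (a : ℕ∞)) : Near G A u (a + m) := by
  obtain ⟨w, hw, h⟩ := h
  exact ⟨w, hw, edist_triangle_le huv h⟩

end ShortestPaths

/-! ### Edge sets of the construction and what each guarantees. -/

section Construction

variable {V : Type u} [Fintype V] [LinearOrder V]

theorem mem_pathEdges {I : Input V} {u v : V} {e : Sym2 V} :
    e ∈ pathEdges I u v ↔
      ∃ j < I.G.dist u v, s(pathVert I u v j, pathVert I u v (j + 1)) = e := by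
  simp [pathEdges, pathVert]

theorem mem_pathVerts {I : Input V} {u v w : V} :
    w ∈ pathVerts I u v ↔ ∃ j ≤ I.G.dist u v, pathVert I u v j = w := by
  simp [pathVerts, pathVert]

theorem pathEdges_subset (I : Input V) (u v : V) :
    (↑(pathEdges I u v) : Set (Sym2 V)) ⊆ I.G.edgeSet := by
  intro e he
  obtain ⟨j, hj, rfl⟩ := mem_pathEdges.1 (Finset.mem_coe.1 he)
  exact pathVert_adj I (reachable_of_dist_pos hj) hj

theorem fromEdgeSet_adj_of_pathEdges {I : Input V} {u v : V} {H : Set (Sym2 V)}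
    (hH : ↑(pathEdges I u v) ⊆ H) {j : ℕ} (hj : j < I.G.dist u v) :
    (SimpleGraph.fromEdgeSet H).Adj (pathVert I u v j) (pathVert I u v (j + 1)) := by
  rw [SimpleGraph.fromEdgeSet_adj]
  exact ⟨hH (Finset.mem_coe.2 (mem_pathEdges.2 ⟨j, hj, rfl⟩)),
    (pathVert_adj I (reachable_of_dist_pos hj) hj).ne⟩

theorem edist_pathVert_le {I : Input V} {u v : V} {H : Set (Sym2 V)}
    (hH : ↑(pathEdges I u v) ⊆ H) {i j : ℕ} (hij : i ≤ j) (hj : j ≤ I.G.dist u v) :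
    (SimpleGraph.fromEdgeSet H).edist (pathVert I u v i) (pathVert I u v j)
      ≤ ((j - i : ℕ) : ℕ∞) :=
  edist_le_of_adj_seq (x := pathVert I u v) (fun _ h => fromEdgeSet_adj_of_pathEdges hH h) hij hj

theorem edist_path_le {I : Input V} {u v : V} (h : I.G.Reachable u v) {H : Set (Sym2 V)}
    (hH : ↑(pathEdges I u v) ⊆ H) :
    (SimpleGraph.fromEdgeSet H).edist u v ≤ (I.G.dist u v : ℕ∞) := by
  have := edist_pathVert_le hH (Nat.zero_le _) le_rfl
  rwa [pathVert_dist I h, pathVert_zero, Nat.sub_zero] at this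

theorem edist_pathVert_graph_le {I : Input V} {u v : V} {i j : ℕ} (hij : i ≤ j)
    (hj : j ≤ I.G.dist u v) :
    I.G.edist (pathVert I u v i) (pathVert I u v j) ≤ ((j - i : ℕ) : ℕ∞) :=
  edist_le_of_adj_seq (x := pathVert I u v) (fun _ h => pathVert_adj I (reachable_of_dist_pos h) h) hij hj

theorem fromEdgeSet_le {G : SimpleGraph V} {H : Set (Sym2 V)} (h : H ⊆ G.edgeSet) :
    SimpleGraph.fromEdgeSet H ≤ G := by
  intro a b hab
  rw [SimpleGraph.fromEdgeSet_adj] at hab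
  exact h hab.1

theorem linkEdges_subset (I : Input V) {k : ℕ} (ω : Outcome V k) (i : ℕ) :
    (↑(linkEdges I ω i) : Set (Sym2 V)) ⊆ I.G.edgeSet := by
  intro e he
  simp only [linkEdges, Finset.mem_coe, Finset.mem_biUnion] at he
  obtain ⟨p, -, hp⟩ := he
  exact pathEdges_subset I _ _ hp

theorem ballEdges_subset (I : Input V) {k : ℕ} (r : ℝ) (ω : Outcome V k) (i : ℕ) :
    (↑(ballEdges I r ω i) : Set (Sym2 V)) ⊆ I.G.edgeSet := by
  intro e he
  simp only [ballEdges, Finset.mem_coe, Finset.mem_biUnion] at he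
  obtain ⟨p, -, hp⟩ := he
  exact pathEdges_subset I _ _ hp

theorem subset_buyStep (I : Input V) {k : ℕ} (ω : Outcome V k) (H : Finset (Sym2 V))
    (p : V × V) : H ⊆ buyStep I ω H p := by
  unfold buyStep
  split_ifs
  · exact Finset.subset_union_left
  · exact subset_rfl

theorem buyStep_subset (I : Input V) {k : ℕ} (ω : Outcome V k) {H : Finset (Sym2 V)}
    (p : V × V) (hH : (↑H : Set (Sym2 V)) ⊆ I.G.edgeSet) :
    (↑(buyStep I ω H p) : Set (Sym2 V)) ⊆ I.G.edgeSet := by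
  unfold buyStep
  split_ifs
  · rw [Finset.coe_union]
    exact Set.union_subset hH (pathEdges_subset I _ _)
  · exact hH

theorem subset_foldl_buyStep (I : Input V) {k : ℕ} (ω : Outcome V k) (l : List (V × V)) :
    ∀ H : Finset (Sym2 V), H ⊆ l.foldl (buyStep I ω) H := by
  induction l with
  | nil => intro H; exact subset_rfl
  | cons p l ih => intro H; exact (subset_buyStep I ω H p).trans (ih _)

theorem foldl_buyStep_subset (I : Input V) {k : ℕ} (ω : Outcome V k) (l : List (V × V)) :
    ∀ H : Finset (Sym2 V), (↑H : Set (Sym2 V)) ⊆ I.G.edgeSet →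
      (↑(l.foldl (buyStep I ω) H) : Set (Sym2 V)) ⊆ I.G.edgeSet := by
  induction l with
  | nil => intro H h; exact h
  | cons p l ih => intro H h; exact ih _ (buyStep_subset I ω p h)

theorem initialEdges_subset (I : Input V) {k : ℕ} (r : ℝ) (ω : Outcome V k) :
    (↑(initialEdges I r ω) : Set (Sym2 V)) ⊆ I.G.edgeSet := by
  rw [initialEdges, Finset.coe_union]
  exact Set.union_subset (ballEdges_subset I r ω 0) (linkEdges_subset I ω 1)

theorem spannerEdges_subset (I : Input V) {k : ℕ} (r : ℝ) (ω : Outcome V k) :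
    (↑(spannerEdges I r ω) : Set (Sym2 V)) ⊆ I.G.edgeSet := by
  rw [spannerEdges, Finset.coe_union, Finset.coe_union]
  refine Set.union_subset (Set.union_subset ?_ ?_) ?_
  · exact foldl_buyStep_subset I ω _ _ (initialEdges_subset I r ω)
  · intro e he
    simp only [Finset.mem_coe, Finset.mem_biUnion] at he
    obtain ⟨i, -, hi⟩ := he
    exact linkEdges_subset I ω i hi
  · intro e he
    simp only [Finset.mem_coe, Finset.mem_biUnion] at he
    obtain ⟨i, -, hi⟩ := he
    exact ballEdges_subset I r ω i hi

theorem spanner_le (I : Input V) {k : ℕ} (r : ℝ) (ω : Outcome V k) :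
    spanner I r ω ≤ I.G := fromEdgeSet_le (spannerEdges_subset I r ω)

theorem initialEdges_subset_boughtEdges (I : Input V) {k : ℕ} (r : ℝ) (ω : Outcome V k) :
    initialEdges I r ω ⊆ boughtEdges I r ω := subset_foldl_buyStep I ω _ _

theorem boughtEdges_subset_spannerEdges (I : Input V) {k : ℕ} (r : ℝ) (ω : Outcome V k) :
    boughtEdges I r ω ⊆ spannerEdges I r ω :=
  Finset.subset_union_left.trans Finset.subset_union_left

theorem linkEdges_subset_spannerEdges (I : Input V) {k : ℕ} (r : ℝ) (ω : Outcome V k) {i : ℕ}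
    (h1 : 1 ≤ i) (hk : i ≤ k) : linkEdges I ω i ⊆ spannerEdges I r ω := by
  intro e he
  simp only [spannerEdges, Finset.mem_union, Finset.mem_biUnion, Finset.mem_Icc]
  exact Or.inl (Or.inr ⟨i, ⟨h1, hk⟩, he⟩)

theorem ballEdges_subset_spannerEdges (I : Input V) {k : ℕ} (r : ℝ) (ω : Outcome V k) {i : ℕ}
    (h2 : 2 ≤ i) (hk : i ≤ k) : ballEdges I r ω i ⊆ spannerEdges I r ω := by
  intro e he
  simp only [spannerEdges, Finset.mem_union, Finset.mem_biUnion, Finset.mem_Icc]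
  exact Or.inr ⟨i, ⟨h2, hk⟩, he⟩

theorem levelSet_zero {k : ℕ} (ω : Outcome V k) : levelSet ω 0 = Finset.univ := by
  simp [levelSet]

theorem levelSet_above {k : ℕ} (ω : Outcome V k) : levelSet ω (k + 1) = ∅ := by
  simp [levelSet]

theorem exists_isClosest {I : Input V} {A : Finset V} {u : V} {m : ℕ} (h : Near I.G A u m) :
    ∃ p, IsClosest I A u p ∧ I.G.dist u p ≤ m := by
  obtain ⟨w, hw, h⟩ := h
  obtain ⟨hr, hd⟩ := edist_le_coe_iff.1 h
  classical
  let B := A.filter fun w => I.G.Reachable u w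
  have hB : B.Nonempty := ⟨w, Finset.mem_filter.2 ⟨hw, hr⟩⟩
  obtain ⟨p, hp, hmin⟩ := B.exists_min_image (fun w => toLex (I.G.dist u w, w)) hB
  obtain ⟨hpA, hpr⟩ := Finset.mem_filter.1 hp
  have hlt : ∀ w' ∈ A, I.G.Reachable u w' →
      I.G.dist u p < I.G.dist u w' ∨ (I.G.dist u p = I.G.dist u w' ∧ p ≤ w') := by
    intro w' hw' hr'
    have := hmin w' (Finset.mem_filter.2 ⟨hw', hr'⟩)
    rwa [Prod.Lex.toLex_le_toLex] at this
  refine ⟨p, ⟨hpA, hpr, hlt⟩, ?_⟩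
  rcases hlt w hw hr with h' | h' <;> omega

theorem edist_le_of_isClosest {I : Input V} {k : ℕ} {ω : Outcome V k} {i : ℕ} {u p : V}
    (hp : IsClosest I (levelSet ω i) u p) {H : Set (Sym2 V)}
    (hH : ↑(linkEdges I ω i) ⊆ H) :
    (SimpleGraph.fromEdgeSet H).edist u p ≤ (I.G.dist u p : ℕ∞) := by
  refine edist_path_le hp.2.1 (subset_trans ?_ hH)
  intro e he
  simp only [linkEdges, Finset.mem_coe, Finset.mem_biUnion, Finset.mem_filter]
  exact ⟨(u, p), ⟨Finset.mem_univ _, hp⟩, he⟩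

/-- Vertices close to a level are linked to it in the spanner. -/
theorem exists_link (I : Input V) {k : ℕ} (r : ℝ) (ω : Outcome V k) {i : ℕ} (h1 : 1 ≤ i)
    (hk : i ≤ k) {u : V} {m : ℕ} (h : Near I.G (levelSet ω i) u m) :
    ∃ p ∈ levelSet ω i, (spanner I r ω).edist u p ≤ (m : ℕ∞) := by
  obtain ⟨p, hp, hd⟩ := exists_isClosest h
  exact ⟨p, hp.1, (edist_le_of_isClosest hp (Finset.coe_subset.2
    (linkEdges_subset_spannerEdges I r ω h1 hk))).trans (by exact_mod_cast hd)⟩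

/-- The dichotomy behind all "or the next level is near" alternatives: a vertex of A that keeps q
out of the ball of p is no further from p than q is. -/
theorem inBall_or_near (I : Input V) (A : Finset V) {p q : V} {m : ℕ}
    (h : I.G.edist p q ≤ (m : ℕ∞)) : InBall I A p q ∨ Near I.G A p m := by
  obtain ⟨hr, hd⟩ := edist_le_coe_iff.1 h
  by_cases hB : InBall I A p q
  · exact Or.inl hB
  · right
    simp only [InBall, not_and, not_forall, not_lt] at hB
    obtain ⟨w, hw, hrw, hdw⟩ := hB hr
    exact ⟨w, hw, edist_le_coe_iff.2 ⟨hrw, hdw.trans hd⟩⟩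

/-- Vertices of level `i ≥ 2` at distance at most `(r+2)^i` are joined exactly, unless the next
level is as close. -/
theorem ball_connect (I : Input V) {k : ℕ} (r : ℝ) (ω : Outcome V k) {i : ℕ} (h2 : 2 ≤ i)
    (hk : i ≤ k) {p q : V} (hp : p ∈ levelSet ω i) (hq : q ∈ levelSet ω i) {m : ℕ}
    (hm : (m : ℝ) ≤ (r + 2) ^ i) (h : I.G.edist p q ≤ (m : ℕ∞)) :
    (spanner I r ω).edist p q ≤ (m : ℕ∞) ∨ Near I.G (levelSet ω (i + 1)) p m := by
  rcases inBall_or_near I (levelSet ω (i + 1)) h with hB | hN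
  · left
    obtain ⟨hr, hd⟩ := edist_le_coe_iff.1 h
    refine (edist_path_le hr ?_).trans (by exact_mod_cast hd)
    refine subset_trans ?_ (Finset.coe_subset.2 (ballEdges_subset_spannerEdges I r ω h2 hk))
    intro e he
    simp only [ballEdges, Finset.mem_coe, Finset.mem_biUnion, Finset.mem_filter]
    exact ⟨(p, q), ⟨Finset.mem_univ _, hp, hq, hB, le_trans (by exact_mod_cast hd) hm⟩, he⟩
  · exact Or.inr hN

theorem pathEdges_of_adj {I : Input V} {u v : V} (h : I.G.Adj u v) :
    pathEdges I u v = {s(u, v)} := by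
  have hd : I.G.dist u v = 1 := SimpleGraph.dist_eq_one_iff_adj.2 h
  have hv := pathVert_dist I h.reachable
  rw [hd] at hv
  ext e
  rw [mem_pathEdges, hd, Finset.mem_singleton]
  constructor
  · rintro ⟨j, hj, rfl⟩
    obtain rfl : j = 0 := by omega
    rw [hv, pathVert_zero]
  · rintro rfl
    exact ⟨0, one_pos, by rw [hv, pathVert_zero]⟩

/-- An edge outside the initial edge set joins vertices within distance one of `V_1`. -/
theorem near_of_notMem_initialEdges (I : Input V) {k : ℕ} (r : ℝ) (ω : Outcome V k) {u v : V}
    (h : I.G.Adj u v) (he : s(u, v) ∉ initialEdges I r ω) : Near I.G (levelSet ω 1) u 1 := by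
  have hd : I.G.dist u v = 1 := SimpleGraph.dist_eq_one_iff_adj.2 h
  rcases inBall_or_near I (levelSet ω 1) (p := u) (q := v) (m := 1)
    (edist_le_coe_iff.2 ⟨h.reachable, hd.le⟩) with hB | hN
  · refine absurd ?_ he
    simp only [initialEdges, ballEdges, Finset.mem_union, Finset.mem_biUnion, Finset.mem_filter]
    refine Or.inl ⟨(u, v), ⟨Finset.mem_univ _, ?_, ?_, hB, ?_⟩, ?_⟩
    · simp [levelSet_zero]
    · simp [levelSet_zero]
    · simp [hd]
    · simp [pathEdges_of_adj h]
  · exact hN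

end Construction


/-! ### Chains of segments and the recursion from one level to the next. -/

section Chains

variable {V : Type u} {G S : SimpleGraph V} {A B : Finset V}

/-- Vertices at distance `m ≤ D` in `G` are at distance at most `m + E` in `S`, unless `A` is
within distance `r` of the first of them. -/
def Covers (G S : SimpleGraph V) (A : Finset V) (D E r : ℕ) : Prop :=
  ∀ m ≤ D, ∀ x y, G.edist x y ≤ (m : ℕ∞) → S.edist x y ≤ ((m + E : ℕ) : ℕ∞) ∨ Near G A x r

/-- The first `s` break points of a sequence `w` with segment lengths `a`, cut off at `n`,
are not near `A`. -/
def Free (G : SimpleGraph V) (A : Finset V) (w : ℕ → V) (n : ℕ) (a r : ℕ → ℕ) (s : ℕ) : Prop :=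
  ∀ t < s, ¬ Near G A (w (min (∑ i ∈ Finset.range t, a i) n)) (r t)

theorem Free.mono {w : ℕ → V} {n : ℕ} {a r : ℕ → ℕ} {s t : ℕ} (h : Free G A w n a r s)
    (hts : t ≤ s) : Free G A w n a r t := fun i hi => h i (hi.trans_le hts)

theorem free_zero {w : ℕ → V} {n : ℕ} {a r : ℕ → ℕ} : Free G A w n a r 0 :=
  fun _ h => absurd h (Nat.not_lt_zero _)

theorem free_or_exists_near (w : ℕ → V) (n : ℕ) (a r : ℕ → ℕ) (N : ℕ) :
    Free G A w n a r N ∨ ∃ s < N, Free G A w n a r s ∧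
      Near G A (w (min (∑ i ∈ Finset.range s, a i) n)) (r s) := by
  induction N with
  | zero => exact Or.inl free_zero
  | succ N ih =>
    rcases ih with h | ⟨s, hs, h⟩
    · by_cases hN : Near G A (w (min (∑ i ∈ Finset.range N, a i) n)) (r N)
      · exact Or.inr ⟨N, Nat.lt_succ_self N, h, hN⟩
      · left
        intro t ht
        rcases Nat.lt_succ_iff_lt_or_eq.1 ht with h' | rfl
        · exact h t h'
        · exact hN
    · exact Or.inr ⟨s, hs.trans (Nat.lt_succ_self N), h⟩

/-- Consecutive terms of the sequence are at most one step apart. -/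
def IsSlow (G : SimpleGraph V) (w : ℕ → V) : Prop :=
  ∀ i j, i ≤ j → G.edist (w i) (w j) ≤ ((j - i : ℕ) : ℕ∞)

theorem IsSlow.reverse {w : ℕ → V} (hw : IsSlow G w) (n : ℕ) :
    IsSlow G (fun i => w (n - i)) := by
  intro i j hij
  refine edist_symm_le (edist_mono_coe (hw (n - j) (n - i) (by omega)) (by omega))

/-- At a free break point the second alternative of `Covers` is excluded, so each segment costs its
length plus E. Break points beyond n coincide with `w n`, and the segments there have length 0. -/
theorem edist_of_free {w : ℕ → V} (hw : IsSlow G w) {n E : ℕ} {a r : ℕ → ℕ} {s : ℕ}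
    (hc : ∀ t < s, Covers G S A (a t) E (r t)) (hf : Free G A w n a r s) :
    S.edist (w 0) (w (min (∑ i ∈ Finset.range s, a i) n)) ≤
      ((min (∑ i ∈ Finset.range s, a i) n + s * E : ℕ) : ℕ∞) := by
  induction s with
  | zero => simp
  | succ s ih =>
    have h1 := ih (fun t ht => hc t (by omega)) (hf.mono (Nat.le_succ s))
    rw [Finset.sum_range_succ]
    set X := ∑ i ∈ Finset.range s, a i
    have h2 := hc s (Nat.lt_succ_self s) (min (X + a s) n - min X n) (by omega) _ _
      (hw (min X n) (min (X + a s) n) (by omega))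
    have h3 := h2.resolve_right (hf s (Nat.lt_succ_self s))
    refine edist_mono_coe (edist_triangle_le h1 h3) ?_
    rw [Nat.succ_mul]
    omega

/-- When the fronts overlap, superfluous segments of the left chain are dropped and its last one is
shortened to end where the right chain ends. `Covers` applies to all lengths up to D, so the overlap
costs no extra length. -/
theorem edist_of_cross {w : ℕ → V} (hw : IsSlow G w) {n E : ℕ} {a r b q : ℕ → ℕ} {s t : ℕ}
    (hc : ∀ i < s, Covers G S A (a i) E (r i)) (hd : ∀ i < t, Covers G S A (b i) E (q i))
    (hf : Free G A w n a r s) (hg : Free G A (fun i => w (n - i)) n b q t)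
    (hn : n ≤ ∑ i ∈ Finset.range s, a i + ∑ i ∈ Finset.range t, b i) :
    S.edist (w 0) (w n) ≤ ((n + (s + t) * E : ℕ) : ℕ∞) := by
  induction s with
  | zero =>
    have h := edist_of_free (hw.reverse n) hd hg
    simp only [Finset.range_zero, Finset.sum_empty, zero_add] at hn
    rw [min_eq_right hn] at h
    simp only [Nat.sub_zero, Nat.sub_self] at h
    simpa using edist_symm_le h
  | succ s ih =>
    set X := ∑ i ∈ Finset.range s, a i with hX
    set Y := ∑ i ∈ Finset.range t, b i with hY
    rcases le_or_gt n (X + Y) with h | h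
    · refine edist_mono_coe (ih (fun i hi => hc i (by omega)) (hf.mono (Nat.le_succ s)) h) ?_
      exact Nat.add_le_add_left (Nat.mul_le_mul_right _ (by omega)) _
    · have h1 := edist_of_free hw (fun i hi => hc i (by omega)) (hf.mono (Nat.le_succ s))
      have h2 := edist_symm_le (edist_of_free (hw.reverse n) hd hg)
      have hs := hf s (Nat.lt_succ_self s)
      rw [← hX] at h1 hs
      rw [← hY] at h2
      rw [Finset.sum_range_succ, ← hX] at hn
      rw [min_eq_left (by omega)] at h1 h2 hs
      simp only [Nat.sub_zero] at h2
      have h3 := (hc s (Nat.lt_succ_self s) (n - Y - X) (by omega) _ _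
        (hw X (n - Y) (by omega))).resolve_right hs
      refine edist_mono_coe (edist_triangle_le (edist_triangle_le h1 h3) h2) ?_
      have : (s + 1 + t) * E = s * E + E + t * E := by ring
      rw [this]
      omega

/-- A level `A` of the hierarchy with next level `B`: vertices near `A` are linked to `A`, and
vertices of `A` within distance `R` are connected up to an error `σ`, or `B` is not much further
away. -/
structure Layer (G S : SimpleGraph V) (A B : Finset V) (R : ℝ) (σ : ℕ) : Prop where
  link : ∀ u m, Near G A u m → ∃ p ∈ A, S.edist u p ≤ (m : ℕ∞)
  connect : ∀ p ∈ A, ∀ q ∈ A, ∀ m : ℕ, (m : ℝ) ≤ R → G.edist p q ≤ (m : ℕ∞) →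
    S.edist p q ≤ ((m + σ : ℕ) : ℕ∞) ∨ Near G B p (m + σ)
  le : S ≤ G

/-- Each front reaches A by a detour that is walked twice, once to leave the path and once inside
the connection of the two vertices of A; hence the factor 2 on both radii. -/
theorem Layer.edist_of_jump {R : ℝ} {σ : ℕ} (hL : Layer G S A B R σ) {w : ℕ → V}
    (hw : IsSlow G w) {n E : ℕ} {a r b q : ℕ → ℕ} {s t : ℕ}
    (hc : ∀ i < s, Covers G S A (a i) E (r i)) (hd : ∀ i < t, Covers G S A (b i) E (q i))
    (hf : Free G A w n a r s) (hg : Free G A (fun i => w (n - i)) n b q t)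
    (hs : Near G A (w (min (∑ i ∈ Finset.range s, a i) n)) (r s))
    (ht : Near G A (w (n - min (∑ i ∈ Finset.range t, b i) n)) (q t))
    (hn : ∑ i ∈ Finset.range s, a i + ∑ i ∈ Finset.range t, b i ≤ n)
    (hR : ((n + r s + q t : ℕ) : ℝ) ≤ R) :
    S.edist (w 0) (w n) ≤ ((n + (s + t) * E + 2 * r s + 2 * q t + σ : ℕ) : ℕ∞) ∨
      Near G B (w 0) (n + 2 * r s + q t + σ) := by
  have h1 := edist_of_free hw hc hf
  have h2 := edist_symm_le (edist_of_free (hw.reverse n) hd hg)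
  set X := ∑ i ∈ Finset.range s, a i with hX
  set Y := ∑ i ∈ Finset.range t, b i with hY
  rw [min_eq_left (by omega)] at h1 h2 hs ht
  simp only [Nat.sub_zero] at h2
  obtain ⟨p, hp, hpe⟩ := hL.link _ _ hs
  obtain ⟨p', hp', hpe'⟩ := hL.link _ _ ht
  have hG := (SimpleGraph.edist_anti hL.le).trans hpe
  have hG' := (SimpleGraph.edist_anti hL.le).trans hpe'
  have hpp := edist_triangle_le (edist_triangle_le (edist_symm_le hG)
    (hw X (n - Y) (by omega))) hG'
  rcases hL.connect p hp p' hp' _ (le_trans (by exact_mod_cast (by omega)) hR) hpp with h | h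
  · left
    refine edist_mono_coe (edist_triangle_le (edist_triangle_le (edist_triangle_le
      (edist_triangle_le h1 hpe) h) (edist_symm_le hpe')) h2) ?_
    rw [Nat.add_mul]
    omega
  · right
    refine (h.of_edist (edist_triangle_le (hw 0 X (by omega)) hG)).mono (by omega)

/-- The recursion of the analysis: `N` segments that are covered by one level are covered by the
next one. -/
theorem Layer.covers_step {R : ℝ} {σ : ℕ} (hL : Layer G S A B R σ) {D E r : ℕ}
    (hc : Covers G S A D E r) (N n : ℕ) (hN : n ≤ N * D) (hR : ((n + 2 * r : ℕ) : ℝ) ≤ R) :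
    Covers G S B n (max (N * E) ((N - 1) * E + 4 * r + σ)) (n + 3 * r + σ) := by
  intro m hm u v huv
  obtain ⟨w, rfl, rfl, hw⟩ := exists_walk_seq huv
  have hsum : ∀ s : ℕ, ∑ i ∈ Finset.range s, (fun _ : ℕ => D) i = s * D := by simp
  have hcross : ∀ s t, s + t ≤ N → Free G A w m (fun _ => D) (fun _ => r) s →
      Free G A (fun i => w (m - i)) m (fun _ => D) (fun _ => r) t → m ≤ s * D + t * D →
      S.edist (w 0) (w m) ≤
        ((m + max (N * E) ((N - 1) * E + 4 * r + σ) : ℕ) : ℕ∞) := by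
    intro s t hst hf hg hmst
    refine edist_mono_coe (edist_of_cross hw (fun _ _ => hc) (fun _ _ => hc) hf hg ?_) ?_
    · rw [hsum, hsum]; exact hmst
    · have : (s + t) * E ≤ N * E := Nat.mul_le_mul_right _ hst
      have := le_max_left (N * E) ((N - 1) * E + 4 * r + σ)
      omega
  -- A chain of N free segments from either end spans the whole path. Otherwise both chains stop,
  -- after s and t segments, at break points near A.
  rcases free_or_exists_near (A := A) (G := G) w m (fun _ => D) (fun _ => r) N with
    hf | ⟨s, hs, hf, hns⟩
  · left
    exact hcross N 0 le_rfl hf free_zero (by omega)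
  rcases free_or_exists_near (A := A) (G := G) (fun i => w (m - i)) m (fun _ => D)
    (fun _ => r) N with hg | ⟨t, ht, hg, hnt⟩
  · left
    exact hcross 0 N (by omega) free_zero hg (by omega)
  rcases Nat.lt_or_ge (s + t) N with hst | hst
  · rcases le_or_gt (s * D + t * D) m with hmst | hmst
    · refine (hL.edist_of_jump hw (fun _ _ => hc) (fun _ _ => hc) hf hg hns hnt
        (by rw [hsum, hsum]; exact hmst) (le_trans ?_ hR)).imp ?_ ?_
      · exact_mod_cast (by omega)
      · intro h
        refine edist_mono_coe h ?_
        have : (s + t) * E ≤ (N - 1) * E := Nat.mul_le_mul_right _ (by omega)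
        have := le_max_right (N * E) ((N - 1) * E + 4 * r + σ)
        omega
      · intro h
        exact h.mono (by omega)
    · left
      exact hcross s t hst.le hf hg hmst.le
  · left
    -- With s + t ≥ N the right chain may be shortened to N - s segments; the two chains still cover
    -- the path.
    refine hcross s (N - s) (by omega) hf (hg.mono (by omega)) ?_
    rw [← Nat.add_mul, Nat.add_sub_cancel' hs.le]
    omega

theorem Covers.mono {D E r D' E' r' : ℕ} (h : Covers G S A D E r) (hD : D' ≤ D) (hE : E ≤ E')
    (hr : r ≤ r') : Covers G S A D' E' r' := by
  intro m hm x y hxy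
  refine (h m (hm.trans hD) x y hxy).imp (fun h => edist_mono_coe h (by omega))
    (fun h => h.mono hr)

/-- The term `3 * (a - s) * (a - s + 1)` is twice the length of the segments still to come, which
closes the induction; the use is at s = a. -/
theorem sum_arith (a : ℕ) : ∀ s ≤ a,
    2 * ∑ i ∈ Finset.range s, 3 * (a - i) + 3 * (a - s) * (a - s + 1) = 3 * a * (a + 1) := by
  intro s
  induction s with
  | zero => intro _; simp
  | succ s ih =>
    intro hs
    rw [← ih (by omega), Finset.sum_range_succ]
    obtain ⟨c, rfl⟩ : ∃ c, a = s + 1 + c := ⟨a - (s + 1), by omega⟩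
    have h1 : s + 1 + c - s = c + 1 := by omega
    have h2 : s + 1 + c - (s + 1) = c := by omega
    rw [h1, h2]
    ring

/-- The second level with segments of decreasing lengths towards the middle. -/
theorem Layer.covers_arith {R : ℝ} (hL : Layer G S A B R 0)
    (hc : ∀ D, Covers G S A D 6 (D + 5)) (M n : ℕ) (hn : n ≤ 3 * M ^ 2)
    (hR : ((n + 6 * M + 13 : ℕ) : ℝ) ≤ R) :
    Covers G S B n (12 * M + 26) (n + 12 * M + 26) := by
  intro m hm u v huv
  obtain ⟨w, rfl, rfl, hw⟩ := exists_walk_seq huv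
  let ln : ℕ → ℕ → ℕ := fun a s => 3 * (a - s)
  let rd : ℕ → ℕ → ℕ := fun a s => 3 * (a - s) + 5
  let Fl : ℕ → Prop := fun a => Free G A w m (ln a) (rd a) a
  let Fr : ℕ → Prop := fun b => Free G A (fun i => w (m - i)) m (ln b) (rd b) b
  have hcov : ∀ a i, Covers G S A (ln a i) 6 (rd a i) := fun a i => hc _
  have hsum : ∀ a, 2 * ∑ i ∈ Finset.range a, ln a i = 3 * a * (a + 1) := by
    intro a
    have := sum_arith a a le_rfl
    simpa [ln] using this
  -- Two free chains have total length at least 3(a² + b²)/2 ≥ 3M² when a + b = 2M, so they cross.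
  have hboth : ∀ a b, a + b = 2 * M → Fl a → Fr b →
      S.edist (w 0) (w m) ≤ ((m + (12 * M + 26) : ℕ) : ℕ∞) := by
    intro a b hab hf hg
    refine edist_mono_coe (edist_of_cross hw (fun i _ => hcov a i) (fun i _ => hcov b i)
      hf hg ?_) (by omega)
    have h1 := hsum a
    have h2 := hsum b
    have h3 : 4 * M ^ 2 ≤ 2 * (a * a + b * b) := by
      zify at hab ⊢
      have : (4 * M ^ 2 : ℤ) = (a + b) ^ 2 := by rw [hab]; ring
      rw [this]
      nlinarith [sq_nonneg ((a : ℤ) - b)]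
    nlinarith
  -- The decreasing lengths balance the cost: s segments cost 6s, and the detour after them 6(a - s)
  -- + 10. The left side thus contributes 6a + 10 wherever it stops, and likewise the right side, in
  -- total at most 6(2M + 1) + 20 = 12M + 26.
  have hneither : ∀ a b, a + b ≤ 2 * M + 1 → ¬ Fl a → ¬ Fr b →
      S.edist (w 0) (w m) ≤ ((m + (12 * M + 26) : ℕ) : ℕ∞) ∨
        Near G B (w 0) (n + 12 * M + 26) := by
    intro a b hab hf hg
    obtain ⟨s, hs, hfs, hns⟩ := (free_or_exists_near w m (ln a) (rd a) a).resolve_left hf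
    obtain ⟨t, ht, hgt, hnt⟩ :=
      (free_or_exists_near (fun i => w (m - i)) m (ln b) (rd b) b).resolve_left hg
    rcases le_or_gt (∑ i ∈ Finset.range s, ln a i + ∑ i ∈ Finset.range t, ln b i) m with h | h
    · refine (hL.edist_of_jump hw (fun i _ => hcov a i) (fun i _ => hcov b i) hfs hgt hns hnt h
        (le_trans ?_ hR)).imp ?_ ?_
      · exact_mod_cast (by simp only [rd]; omega)
      · intro h
        exact edist_mono_coe h (by simp only [rd]; omega)
      · intro h
        exact h.mono (by simp only [rd]; omega)
    · left
      exact edist_mono_coe (edist_of_cross hw (fun i _ => hcov a i) (fun i _ => hcov b i)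
        hfs hgt h.le) (by omega)
  by_contra hcon
  -- Discrete continuity: if both good cases fail throughout, then `Fl a` excludes `Fr (2M - a)`,
  -- which in turn forces `Fl (a + 1)`. This ends with the failure of `Fr 0`, which is vacuously
  -- true.
  have key : ∀ a ≤ 2 * M, Fl a ∧ ¬ Fr (2 * M - a) := by
    intro a
    induction a with
    | zero =>
      intro _
      exact ⟨free_zero, fun h => hcon (Or.inl (hboth 0 (2 * M - 0) (by omega) free_zero h))⟩
    | succ a ih =>
      intro ha
      obtain ⟨-, h2⟩ := ih (by omega)
      have h3 : Fl (a + 1) := by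
        by_contra h3
        exact hcon (hneither (a + 1) (2 * M - a) (by omega) h3 h2)
      exact ⟨h3, fun h => hcon (Or.inl (hboth (a + 1) _ (by omega) h3 h))⟩
  obtain ⟨-, h⟩ := key (2 * M) le_rfl
  rw [Nat.sub_self] at h
  exact h free_zero

end Chains


/-! ### Analysis of the path-buying algorithm. -/

section Buying

variable {V : Type u} [Fintype V] [LinearOrder V]

/-- The graph with edge set `H`. -/
abbrev edgeGraph (H : Finset (Sym2 V)) : SimpleGraph V :=
  SimpleGraph.fromEdgeSet (↑H : Set (Sym2 V))

theorem edgeGraph_mono {H H' : Finset (Sym2 V)} (h : H ⊆ H') : edgeGraph H ≤ edgeGraph H' :=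
  SimpleGraph.fromEdgeSet_mono (Finset.coe_subset.2 h)

/-- The pair `{x, y}` with its smaller element first. -/
def sortPair (x y : V) : V × V := (min x y, max x y)

theorem sortPair_eq {x y x' y' : V} (h : sortPair x y = sortPair x' y') :
    s(x, y) = s(x', y') := by
  have key : ∀ x y : V, s((sortPair x y).1, (sortPair x y).2) = s(x, y) := by
    intro x y
    rcases le_total x y with h | h
    · simp [sortPair, h]
    · simp [sortPair, h, Sym2.eq_swap]
  rw [← key x y, h, key]

theorem sortPair_mem_demandPairs {I : Input V} {k : ℕ} {ω : Outcome V k} {x y : V} (hxy : x ≠ y)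
    (hx : x ∈ levelSet ω 1) (hy : y ∈ levelSet ω 1)
    (h : InBall I (levelSet ω 2) x y ∨ InBall I (levelSet ω 2) y x) :
    sortPair x y ∈ demandPairs I ω := by
  simp only [demandPairs, Finset.mem_filter, Finset.mem_univ, true_and]
  rcases lt_or_gt_of_ne hxy with h' | h'
  · simpa [sortPair, h'.le] using ⟨h', hx, hy, h⟩
  · simpa [sortPair, h'.le] using ⟨h', hy, hx, h.symm⟩

open scoped Classical in
/-- The demand pairs counted by the value of a path. -/
def valuePairs (I : Input V) {k : ℕ} (ω : Outcome V k) (H : Finset (Sym2 V)) (u v : V) :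
    Finset (V × V) :=
  (demandPairs I ω).filter fun p => Touches I ω p.1 u v ∧ Touches I ω p.2 u v ∧
    (edgeGraph (H ∪ pathEdges I u v)).edist p.1 p.2 < (edgeGraph H).edist p.1 p.2

theorem card_valuePairs (I : Input V) {k : ℕ} (ω : Outcome V k) (H : Finset (Sym2 V)) (u v : V) :
    (valuePairs I ω H u v).card = value I ω H u v := by
  unfold valuePairs value
  congr

theorem sortPair_mem_valuePairs {I : Input V} {k : ℕ} {ω : Outcome V k} {H : Finset (Sym2 V)}
    {u v x y : V} (hd : sortPair x y ∈ demandPairs I ω) (hx : Touches I ω x u v)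
    (hy : Touches I ω y u v)
    (h : (edgeGraph (H ∪ pathEdges I u v)).edist x y < (edgeGraph H).edist x y) :
    sortPair x y ∈ valuePairs I ω H u v := by
  classical
  unfold valuePairs
  rw [Finset.mem_filter]
  refine ⟨hd, ?_⟩
  rcases le_total x y with h' | h'
  · simpa [sortPair, h'] using ⟨hx, hy, h⟩
  · simp only [sortPair, min_eq_right h', max_eq_left h']
    exact ⟨hy, hx, by rwa [SimpleGraph.edist_comm, (edgeGraph H).edist_comm]⟩

theorem touches_iff {I : Input V} {k : ℕ} {ω : Outcome V k} {x u v : V} :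
    Touches I ω x u v ↔ ∃ j ≤ I.G.dist u v,
      IsClosest I (levelSet ω 1) (pathVert I u v j) x ∧ I.G.dist (pathVert I u v j) x ≤ 1 := by
  simp only [Touches, mem_pathVerts]
  constructor
  · rintro ⟨_, ⟨j, hj, rfl⟩, h⟩
    exact ⟨j, hj, h⟩
  · rintro ⟨j, hj, h⟩
    exact ⟨_, ⟨j, hj, rfl⟩, h⟩

theorem isClosest_self {I : Input V} {A : Finset V} {u : V} (hu : u ∈ A) :
    IsClosest I A u u := by
  refine ⟨hu, SimpleGraph.Reachable.refl _, fun w _ hr => ?_⟩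
  rw [SimpleGraph.dist_self]
  by_cases h : u = w
  · subst h; simp
  · exact Or.inl (hr.pos_dist_of_ne h)

theorem edist_touch {I : Input V} {k : ℕ} {ω : Outcome V k} {H : Finset (Sym2 V)} {w x : V}
    (hH : linkEdges I ω 1 ⊆ H) (h : IsClosest I (levelSet ω 1) w x) (h1 : I.G.dist w x ≤ 1) :
    (edgeGraph H).edist w x ≤ ((1 : ℕ) : ℕ∞) :=
  (edist_le_of_isClosest h (Finset.coe_subset.2 hH)).trans (by exact_mod_cast h1)

open scoped Classical in
/-- The positions of the edges of `P(u,v)` that are missing in `H`. -/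
def missing (I : Input V) (H : Finset (Sym2 V)) (u v : V) : Finset ℕ :=
  (Finset.range (I.G.dist u v)).filter
    fun j => s(pathVert I u v j, pathVert I u v (j + 1)) ∉ H

theorem cost_le_card_missing (I : Input V) (H : Finset (Sym2 V)) (u v : V) :
    cost I H u v ≤ (missing I H u v).card := by
  classical
  refine le_trans (Finset.card_le_card ?_) (Finset.card_image_le (s := missing I H u v)
    (f := fun j => s(pathVert I u v j, pathVert I u v (j + 1))))
  intro e he
  rw [Finset.mem_sdiff, mem_pathEdges] at he
  obtain ⟨⟨j, hj, rfl⟩, h⟩ := he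
  exact Finset.mem_image.2 ⟨j, by simp [missing, hj, h], rfl⟩

theorem abs_sub_le_of_pathVert {I : Input V} {u v : V} (h : I.G.Reachable u v) {i j m : ℕ}
    (hj : j ≤ I.G.dist u v)
    (hm : I.G.edist (pathVert I u v i) (pathVert I u v j) ≤ (m : ℕ∞)) (hij : i ≤ j) :
    j ≤ i + m := by
  have h1 := edist_pathVert_graph_le (I := I) (u := u) (v := v) (Nat.zero_le i) (hij.trans hj)
  have h2 := edist_pathVert_graph_le (I := I) (u := u) (v := v) hj le_rfl
  rw [pathVert_dist I h] at h2
  have := (edist_le_coe_iff.1 (edist_triangle_le (edist_triangle_le h1 hm) h2)).2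
  rw [pathVert_zero] at this
  omega

/-- The vertices of `V_1` that touch a path are at least a third of its missing edges. -/
theorem card_missing_lt (I : Input V) {k : ℕ} (r : ℝ) (ω : Outcome V k) {H : Finset (Sym2 V)}
    (hH : initialEdges I r ω ⊆ H) {u v : V} (h : I.G.Reachable u v) (Y : Finset V)
    (hY : ∀ y, Touches I ω y u v → y ∈ Y) (hpos : 0 < (missing I H u v).card) :
    (missing I H u v).card + 1 ≤ 3 * Y.card := by
  classical
  set J := missing I H u v with hJ
  have hne : J.Nonempty := Finset.card_pos.1 hpos
  -- The right end of the last missing edge is also near V_1; it supplies the extra 1 in the bound.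
  let J' := insert (J.max' hne + 1) J
  have hcard : J'.card = J.card + 1 := by
    refine Finset.card_insert_of_notMem ?_
    intro hmem
    have := J.le_max' _ hmem
    omega
  have hmem : ∀ j ∈ J, j < I.G.dist u v ∧
      s(pathVert I u v j, pathVert I u v (j + 1)) ∉ H := by
    intro j hj
    simpa [hJ, missing] using hj
  have hnear : ∀ j ∈ J', j ≤ I.G.dist u v ∧ Near I.G (levelSet ω 1) (pathVert I u v j) 1 := by
    intro j hj
    rcases Finset.mem_insert.1 hj with rfl | hj
    · obtain ⟨h1, h2⟩ := hmem _ (J.max'_mem hne)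
      refine ⟨h1, near_of_notMem_initialEdges I r ω (pathVert_adj I h h1).symm ?_⟩
      rw [Sym2.eq_swap]
      exact fun h => h2 (hH h)
    · obtain ⟨h1, h2⟩ := hmem _ hj
      exact ⟨h1.le, near_of_notMem_initialEdges I r ω (pathVert_adj I h h1)
        (fun h => h2 (hH h))⟩
  have hex : ∀ j ∈ J', ∃ y, IsClosest I (levelSet ω 1) (pathVert I u v j) y ∧
      I.G.dist (pathVert I u v j) y ≤ 1 := fun j hj => exists_isClosest (hnear j hj).2
  have : Nonempty V := ⟨u⟩
  choose! c hc hc1 using hex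
  rw [← hcard]
  refine (Finset.card_le_mul_card_image (f := c) J' 3 ?_).trans
    (Nat.mul_le_mul_left _ (Finset.card_le_card ?_))
  · intro y hy
    obtain ⟨j₀, hj₀, hj₀y⟩ := Finset.mem_image.1 hy
    set Fb := J'.filter fun j => c j = y
    have hFb : Fb.Nonempty := ⟨j₀, Finset.mem_filter.2 ⟨hj₀, hj₀y⟩⟩
    -- Two positions with the same vertex y at distance at most 1 are at most 2 apart on a shortest
    -- path, so each y serves at most three positions.
    have hsub : Fb ⊆ Finset.Icc (Fb.min' hFb) (Fb.min' hFb + 2) := by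
      intro j hj
      have hmin := Fb.min'_le j hj
      refine Finset.mem_Icc.2 ⟨hmin, ?_⟩
      obtain ⟨hj1, hj2⟩ := Finset.mem_filter.1 hj
      obtain ⟨hi1, hi2⟩ := Finset.mem_filter.1 (Fb.min'_mem hFb)
      have key : ∀ i ∈ J', c i = y →
          I.G.edist (pathVert I u v i) y ≤ ((1 : ℕ) : ℕ∞) := by
        intro i hi hiy
        rw [← hiy]
        exact edist_le_coe_iff.2 ⟨(hc i hi).2.1, hc1 i hi⟩
      exact abs_sub_le_of_pathVert h (hnear j hj1).1
        (edist_triangle_le (key _ hi1 hi2) (edist_symm_le (key _ hj1 hj2))) hmin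
    refine (Finset.card_le_card hsub).trans ?_
    rw [Nat.card_Icc]
    omega
  · intro y hy
    obtain ⟨j, hj, rfl⟩ := Finset.mem_image.1 hy
    exact hY _ (touches_iff.2 ⟨j, (hnear j hj).1, hc j hj, hc1 j hj⟩)

/-- A path whose endpoints are far apart in `H` is worth buying if its endpoints and all
vertices of `V_1` touching it form demand pairs. -/
theorem cost_le_value (I : Input V) {k : ℕ} (r : ℝ) (ω : Outcome V k) {H : Finset (Sym2 V)}
    (hH : initialEdges I r ω ⊆ H) {a b : V} (hab : a ≠ b) (h : I.G.Reachable a b)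
    (ha : a ∈ levelSet ω 1) (hb : b ∈ levelSet ω 1)
    (hd : sortPair a b ∈ demandPairs I ω)
    (hdy : ∀ y, Touches I ω y a b → y ≠ a → y ≠ b →
      sortPair a y ∈ demandPairs I ω ∧ sortPair y b ∈ demandPairs I ω)
    (hfar : ¬ (edgeGraph H).edist a b ≤ ((I.G.dist a b + 2 : ℕ) : ℕ∞)) :
    cost I H a b ≤ 6 * value I ω H a b := by
  classical
  have hlink : linkEdges I ω 1 ⊆ H := Finset.subset_union_right.trans hH
  have hta : Touches I ω a a b := touches_iff.2 ⟨0, Nat.zero_le _,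
    isClosest_self ha, by rw [pathVert_zero, SimpleGraph.dist_self]; exact zero_le_one⟩
  have htb : Touches I ω b a b := by
    refine touches_iff.2 ⟨I.G.dist a b, le_rfl, ?_, ?_⟩
    · rw [pathVert_dist I h]; exact isClosest_self hb
    · rw [pathVert_dist I h, SimpleGraph.dist_self]; exact zero_le_one
  set H' := H ∪ pathEdges I a b with hH'
  have hPH' : (↑(pathEdges I a b) : Set (Sym2 V)) ⊆ ↑H' :=
    Finset.coe_subset.2 Finset.subset_union_right
  have hab' : (edgeGraph H').edist a b < (edgeGraph H).edist a b := by
    refine lt_of_le_of_lt (edist_path_le h hPH') (lt_of_le_of_lt ?_ (not_le.1 hfar))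
    exact_mod_cast Nat.le_add_right _ _
  let Y := Finset.univ.filter fun y => Touches I ω y a b
  -- Each touching y ≠ a yields an improved pair. If neither {a, y} nor {y, b} improved, their
  -- distances in H would already be those in H', and passing through y would give distance at most
  -- d + 2 in H, against `hfar`.
  let f : V → V × V := fun y =>
    if (edgeGraph H').edist a y < (edgeGraph H).edist a y then sortPair a y else sortPair y b
  have hmap : ∀ y ∈ Y.erase a, f y ∈ valuePairs I ω H a b := by
    intro y hy
    obtain ⟨hya, hy⟩ := Finset.mem_erase.1 hy
    have hty : Touches I ω y a b := (Finset.mem_filter.1 hy).2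
    by_cases hyb : y = b
    · subst hyb
      simp only [f, if_pos hab']
      exact sortPair_mem_valuePairs hd hta hty hab'
    obtain ⟨hd1, hd2⟩ := hdy y hty hya hyb
    by_cases h1 : (edgeGraph H').edist a y < (edgeGraph H).edist a y
    · simp only [f, if_pos h1]
      exact sortPair_mem_valuePairs hd1 hta hty h1
    · simp only [f, if_neg h1]
      refine sortPair_mem_valuePairs hd2 hty htb ?_
      by_contra h2
      obtain ⟨j, hj, hcj, hdj⟩ := touches_iff.1 hty
      have e1 := edist_touch (hlink.trans Finset.subset_union_left : linkEdges I ω 1 ⊆ H') hcj hdj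
      have e2 := edist_pathVert_le hPH' (Nat.zero_le j) hj
      have e3 := edist_pathVert_le hPH' hj le_rfl
      rw [pathVert_dist I h] at e3
      rw [pathVert_zero] at e2
      have e4 := (not_lt.1 h1).trans (edist_triangle_le e2 e1)
      have e5 := (not_lt.1 h2).trans (edist_triangle_le (edist_symm_le e1) e3)
      exact hfar (edist_mono_coe (edist_triangle_le e4 e5) (by omega))
  have hinj : Set.InjOn f (↑(Y.erase a) : Set V) := by
    intro y hy z hz hyz
    have hya : y ≠ a := (Finset.mem_erase.1 hy).1
    have hza : z ≠ a := (Finset.mem_erase.1 hz).1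
    simp only [f] at hyz
    split_ifs at hyz
    all_goals
      have := Sym2.eq_iff.1 (sortPair_eq hyz)
      rcases this with ⟨h1, h2⟩ | ⟨h1, h2⟩ <;> grind
  have hcard := Finset.card_le_card_of_injOn f hmap hinj
  rw [card_valuePairs] at hcard
  have haY : a ∈ Y := Finset.mem_filter.2 ⟨Finset.mem_univ _, hta⟩
  have hbY : b ∈ Y.erase a :=
    Finset.mem_erase.2 ⟨hab.symm, Finset.mem_filter.2 ⟨Finset.mem_univ _, htb⟩⟩
  have hpos : 0 < (Y.erase a).card := Finset.card_pos.2 ⟨b, hbY⟩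
  rw [Finset.card_erase_of_mem haY] at hcard hpos
  refine (cost_le_card_missing I H a b).trans ?_
  -- With t touching vertices the cost is at most 3t - 1 and the value at least t - 1. Both ends
  -- touch, so t ≥ 2 and 3t - 1 ≤ 6(t - 1).
  rcases Nat.eq_zero_or_pos (missing I H a b).card with h0 | h0
  · omega
  · have := card_missing_lt I r ω hH h Y
      (fun y hy => Finset.mem_filter.2 ⟨Finset.mem_univ _, hy⟩) h0
    omega

/-- A vertex of A within j + 1 of y lies within (i + 1) + (j + 1) of p. This is the reason for the
slack 2 in the radius of `buy_connect`. -/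
theorem inBall_of_touch {I : Input V} {A : Finset V} {p q w y : V} {i j : ℕ}
    (hpw : I.G.edist p w ≤ (i : ℕ∞)) (hwq : I.G.edist w q ≤ (j : ℕ∞))
    (hwy : I.G.edist w y ≤ ((1 : ℕ) : ℕ∞)) (hN : ¬ Near I.G A p (i + j + 2)) :
    InBall I A p y ∧ InBall I A y q := by
  have hpy := edist_triangle_le hpw hwy
  refine ⟨(inBall_or_near I A hpy).resolve_right fun h => hN (h.mono (by omega)), ?_⟩
  exact (inBall_or_near I A (edist_triangle_le (edist_symm_le hwy) hwq)).resolve_right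
    fun h => hN ((h.of_edist hpy).mono (by omega))

theorem exists_buyStep (I : Input V) {k : ℕ} (r : ℝ) (ω : Outcome V k) (p : V × V) :
    ∃ H, initialEdges I r ω ⊆ H ∧ buyStep I ω H p ⊆ boughtEdges I r ω := by
  obtain ⟨l₁, l₂, hl⟩ := List.append_of_mem (I.order_complete p)
  refine ⟨l₁.foldl (buyStep I ω) (initialEdges I r ω), subset_foldl_buyStep I ω _ _, ?_⟩
  rw [boughtEdges, hl, List.foldl_append, List.foldl_cons]
  exact subset_foldl_buyStep I ω _ _

/-- The guarantee of the path-buying algorithm. -/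
theorem buy_connect (I : Input V) {k : ℕ} (r : ℝ) (ω : Outcome V k) {p q : V}
    (hp : p ∈ levelSet ω 1) (hq : q ∈ levelSet ω 1) {m : ℕ}
    (h : I.G.edist p q ≤ (m : ℕ∞)) :
    (spanner I r ω).edist p q ≤ ((m + 2 : ℕ) : ℕ∞) ∨ Near I.G (levelSet ω 2) p (m + 2) := by
  by_cases hpq : p = q
  · subst hpq; left; simp
  by_cases hN : Near I.G (levelSet ω 2) p (m + 2)
  · exact Or.inr hN
  left
  obtain ⟨hr, hdm⟩ := edist_le_coe_iff.1 h
  have hball : InBall I (levelSet ω 2) p q :=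
    (inBall_or_near I _ h).resolve_right fun h => hN (h.mono (by omega))
  -- Demand pairs are listed with the smaller vertex first, and P(a,b) need not be the reverse of
  -- P(b,a). The argument runs for the sorted pair, although the assumption on V_2 concerns p, which
  -- may be either end.
  obtain ⟨a, b, hab, hs⟩ : ∃ a b, a < b ∧ ((a = p ∧ b = q) ∨ (a = q ∧ b = p)) := by
    rcases lt_or_gt_of_ne hpq with h' | h'
    · exact ⟨p, q, h', Or.inl ⟨rfl, rfl⟩⟩
    · exact ⟨q, p, h', Or.inr ⟨rfl, rfl⟩⟩
  have hdist : I.G.dist a b = I.G.dist p q := by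
    rcases hs with ⟨rfl, rfl⟩ | ⟨rfl, rfl⟩
    · rfl
    · exact SimpleGraph.dist_comm
  have hrab : I.G.Reachable a b := by
    rcases hs with ⟨rfl, rfl⟩ | ⟨rfl, rfl⟩
    · exact hr
    · exact hr.symm
  have ha : a ∈ levelSet ω 1 := by rcases hs with ⟨rfl, rfl⟩ | ⟨rfl, rfl⟩ <;> assumption
  have hb : b ∈ levelSet ω 1 := by rcases hs with ⟨rfl, rfl⟩ | ⟨rfl, rfl⟩ <;> assumption
  have hd : sortPair a b ∈ demandPairs I ω := by
    refine sortPair_mem_demandPairs hab.ne ha hb ?_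
    rcases hs with ⟨rfl, rfl⟩ | ⟨rfl, rfl⟩
    · exact Or.inl hball
    · exact Or.inr hball
  suffices hS : (spanner I r ω).edist a b ≤ ((m + 2 : ℕ) : ℕ∞) by
    rcases hs with ⟨rfl, rfl⟩ | ⟨rfl, rfl⟩
    · exact hS
    · exact edist_symm_le hS
  obtain ⟨H, hiH, hHb⟩ := exists_buyStep I r ω (a, b)
  have hsub : H ⊆ spannerEdges I r ω :=
    (subset_buyStep I ω H (a, b)).trans (hHb.trans (boughtEdges_subset_spannerEdges I r ω))
  by_cases hfar : (edgeGraph H).edist a b ≤ ((I.G.dist a b + 2 : ℕ) : ℕ∞)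
  · exact (SimpleGraph.edist_anti (edgeGraph_mono hsub)).trans (edist_mono_coe hfar (by omega))
  have hbuy := cost_le_value I r ω hiH hab.ne hrab ha hb hd (fun y hy hya hyb => by
    have hy1 : y ∈ levelSet ω 1 := by
      obtain ⟨j, -, hc, -⟩ := touches_iff.1 hy
      exact hc.1
    obtain ⟨j, hj, hc, hd1⟩ := touches_iff.1 hy
    have hwy : I.G.edist (pathVert I a b j) y ≤ ((1 : ℕ) : ℕ∞) :=
      edist_le_coe_iff.2 ⟨hc.2.1, hd1⟩
    have e2 := edist_pathVert_graph_le (I := I) (u := a) (v := b) (Nat.zero_le j) hj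
    have e3 := edist_pathVert_graph_le (I := I) (u := a) (v := b) hj le_rfl
    rw [pathVert_dist I hrab] at e3
    rw [pathVert_zero] at e2
    rcases hs with ⟨rfl, rfl⟩ | ⟨rfl, rfl⟩
    · obtain ⟨b1, b2⟩ := inBall_of_touch e2 e3 hwy (fun h => hN (h.mono (by omega)))
      exact ⟨sortPair_mem_demandPairs hya.symm ha hy1 (Or.inl b1),
        sortPair_mem_demandPairs hyb hy1 hb (Or.inl b2)⟩
    · obtain ⟨b1, b2⟩ := inBall_of_touch (edist_symm_le e3) (edist_symm_le e2) hwy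
        (fun h => hN (h.mono (by omega)))
      exact ⟨sortPair_mem_demandPairs hya.symm ha hy1 (Or.inr b2),
        sortPair_mem_demandPairs hyb hy1 hb (Or.inr b1)⟩) hfar
  have hP : pathEdges I a b ⊆ spannerEdges I r ω := by
    refine subset_trans ?_ (hHb.trans (boughtEdges_subset_spannerEdges I r ω))
    unfold buyStep
    rw [if_pos]
    · exact Finset.subset_union_right
    · refine ⟨?_, hbuy⟩
      simpa [sortPair, hab.le] using hd
  exact (edist_path_le hrab (Finset.coe_subset.2 hP)).trans (by exact_mod_cast (by omega))

open scoped Classical in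
/-- The number of times the distance of a pair can still drop below its distance plus five. -/
def potential (I : Input V) (H : Finset (Sym2 V)) (p : V × V) : ℕ :=
  ((Finset.range 5).filter fun j =>
    ((I.G.dist p.1 p.2 + j : ℕ) : ℕ∞) < (edgeGraph H).edist p.1 p.2).card

theorem potential_anti (I : Input V) {H H' : Finset (Sym2 V)} (h : H ⊆ H') (p : V × V) :
    potential I H' p ≤ potential I H p := by
  refine Finset.card_le_card fun j hj => ?_
  rw [Finset.mem_filter] at hj ⊢
  exact ⟨hj.1, hj.2.trans_le (SimpleGraph.edist_anti (edgeGraph_mono h))⟩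

theorem potential_le (I : Input V) (H : Finset (Sym2 V)) (p : V × V) : potential I H p ≤ 5 :=
  (Finset.card_filter_le _ _).trans (by simp)

/-- Both vertices of an improved pair hang on the bought shortest path by links of length at most 1.
The piece of the path between them has length at most their distance plus 2, so the new distance
exceeds the true one by at most 4. The index equal to this new excess is counted before the purchase
and not after it. -/
theorem potential_lt (I : Input V) {k : ℕ} (ω : Outcome V k) {H : Finset (Sym2 V)}
    (hHG : (↑H : Set (Sym2 V)) ⊆ I.G.edgeSet) (hlink : linkEdges I ω 1 ⊆ H) {u v : V}
    {p : V × V} (hp : p ∈ valuePairs I ω H u v) :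
    potential I (H ∪ pathEdges I u v) p < potential I H p := by
  classical
  unfold valuePairs at hp
  obtain ⟨-, ht1, ht2, hlt⟩ := Finset.mem_filter.1 hp
  set H' := H ∪ pathEdges I u v with hH'
  have hH'G : edgeGraph H' ≤ I.G := by
    refine fromEdgeSet_le ?_
    rw [hH', Finset.coe_union]
    exact Set.union_subset hHG (pathEdges_subset I u v)
  have hlink' : linkEdges I ω 1 ⊆ H' := hlink.trans Finset.subset_union_left
  have hPH' : (↑(pathEdges I u v) : Set (Sym2 V)) ⊆ ↑H' :=
    Finset.coe_subset.2 Finset.subset_union_right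
  obtain ⟨i, hi, hci, hdi⟩ := touches_iff.1 ht1
  obtain ⟨j, hj, hcj, hdj⟩ := touches_iff.1 ht2
  have e1 := edist_touch hlink' hci hdi
  have e2 := edist_touch hlink' hcj hdj
  have hreach : (edgeGraph H').Reachable p.1 p.2 :=
    SimpleGraph.reachable_of_edist_ne_top (ne_top_of_lt hlt)
  have hreachG := hreach.mono hH'G
  have key : ∀ i j x y, i ≤ j → j ≤ I.G.dist u v →
      (edgeGraph H').edist (pathVert I u v i) x ≤ ((1 : ℕ) : ℕ∞) →
      (edgeGraph H').edist (pathVert I u v j) y ≤ ((1 : ℕ) : ℕ∞) → I.G.Reachable x y →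
      (edgeGraph H').edist x y ≤ ((I.G.dist x y + 4 : ℕ) : ℕ∞) := by
    intro i j x y hij hj hx hy hxy
    have hx' := (SimpleGraph.edist_anti hH'G).trans hx
    have hy' := (SimpleGraph.edist_anti hH'G).trans hy
    have hle : j ≤ i + (1 + I.G.dist x y + 1) := by
      by_cases h0 : I.G.dist u v = 0
      · omega
      · exact abs_sub_le_of_pathVert (SimpleGraph.Reachable.of_dist_ne_zero h0) hj
          (edist_triangle_le (edist_triangle_le hx' (edist_eq_coe_dist hxy).le)
            (edist_symm_le hy')) hij
    have := edist_pathVert_le hPH' hij hj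
    exact edist_mono_coe (edist_triangle_le (edist_triangle_le (edist_symm_le hx) this) hy)
      (by omega)
  have hub : (edgeGraph H').edist p.1 p.2 ≤ ((I.G.dist p.1 p.2 + 4 : ℕ) : ℕ∞) := by
    rcases le_total i j with hij | hij
    · exact key i j _ _ hij hj e1 e2 hreachG
    · have := key j i _ _ hij hi e2 e1 hreachG.symm
      rw [SimpleGraph.edist_comm, SimpleGraph.dist_comm]
      exact this
  have hd' := (edist_le_coe_iff.1 hub).2
  have hlow : I.G.dist p.1 p.2 ≤ (edgeGraph H').dist p.1 p.2 :=
    SimpleGraph.Reachable.dist_anti hH'G hreach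
  rw [edist_eq_coe_dist hreach] at hlt
  refine Finset.card_lt_card ?_
  rw [Finset.ssubset_iff_of_subset]
  · refine ⟨(edgeGraph H').dist p.1 p.2 - I.G.dist p.1 p.2, ?_, ?_⟩
    · rw [Finset.mem_filter, Nat.add_sub_cancel' hlow]
      exact ⟨Finset.mem_range.2 (by omega), hlt⟩
    · rw [Finset.mem_filter, Nat.add_sub_cancel' hlow, edist_eq_coe_dist hreach]
      exact fun h => lt_irrefl _ h.2
  · intro j hj
    rw [Finset.mem_filter] at hj ⊢
    exact ⟨hj.1, hj.2.trans_le
      (SimpleGraph.edist_anti (edgeGraph_mono Finset.subset_union_left))⟩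

/-- Amortization: a purchase adds at most 6 edges per improved pair, and each of these pairs loses
at least one unit of potential. -/
theorem card_buyStep_le (I : Input V) {k : ℕ} (ω : Outcome V k) {H : Finset (Sym2 V)}
    (hHG : (↑H : Set (Sym2 V)) ⊆ I.G.edgeSet) (hlink : linkEdges I ω 1 ⊆ H) (p : V × V) :
    (buyStep I ω H p).card + 6 * ∑ x ∈ demandPairs I ω, potential I (buyStep I ω H p) x ≤
      H.card + 6 * ∑ x ∈ demandPairs I ω, potential I H x := by
  classical
  unfold buyStep
  split_ifs with h
  · have h1 : (H ∪ pathEdges I p.1 p.2).card = cost I H p.1 p.2 + H.card := by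
      rw [Finset.union_comm, ← Finset.card_sdiff_add_card]
      congr 1
    have h2 : value I ω H p.1 p.2 +
        ∑ x ∈ demandPairs I ω, potential I (H ∪ pathEdges I p.1 p.2) x ≤
        ∑ x ∈ demandPairs I ω, potential I H x := by
      have h3 : value I ω H p.1 p.2 = ∑ x ∈ demandPairs I ω,
          if x ∈ valuePairs I ω H p.1 p.2 then 1 else 0 := by
        rw [← card_valuePairs, ← Finset.card_filter]
        congr 1
        ext x
        simp only [Finset.mem_filter]
        exact ⟨fun h => ⟨(Finset.mem_filter.1 h).1, h⟩, fun h => h.2⟩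
      rw [h3, ← Finset.sum_add_distrib]
      refine Finset.sum_le_sum fun x _ => ?_
      split_ifs with hx
      · have := potential_lt I ω hHG hlink hx
        omega
      · have := potential_anti I (Finset.subset_union_left :
          H ⊆ H ∪ pathEdges I p.1 p.2) x
        omega
    have h4 := h.2
    rw [h1]
    omega
  · exact le_rfl

/-- The number of edges bought is linear in the number of demand pairs. -/
theorem card_boughtEdges_le (I : Input V) {k : ℕ} (r : ℝ) (ω : Outcome V k) :
    (boughtEdges I r ω).card ≤ (initialEdges I r ω).card + 30 * (demandPairs I ω).card := by
  have key : ∀ (l : List (V × V)) (H : Finset (Sym2 V)), (↑H : Set (Sym2 V)) ⊆ I.G.edgeSet →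
      linkEdges I ω 1 ⊆ H → (l.foldl (buyStep I ω) H).card ≤
        H.card + 6 * ∑ x ∈ demandPairs I ω, potential I H x := by
    intro l
    induction l with
    | nil => intro H _ _; simp
    | cons p l ih =>
      intro H hHG hlink
      exact (ih _ (buyStep_subset I ω p hHG) (hlink.trans (subset_buyStep I ω H p))).trans
        (card_buyStep_le I ω hHG hlink p)
  refine (key _ _ (initialEdges_subset I r ω) Finset.subset_union_right).trans ?_
  have : ∑ x ∈ demandPairs I ω, potential I (initialEdges I r ω) x ≤
      (demandPairs I ω).card * 5 := by
    simpa using Finset.sum_le_card_nsmul _ _ 5 (fun x _ => potential_le I _ x)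
  omega

end Buying


/-! ### Unconditional additive errors and their concatenation. -/

section Levels

variable {V : Type u}

theorem not_near_empty {G : SimpleGraph V} {u : V} {m : ℕ} : ¬ Near G (∅ : Finset V) u m := by
  rintro ⟨w, hw, -⟩
  exact absurd hw (Finset.notMem_empty w)

/-- Distance at most `D` in `G` is preserved in `S` up to an additive error `E`. -/
def Additive (G S : SimpleGraph V) (D E : ℕ) : Prop :=
  ∀ m ≤ D, ∀ x y, G.edist x y ≤ (m : ℕ∞) → S.edist x y ≤ ((m + E : ℕ) : ℕ∞)

theorem Covers.additive {G S : SimpleGraph V} {D E r : ℕ} (h : Covers G S ∅ D E r) :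
    Additive G S D E :=
  fun m hm x y hxy => (h m hm x y hxy).resolve_right not_near_empty

theorem exists_split {G : SimpleGraph V} {x y : V} {a b : ℕ}
    (h : G.edist x y ≤ ((a + b : ℕ) : ℕ∞)) :
    ∃ z, G.edist x z ≤ (a : ℕ∞) ∧ G.edist z y ≤ (b : ℕ∞) := by
  obtain ⟨w, rfl, rfl, hw⟩ := exists_walk_seq h
  exact ⟨w a, by simpa using hw 0 a (Nat.zero_le _), by simpa using hw a (a + b) (by omega)⟩

theorem Additive.add {G S : SimpleGraph V} {D E D' E' : ℕ} (h : Additive G S D E)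
    (h' : Additive G S D' E') : Additive G S (D + D') (E + E') := by
  intro m hm x y hxy
  have e : m = min m D + (m - D) := by omega
  rw [e] at hxy
  obtain ⟨z, h1, h2⟩ := exists_split hxy
  exact edist_mono_coe (edist_triangle_le (h _ (by omega) _ _ h1) (h' _ (by omega) _ _ h2))
    (by omega)

theorem Additive.mul {G S : SimpleGraph V} {D E : ℕ} (h : Additive G S D E) (q : ℕ) :
    Additive G S (q * D) (q * E) := by
  induction q with
  | zero =>
    intro m hm x y hxy
    obtain rfl : m = 0 := by omega
    have : G.edist x y = 0 := by simpa using hxy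
    rw [SimpleGraph.edist_eq_zero_iff] at this
    subst this
    simp
  | succ q ih =>
    rw [Nat.succ_mul, Nat.succ_mul]
    exact ih.add h

theorem Additive.mono {G S : SimpleGraph V} {D E D' E' : ℕ} (h : Additive G S D E) (hD : D' ≤ D)
    (hE : E ≤ E') : Additive G S D' E' :=
  fun m hm x y hxy => edist_mono_coe (h m (hm.trans hD) x y hxy) (by omega)

theorem Additive.distLE {G S : SimpleGraph V} {D E : ℕ} (h : Additive G S D E) {u v : V}
    (hr : G.Reachable u v) (hD : G.dist u v ≤ D) {x : ℝ}
    (hx : (G.dist u v : ℝ) + E ≤ x) : DistLE S u v x := by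
  obtain ⟨h1, h2⟩ := edist_le_coe_iff.1 (h _ hD u v (edist_eq_coe_dist hr).le)
  refine ⟨h1, le_trans ?_ hx⟩
  exact_mod_cast h2

end Levels

/-! ### The recursion with scales 3^j and L^j. -/

section Regimes

variable {V : Type u} [Fintype V] [LinearOrder V]

/-- Path buying examines pairs at every distance, so R is arbitrary on level 1. -/
theorem layer_one (I : Input V) {k : ℕ} (r : ℝ) (ω : Outcome V k) (hk : 1 ≤ k) (R : ℝ) :
    Layer I.G (spanner I r ω) (levelSet ω 1) (levelSet ω 2) R 2 where
  link _ _ h := exists_link I r ω le_rfl hk h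
  connect _ hp _ hq _ _ h := buy_connect I r ω hp hq h
  le := spanner_le I r ω

theorem layer_of_two_le (I : Input V) {k : ℕ} (r : ℝ) (ω : Outcome V k) {i : ℕ} (h2 : 2 ≤ i)
    (hk : i ≤ k) : Layer I.G (spanner I r ω) (levelSet ω i) (levelSet ω (i + 1))
      ((r + 2) ^ i) 0 where
  link _ _ h := exists_link I r ω (by omega) hk h
  connect _ hp _ hq _ hm h := ball_connect I r ω h2 hk hp hq hm h
  le := spanner_le I r ω

theorem covers_edges (I : Input V) {k : ℕ} (r : ℝ) (ω : Outcome V k) :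
    Covers I.G (spanner I r ω) (levelSet ω 1) 1 0 1 := by
  intro m hm x y hxy
  rcases Nat.le_one_iff_eq_zero_or_eq_one.1 hm with rfl | rfl
  · left
    have : I.G.edist x y = 0 := by simpa using hxy
    rw [SimpleGraph.edist_eq_zero_iff] at this
    subst this
    simp
  · rcases SimpleGraph.edist_le_one_iff_adj_or_eq.1 (by exact_mod_cast hxy) with h | rfl
    · by_cases he : s(x, y) ∈ initialEdges I r ω
      · left
        refine (SimpleGraph.edist_eq_one_iff_adj.2 ?_).le.trans (by simp)
        rw [spanner, SimpleGraph.fromEdgeSet_adj]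
        exact ⟨boughtEdges_subset_spannerEdges I r ω
          (initialEdges_subset_boughtEdges I r ω he), h.ne⟩
      · exact Or.inr (near_of_notMem_initialEdges I r ω h he)
    · left
      simp

/-- Segments are single edges: an edge is in F_0 or starts at distance at most 1 from V_1, so
crossing costs nothing and a jump costs 4 + 2. The error does not depend on D. -/
theorem covers_one (I : Input V) {k : ℕ} (r : ℝ) (ω : Outcome V k) (hk : 1 ≤ k) (D : ℕ) :
    Covers I.G (spanner I r ω) (levelSet ω 2) D 6 (D + 5) :=
  ((layer_one I r ω hk _).covers_step (covers_edges I r ω) D D (by omega) le_rfl).mono le_rfl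
    (by simp) (by omega)

/-- The radius condition of `small_regime` divided by 3^(k+1), in the worst case x = 1/5. At k = 1
it is an equality, which is where 1/5 comes from. -/
theorem add_pow_radius {k : ℕ} (hk : 1 ≤ k) :
    1 / 5 * (1 + 2 * (k : ℝ) / 3) + 13 / 9 ≤ (4 / 3 : ℝ) ^ (k + 1) := by
  obtain ⟨j, rfl⟩ : ∃ j, k = j + 1 := ⟨k - 1, by omega⟩
  have h := one_add_mul_le_pow (a := (1 / 3 : ℝ)) (by norm_num) j
  have h' : (4 / 3 : ℝ) ^ (j + 1 + 1) = (1 + 1 / 3) ^ j * (16 / 9) := by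
    rw [pow_add, pow_add]; norm_num; ring
  rw [h']
  push_cast
  have hj : (0 : ℝ) ≤ j := Nat.cast_nonneg j
  nlinarith

/-- The error at scales up to `3^k`, valid for all `r ≥ 2`. -/
theorem small_regime (I : Input V) {k : ℕ} {r : ℝ} (ω : Outcome V k) (hk : 2 ≤ k) (hr : 2 ≤ r)
    {m : ℕ} (hm : m ≤ 3 ^ k) :
    ∃ D E : ℕ, (m : ℝ) / 5 ≤ D ∧ (E : ℝ) ≤ k * m + 10 * 3 ^ k ∧
      Additive I.G (spanner I r ω) D E := by
  set x : ℝ := m / (5 * 3 ^ k) with hx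
  have h3 : (0 : ℝ) < 3 ^ k := by positivity
  have hx0 : 0 ≤ x := by positivity
  have hx5 : x ≤ 1 / 5 := by
    rw [hx, div_le_iff₀ (by positivity)]
    have : (m : ℝ) ≤ 3 ^ k := by exact_mod_cast hm
    linarith
  have hxm : x * 3 ^ k = m / 5 := by rw [hx]; field_simp
  let D : ℕ → ℕ := fun j => ⌈x * 3 ^ j⌉₊
  have hD : ∀ j, (D j : ℝ) ≤ x * 3 ^ j + 1 :=
    fun j => (Nat.ceil_lt_add_one (by positivity)).le
  have hD3 : ∀ j, D (j + 1) ≤ 3 * D j := by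
    intro j
    refine Nat.ceil_le.2 ?_
    push_cast
    have := Nat.le_ceil (x * 3 ^ j)
    rw [pow_succ]
    linarith
  set Y : ℝ := 4 * (k * x + 5 / 2) with hY
  -- Radii satisfy q_{j+1} = D_{j+1} + 3 q_j. The term -1/2 absorbs the rounding of D_{j+1}, since 1
  -- - 3/2 = -1/2, and 13/6 fits q_1 = D_1 + 5. As 4q ≤ 3^j Y, the bound E ≤ 3^j Y survives both 3E
  -- and 2E + 4q.
  have key : ∀ j, 1 ≤ j → j ≤ k → ∃ E q : ℕ,
      Covers I.G (spanner I r ω) (levelSet ω (j + 1)) (D j) E q ∧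
      (q : ℝ) ≤ 3 ^ j * (j * x + 13 / 6) - 1 / 2 ∧ (E : ℝ) ≤ 3 ^ j * Y := by
    intro j hj
    induction j, hj using Nat.le_induction with
    | base =>
      intro _
      refine ⟨6, D 1 + 5, covers_one I r ω (by omega) _, ?_, ?_⟩
      · have := hD 1
        push_cast
        linarith
      · have : 0 ≤ (k : ℝ) * x := by positivity
        push_cast
        rw [hY]
        linarith
    | succ j hj ih =>
      intro hjk
      obtain ⟨E, q, hc, hq, hE⟩ := ih (by omega)
      have hR : ((D (j + 1) + 2 * q : ℕ) : ℝ) ≤ (r + 2) ^ (j + 1) := by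
        have h1 := hD (j + 1)
        have h2 : (4 : ℝ) ^ (j + 1) ≤ (r + 2) ^ (j + 1) :=
          pow_le_pow_left₀ (by norm_num) (by linarith) _
        have h4 : (4 : ℝ) ^ (j + 1) = (4 / 3) ^ (j + 1) * 3 ^ (j + 1) := by
          rw [← mul_pow]; norm_num
        have h5 := add_pow_radius hj
        have h6 : x * (1 + 2 * (j : ℝ) / 3) + 13 / 9 ≤ (4 / 3 : ℝ) ^ (j + 1) := by
          refine le_trans ?_ h5
          have : (0 : ℝ) ≤ 1 + 2 * (j : ℝ) / 3 := by positivity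
          have := mul_le_mul_of_nonneg_right hx5 this
          linarith
        have h7 := mul_le_mul_of_nonneg_right h6 (by positivity : (0 : ℝ) ≤ 3 ^ (j + 1))
        refine le_trans ?_ h2
        rw [h4]
        refine le_trans ?_ h7
        push_cast
        rw [pow_succ] at h1 ⊢
        linarith
      refine ⟨_, _, (layer_of_two_le I r ω (by omega) hjk).covers_step hc 3 (D (j + 1))
        (hD3 j) hR, ?_, ?_⟩
      · have h1 := hD (j + 1)
        push_cast
        rw [pow_succ] at h1 ⊢
        linarith
      · have hjk' : (j : ℝ) * x ≤ k * x := by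
          refine mul_le_mul_of_nonneg_right ?_ hx0
          exact_mod_cast (by omega : j ≤ k)
        have h3j : (0 : ℝ) < 3 ^ j := by positivity
        have h8 : (3 : ℝ) ^ j * (j * x) ≤ 3 ^ j * (k * x) :=
          mul_le_mul_of_nonneg_left hjk' h3j.le
        push_cast
        refine max_le ?_ ?_
        · rw [pow_succ]
          linarith
        · rw [pow_succ]
          rw [hY] at hE ⊢
          norm_num
          linarith
  obtain ⟨E, q, hc, -, hE⟩ := key k (by omega) le_rfl
  rw [levelSet_above] at hc
  refine ⟨D k, E, ?_, ?_, hc.additive⟩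
  · rw [← hxm]
    exact Nat.le_ceil _
  · refine hE.trans ?_
    have e : (3 : ℝ) ^ k * Y = 4 * (k * (x * 3 ^ k)) + 10 * 3 ^ k := by rw [hY]; ring
    rw [e, hxm]
    have : (0 : ℝ) ≤ k * m := by positivity
    linarith

/-- The first inequality is the radius condition of the next layer; it propagates on multiplication
by L + 2, which explains the range (r+2)^i of F_i. The radius bound survives because 3(L + 12) ≤ 12L
for L ≥ 4. The errors follow max(LE, (L-1)E + 4q): the constant 4L + 48 is a fixed point, while the
cruder LE + 4q grows by 4(L + 12) per level. The former gives the factor 5 + C/l, the latter 1 + (4k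
+ C)/l. -/
theorem exists_covers_pow (I : Input V) {k : ℕ} {r : ℝ} (ω : Outcome V k) {L : ℕ} (hL : 4 ≤ L)
    (hLr : (L : ℝ) ≤ r) (j : ℕ) (hj : 1 ≤ j) (hjk : j ≤ k) :
    ∃ E q : ℕ, Covers I.G (spanner I r ω) (levelSet ω (j + 1)) (L ^ j) E q ∧
      L ^ (j + 1) + 2 * q ≤ (L + 2) ^ (j + 1) ∧ L * q ≤ L ^ j * (L + 12) ∧
      L * E ≤ L ^ j * (4 * L + 48) ∧ L ^ 2 * E ≤ L ^ j * (4 * j * (L + 12) + 2 * L) := by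
  induction j, hj using Nat.le_induction with
  | base =>
    refine ⟨6, L ^ 1 + 5, covers_one I r ω (by omega) _, ?_, ?_, ?_, ?_⟩
    · ring_nf; linarith
    all_goals nlinarith
  | succ j hj ih =>
    obtain ⟨E, q, hc, h1, h2, h3, h4⟩ := ih (by omega)
    have hR : ((L ^ (j + 1) + 2 * q : ℕ) : ℝ) ≤ (r + 2) ^ (j + 1) := by
      refine le_trans (b := ((L : ℝ) + 2) ^ (j + 1)) (by exact_mod_cast h1) ?_
      exact pow_le_pow_left₀ (by positivity) (by linarith) _
    refine ⟨_, _, (layer_of_two_le I r ω (by omega) hjk).covers_step hc L (L ^ (j + 1))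
      (by rw [pow_succ, mul_comm]) hR, ?_, ?_, ?_, ?_⟩
    · have e1 : (L + 2) ^ (j + 1 + 1) = (L + 2) * (L + 2) ^ (j + 1) := by ring
      have e2 : L ^ (j + 1 + 1) = L * L ^ (j + 1) := by ring
      have h5 := Nat.mul_le_mul_left (L + 2) h1
      have h6 : 4 * q ≤ L * q := Nat.mul_le_mul_right q hL
      rw [e1, e2]
      refine le_trans ?_ h5
      nlinarith
    · have h5 : L ^ j * (3 * L + 36) ≤ L ^ j * (12 * L) := Nat.mul_le_mul_left _ (by omega)
      rw [pow_succ]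
      nlinarith
    · set X := L ^ j * (4 * L + 48) with hX
      have e1 : L ^ (j + 1) * (4 * L + 48) = L * X := by rw [hX]; ring
      rw [e1]
      rcases max_choice (L * E) ((L - 1) * E + 4 * q + 0) with h | h <;> rw [h]
      · exact Nat.mul_le_mul_left L h3
      · have h5 := Nat.mul_le_mul_left (L - 1) h3
        have h6 : (L - 1) * X + X = L * X := by
          rw [← Nat.succ_mul, Nat.succ_eq_add_one, Nat.sub_add_cancel (by omega)]
        have h7 : L * ((L - 1) * E + 4 * q + 0) = (L - 1) * (L * E) + 4 * (L * q) := by ring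
        have h8 : X = 4 * (L ^ j * (L + 12)) := by rw [hX]; ring
        omega
    · have h5 : max (L * E) ((L - 1) * E + 4 * q + 0) ≤ L * E + 4 * q := by
        have : (L - 1) * E ≤ L * E := Nat.mul_le_mul_right E (by omega)
        omega
      refine (Nat.mul_le_mul_left _ h5).trans ?_
      have h6 := Nat.mul_le_mul_left L h4
      have h7 := Nat.mul_le_mul_left (4 * L) h2
      calc L ^ 2 * (L * E + 4 * q) = L * (L ^ 2 * E) + 4 * L * (L * q) := by ring
        _ ≤ L * (L ^ j * (4 * j * (L + 12) + 2 * L)) + 4 * L * (L ^ j * (L + 12)) :=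
          add_le_add h6 h7
        _ = _ := by ring

/-- The error at large distances for an integer scale `4 ≤ L ≤ r`. -/
theorem large_regime (I : Input V) {k : ℕ} {r : ℝ} (ω : Outcome V k) (hk : 2 ≤ k) {L : ℕ}
    (hL : 4 ≤ L) (hLr : (L : ℝ) ≤ r) {d : ℕ} (hd : L ^ k ≤ d) :
    ∃ T : ℕ, Additive I.G (spanner I r ω) d T ∧ (T : ℝ) ≤ (4 + 80 / L) * d ∧
      (T : ℝ) ≤ (4 * k + 48 * k / L + 34) / L * d := by
  obtain ⟨E₁, q₁, hc₁, -, -, h3₁, h4₁⟩ := exists_covers_pow I ω hL hLr k (by omega) le_rfl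
  obtain ⟨E, q, hc, h1, h2, h3, h4⟩ :=
    exists_covers_pow I ω hL hLr (k - 1) (by omega) (by omega)
  rw [levelSet_above] at hc₁
  rw [Nat.sub_add_cancel (by omega)] at hc h1
  set P := L ^ (k - 1) with hP
  have hLk : L ^ k = L * P := by
    rw [hP, ← pow_succ', Nat.sub_add_cancel (by omega)]
  have hPpos : 0 < P := by positivity
  have hdiv : L ^ k * (d / L ^ k) + d % L ^ k = d := Nat.div_add_mod _ _
  set a := d / L ^ k
  set b := d % L ^ k with hb
  have hbL : b < L ^ k := Nat.mod_lt _ (by positivity)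
  have hbdiv : P * (b / P) + b % P = b := Nat.div_add_mod _ _
  have hbmod : b % P < P := Nat.mod_lt _ hPpos
  set c := b / P
  have hR : ((b + 2 * q : ℕ) : ℝ) ≤ (r + 2) ^ k := by
    refine le_trans (b := ((L : ℝ) + 2) ^ k) (by exact_mod_cast (by omega)) ?_
    exact pow_le_pow_left₀ (by positivity) (by linarith) _
  have hbc : b ≤ (c + 1) * P := by
    have : (c + 1) * P = P * c + P := by ring
    omega
  have hcb := (layer_of_two_le I r ω hk le_rfl).covers_step hc (c + 1) b
    hbc hR
  rw [levelSet_above] at hcb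
  have hmax : max ((c + 1) * E) ((c + 1 - 1) * E + 4 * q + 0) ≤ (c + 1) * E + 4 * q := by
    have : (c + 1 - 1) * E ≤ (c + 1) * E := Nat.mul_le_mul_right E (Nat.sub_le _ _)
    omega
  -- The distance splits as d = a L^k + b: a full blocks, then one chain of c + 1 segments of length
  -- P for the rest. The surplus E + 4q ≤ 32P is at most 32d/L because d ≥ L^k.
  refine ⟨a * E₁ + ((c + 1) * E + 4 * q), ?_, ?_⟩
  · refine ((hc₁.additive.mul a).add (hcb.additive.mono le_rfl hmax)).mono ?_ le_rfl
    rw [mul_comm]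
    omega
  have hL0 : (0 : ℝ) < L := by positivity
  have hL4 : (4 : ℝ) ≤ L := by exact_mod_cast hL
  have hdP : (P : ℝ) ≤ d / L := by
    rw [le_div_iff₀ hL0]
    have : L * P ≤ d := hLk ▸ hd
    rw [mul_comm]
    exact_mod_cast this
  have hE16 : (E : ℝ) ≤ 16 * P := by
    have h5 : (L : ℝ) * E ≤ P * (4 * L + 48) := by exact_mod_cast h3
    have h6 : (P : ℝ) * (4 * L + 48) ≤ P * (16 * L) :=
      mul_le_mul_of_nonneg_left (by linarith) (by positivity)
    refine le_of_mul_le_mul_left (a := (L : ℝ)) ?_ hL0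
    linarith
  have hq16 : (4 * q : ℝ) ≤ 16 * P := by
    have h5 : (L : ℝ) * q ≤ P * (L + 12) := by exact_mod_cast h2
    have h6 : (P : ℝ) * (L + 12) ≤ P * (4 * L) :=
      mul_le_mul_of_nonneg_left (by linarith) (by positivity)
    refine le_of_mul_le_mul_left (a := (L : ℝ)) ?_ hL0
    linarith
  have key : ∀ X : ℝ, 0 ≤ X → (E₁ : ℝ) ≤ X * (L ^ k : ℕ) → (E : ℝ) ≤ X * P →
      ((a * E₁ + ((c + 1) * E + 4 * q) : ℕ) : ℝ) ≤ (X + 32 / L) * d := by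
    intro X hX h5 h6
    have h7 : (a : ℝ) * E₁ ≤ a * (X * (L ^ k : ℕ)) :=
      mul_le_mul_of_nonneg_left h5 (by positivity)
    have h8 : (c : ℝ) * E ≤ c * (X * P) := mul_le_mul_of_nonneg_left h6 (by positivity)
    have h9 : ((L ^ k : ℕ) : ℝ) * a + P * c ≤ d := by
      exact_mod_cast (by omega : L ^ k * a + P * c ≤ d)
    have h10 := mul_le_mul_of_nonneg_left h9 hX
    have h11 : (X + 32 / (L : ℝ)) * d = X * d + 32 * (d / L) := by ring
    rw [h11]
    push_cast at h7 h10 ⊢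
    nlinarith
  constructor
  · have h5 := key ((4 * L + 48) / L) (by positivity) ?_ ?_
    · refine h5.trans (le_of_eq ?_)
      field_simp
      ring
    · rw [div_mul_eq_mul_div, le_div_iff₀ hL0, mul_comm, mul_comm (4 * (L : ℝ) + 48)]
      exact_mod_cast h3₁
    · rw [div_mul_eq_mul_div, le_div_iff₀ hL0, mul_comm, mul_comm (4 * (L : ℝ) + 48)]
      exact_mod_cast h3
  · have h5 := key ((4 * k * (L + 12) + 2 * L) / L ^ 2) (by positivity) ?_ ?_
    · refine h5.trans (le_of_eq ?_)
      field_simp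
      ring
    · rw [div_mul_eq_mul_div, le_div_iff₀ (by positivity), mul_comm,
        mul_comm (4 * (k : ℝ) * (L + 12) + 2 * L)]
      exact_mod_cast h4₁
    · rw [div_mul_eq_mul_div, le_div_iff₀ (by positivity), mul_comm,
        mul_comm (4 * (k : ℝ) * (L + 12) + 2 * L)]
      have h6 : L ^ 2 * E ≤ P * (4 * k * (L + 12) + 2 * L) := by
        refine h4.trans (Nat.mul_le_mul_left _ ?_)
        have : 4 * (k - 1) * (L + 12) ≤ 4 * k * (L + 12) :=
          Nat.mul_le_mul_right _ (by omega)
        omega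
      exact_mod_cast h6

end Regimes


/-! ### The recursion with the sharp leading constant 4. -/

section Fine

/-- The first two binomial terms; the second one makes room for twice the radius in the range
(r+2)^i. -/
theorem pow_add_le_add_two_pow {x : ℝ} (hx : 0 ≤ x) (j : ℕ) :
    x ^ (j + 1) + 2 * (j + 1) * x ^ j ≤ (x + 2) ^ (j + 1) := by
  induction j with
  | zero => simp
  | succ j ih =>
    have h := mul_le_mul_of_nonneg_left ih (by linarith : 0 ≤ x + 2)
    have h1 : 0 ≤ x ^ j := by positivity
    have h2 : (0 : ℝ) ≤ j := Nat.cast_nonneg j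
    have h3 : 0 ≤ (j : ℝ) * x ^ j := by positivity
    rw [pow_succ' (x + 2)]
    refine le_trans ?_ h
    push_cast
    rw [pow_succ x (j + 1), pow_succ x j]
    nlinarith

variable {V : Type u} [Fintype V] [LinearOrder V]

theorem covers_two (I : Input V) {k : ℕ} {r : ℝ} (ω : Outcome V k) (hk : 2 ≤ k) (M n : ℕ)
    (hn : n ≤ 3 * M ^ 2) (hR : ((n + 6 * M + 13 : ℕ) : ℝ) ≤ (r + 2) ^ 2) :
    Covers I.G (spanner I r ω) (levelSet ω 3) n (12 * M + 26) (n + 12 * M + 26) :=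
  (layer_of_two_le I r ω le_rfl hk).covers_arith (covers_one I r ω (by omega)) M n hn hR

/-- Starting at j = 2 from `covers_two`, with error at most 8L instead of about 10L for equal
segments, removes the surplus 2L of `exists_covers_pow` and leaves 4j as leading coefficient. -/
theorem exists_covers_pow_fine (I : Input V) {k : ℕ} {r : ℝ} (ω : Outcome V k) {L : ℕ}
    (hL : 50 ≤ L) (hLr : (L : ℝ) ≤ r) (j : ℕ) (hj : 2 ≤ j) (hjk : j ≤ k) :
    ∃ E q : ℕ, Covers I.G (spanner I r ω) (levelSet ω (j + 1)) (L ^ j) E q ∧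
      L * q ≤ L ^ j * (L + 8) ∧ L ^ 2 * E ≤ L ^ j * (4 * j * L + 32 * j) := by
  induction j, hj using Nat.le_induction with
  | base =>
    -- M ≥ 3L/5 gives 3M² ≥ L², and 12M + 26 ≤ 7.2L + 38 ≤ 8L once L ≥ 50.
    set M := 3 * L / 5 + 1 with hM
    have hM1 : 3 * L ≤ 5 * M := by omega
    have hM2 : 12 * M + 26 ≤ 8 * L := by omega
    refine ⟨_, _, covers_two I ω hjk M (L ^ 2) (by nlinarith) ?_, ?_, ?_⟩
    · refine le_trans (b := ((L : ℝ) + 2) ^ 2) ?_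
        (pow_le_pow_left₀ (by positivity) (by linarith) _)
      have : L ^ 2 + 6 * M + 13 ≤ (L + 2) ^ 2 := by
        have : (L + 2) ^ 2 = L ^ 2 + 4 * L + 4 := by ring
        omega
      exact_mod_cast this
    · nlinarith
    · nlinarith
  | succ j hj ih =>
    obtain ⟨E, q, hc, h2, h4⟩ := ih (by omega)
    have hLpos : 0 < L := by omega
    have hq : q ≤ 2 * L ^ j := by
      refine le_of_mul_le_mul_left (a := L) ?_ hLpos
      have : L ^ j * (L + 8) ≤ L ^ j * (2 * L) := Nat.mul_le_mul_left _ (by omega)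
      linarith
    have hR : ((L ^ (j + 1) + 2 * q : ℕ) : ℝ) ≤ (r + 2) ^ (j + 1) := by
      refine le_trans (b := ((L : ℝ) + 2) ^ (j + 1)) ?_
        (pow_le_pow_left₀ (by positivity) (by linarith) _)
      refine le_trans ?_ (pow_add_le_add_two_pow (by positivity) j)
      have h5 : 2 * q ≤ 2 * (j + 1) * L ^ j := by nlinarith [Nat.zero_le (L ^ j)]
      have h6 : L ^ (j + 1) + 2 * q ≤ L ^ (j + 1) + 2 * (j + 1) * L ^ j := by omega
      exact_mod_cast h6
    refine ⟨_, _, (layer_of_two_le I r ω (by omega) hjk).covers_step hc L (L ^ (j + 1))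
      (by rw [pow_succ, mul_comm]) hR, ?_, ?_⟩
    · have h5 : L ^ j * (3 * L + 24) ≤ L ^ j * (8 * L) := Nat.mul_le_mul_left _ (by omega)
      rw [pow_succ]
      nlinarith
    · have h5 : max (L * E) ((L - 1) * E + 4 * q + 0) ≤ L * E + 4 * q := by
        have : (L - 1) * E ≤ L * E := Nat.mul_le_mul_right E (by omega)
        omega
      refine (Nat.mul_le_mul_left _ h5).trans ?_
      have h6 := Nat.mul_le_mul_left L h4
      have h7 := Nat.mul_le_mul_left (4 * L) h2
      calc L ^ 2 * (L * E + 4 * q) = L * (L ^ 2 * E) + 4 * L * (L * q) := by ring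
        _ ≤ L * (L ^ j * (4 * j * L + 32 * j)) + 4 * L * (L ^ j * (L + 8)) :=
          add_le_add h6 h7
        _ = _ := by ring

/-- The constant in the lower-order term of the sharp error bound. -/
def fineConst (k : ℕ) : ℝ := 32 * k * 2 ^ k + 36 * k + 38

theorem fine_two (I : Input V) {r : ℝ} (ω : Outcome V 2) {L : ℕ}
    (hL : 50 ≤ L) (hLr : (L : ℝ) ≤ r) {n : ℕ} (hn : (n : ℝ) ≤ r ^ 2) (hnL : n ≤ (L + 1) ^ 2) :
    ∃ T : ℕ, Additive I.G (spanner I r ω) n T ∧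
      (T : ℝ) ≤ 4 * (n / L) + 4 * L + 38 := by
  have hL0 : (50 : ℝ) ≤ L := by exact_mod_cast hL
  set y : ℝ := n / L with hy
  have hyL : y * L = n := by rw [hy]; field_simp
  have hy0 : 0 ≤ y := by positivity
  have hyL3 : y ≤ L + 3 := by
    rw [hy, div_le_iff₀ (by linarith)]
    have : (n : ℝ) ≤ (L + 1) ^ 2 := by exact_mod_cast hnL
    nlinarith
  -- By AM-GM, 3M² ≥ yL = n needs a coefficient of at least 1/(2√3). It must stay below 1/3 for 12M
  -- to fit into 4(y + L) and for 6M, plus lower-order terms, to fit into the radius; 7/24 lies in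
  -- between.
  set M := ⌈7 / 24 * (y + L)⌉₊ with hM
  have hM1 : 7 / 24 * (y + L) ≤ M := Nat.le_ceil _
  have hM2 : (M : ℝ) ≤ 7 / 24 * (y + L) + 1 := (Nat.ceil_lt_add_one (by positivity)).le
  have h3 : n ≤ 3 * M ^ 2 := by
    have h5 : (7 / 24 * (y + L)) ^ 2 ≤ (M : ℝ) ^ 2 := pow_le_pow_left₀ (by positivity) hM1 2
    have h4 : (n : ℝ) ≤ 3 * (M : ℝ) ^ 2 := by
      rw [← hyL]
      nlinarith [sq_nonneg (y - L)]
    exact_mod_cast h4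
  have hc := covers_two I ω le_rfl M n h3 (by
    push_cast
    nlinarith)
  rw [levelSet_above] at hc
  refine ⟨_, hc.additive, ?_⟩
  push_cast
  linarith

/-- One last chain of c + 1 segments of length L^(k-1): the c segments give 4(k-1)n/L, the final
jump 4q gives 4L^(k-1), and everything else has order L^(k-2). The factor 2^k in `fineConst` comes
from n ≤ (L+1)^k ≤ (2L)^k. -/
theorem fine_of_three_le (I : Input V) {k : ℕ} {r : ℝ} (ω : Outcome V k) (hk : 3 ≤ k) {L : ℕ}
    (hL : 50 ≤ L) (hLr : (L : ℝ) ≤ r) {n : ℕ} (hn : (n : ℝ) ≤ r ^ k) (hnL : n ≤ (L + 1) ^ k) :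
    ∃ T : ℕ, Additive I.G (spanner I r ω) n T ∧
      (T : ℝ) ≤ 4 * (k - 1) * (n / L) + 4 * (L : ℝ) ^ (k - 1) +
        fineConst k * (L : ℝ) ^ (k - 2) := by
  obtain ⟨j, rfl⟩ : ∃ j, k = j + 2 := ⟨k - 2, by omega⟩
  obtain ⟨E, q, hc, h2, h4⟩ :=
    exists_covers_pow_fine I ω hL hLr (j + 1) (by omega) (by omega)
  have hL0 : (50 : ℝ) ≤ L := by exact_mod_cast hL
  have hLp : (0 : ℝ) < L := by linarith
  set P := L ^ (j + 1) with hP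
  have hPpos : 0 < P := by positivity
  set Q : ℝ := (L : ℝ) ^ j with hQ
  have hQ0 : 0 < Q := by positivity
  have hPQ : (P : ℝ) = L * Q := by rw [hP, hQ]; push_cast; ring
  have h2' : (q : ℝ) ≤ Q * (L + 8) := by
    have h5 : (L : ℝ) * q ≤ P * (L + 8) := by exact_mod_cast h2
    rw [hPQ] at h5
    refine le_of_mul_le_mul_left (a := (L : ℝ)) ?_ hLp
    linarith
  have h4' : (L : ℝ) * E ≤ Q * (4 * (j + 1) * L + 32 * (j + 1)) := by
    have h5 : (L : ℝ) ^ 2 * E ≤ P * (4 * (j + 1) * L + 32 * (j + 1)) := by exact_mod_cast h4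
    rw [hPQ] at h5
    refine le_of_mul_le_mul_left (a := (L : ℝ)) ?_ hLp
    linarith
  have hE36 : (E : ℝ) ≤ 36 * (j + 1) * Q := by
    refine le_of_mul_le_mul_left (a := (L : ℝ)) ?_ hLp
    have : 0 ≤ Q * (j + 1) * (L - 1) := by
      have : (0 : ℝ) ≤ L - 1 := by linarith
      positivity
    nlinarith
  have hdiv : P * (n / P) + n % P = n := Nat.div_add_mod _ _
  have hmod : n % P < P := Nat.mod_lt _ hPpos
  generalize n / P = c at hdiv
  have hR : ((n + 2 * q : ℕ) : ℝ) ≤ (r + 2) ^ (j + 2) := by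
    refine le_trans ?_ (pow_add_le_add_two_pow (by linarith) (j + 1))
    push_cast
    have h5 : (P : ℝ) ≤ r ^ (j + 1) := by
      rw [hP]; push_cast; exact pow_le_pow_left₀ hLp.le hLr _
    have h6 : 2 * (q : ℝ) ≤ 4 * P := by
      rw [hPQ]
      nlinarith
    have h7 : (0 : ℝ) ≤ j * r ^ (j + 1) := by
      have : 0 ≤ r := by linarith
      positivity
    nlinarith
  have hnc : n ≤ (c + 1) * P := by
    have : (c + 1) * P = P * c + P := by ring
    omega
  have hcb := (layer_of_two_le I r ω (by omega) le_rfl).covers_step hc (c + 1) n hnc hR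
  rw [levelSet_above] at hcb
  have hmax : max ((c + 1) * E) ((c + 1 - 1) * E + 4 * q + 0) ≤ (c + 1) * E + 4 * q := by
    have : (c + 1 - 1) * E ≤ (c + 1) * E := Nat.mul_le_mul_right E (Nat.sub_le _ _)
    omega
  refine ⟨_, hcb.additive.mono le_rfl hmax, ?_⟩
  set y : ℝ := n / L with hy
  have hyL : y * L = n := by rw [hy]; field_simp
  have hy0 : 0 ≤ y := by positivity
  have hcP : (c : ℝ) * Q ≤ y := by
    have h5 : (P : ℝ) * c ≤ n := by exact_mod_cast (by omega : P * c ≤ n)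
    rw [hPQ, ← hyL] at h5
    refine le_of_mul_le_mul_left (a := (L : ℝ)) ?_ hLp
    linarith
  have hy2 : y ≤ 2 ^ (j + 2) * (L * Q) := by
    rw [hy, div_le_iff₀ hLp]
    have h5 : (n : ℝ) ≤ (L + 1) ^ (j + 2) := by exact_mod_cast hnL
    refine h5.trans ?_
    have h6 : ((L : ℝ) + 1) ^ (j + 2) ≤ (2 * L) ^ (j + 2) :=
      pow_le_pow_left₀ (by positivity) (by linarith) _
    refine h6.trans (le_of_eq ?_)
    rw [mul_pow, hQ]
    ring
  have hcE : (c : ℝ) * E ≤ 4 * (j + 1) * y + 32 * (j + 1) * 2 ^ (j + 2) * Q := by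
    refine le_of_mul_le_mul_left (a := (L : ℝ)) ?_ hLp
    have h5 : (c : ℝ) * (L * E) ≤ c * (Q * (4 * (j + 1) * L + 32 * (j + 1))) :=
      mul_le_mul_of_nonneg_left h4' (by positivity)
    have h6 : (c : ℝ) * Q * (4 * (j + 1) * L + 32 * (j + 1)) ≤
        y * (4 * (j + 1) * L + 32 * (j + 1)) :=
      mul_le_mul_of_nonneg_right hcP (by positivity)
    have h7 : y * (32 * (j + 1)) ≤ 2 ^ (j + 2) * (L * Q) * (32 * (j + 1)) :=
      mul_le_mul_of_nonneg_right hy2 (by positivity)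
    linarith
  have e1 : j + 2 - 1 = j + 1 := by omega
  have e2 : j + 2 - 2 = j := by omega
  rw [e1, e2, ← hQ, fineConst]
  have e3 : (L : ℝ) ^ (j + 1) = L * Q := by rw [hQ]; ring
  rw [e3]
  push_cast
  have h8 : (0 : ℝ) ≤ 2 ^ (j + 2) * Q := by positivity
  nlinarith

/-- The sharp error bound for distances up to `r^k`, with a lower-order term depending on `k`. -/
theorem fine_regime (I : Input V) {k : ℕ} {r : ℝ} (ω : Outcome V k) (hk : 2 ≤ k) {L : ℕ}
    (hL : 50 ≤ L) (hLr : (L : ℝ) ≤ r) {n : ℕ} (hn : (n : ℝ) ≤ r ^ k) (hnL : n ≤ (L + 1) ^ k) :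
    ∃ T : ℕ, Additive I.G (spanner I r ω) n T ∧
      (T : ℝ) ≤ 4 * (k - 1) * (n / L) + 4 * (L : ℝ) ^ (k - 1) +
        fineConst k * (L : ℝ) ^ (k - 2) := by
  rcases hk.lt_or_eq with h | rfl
  · exact fine_of_three_le I ω h hL hLr hn hnL
  · obtain ⟨T, h1, h2⟩ := fine_two I ω hL hLr hn hnL
    refine ⟨T, h1, h2.trans ?_⟩
    simp only [fineConst]
    norm_num

end Fine


/-! ### The stretch bounds at real scales. -/

section Stretch

theorem exists_root {d : ℝ} (hd : 0 < d) {k : ℕ} (hk : 1 ≤ k) :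
    ∃ l : ℝ, 0 < l ∧ l ^ k = d ∧ d ^ (1 - 1 / (k : ℝ)) = l ^ (k - 1) ∧
      l = d ^ (1 / (k : ℝ)) := by
  have hk0 : (k : ℝ) ≠ 0 := by exact_mod_cast (by omega : k ≠ 0)
  have h1 : (d ^ (1 / (k : ℝ))) ^ k = d := by
    rw [one_div]
    exact Real.rpow_inv_natCast_pow hd.le (by omega)
  refine ⟨d ^ (1 / (k : ℝ)), by positivity, h1, ?_, rfl⟩
  rw [← Real.rpow_natCast, ← Real.rpow_mul hd.le, Nat.cast_sub hk]
  congr 1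
  field_simp
  simp

theorem one_div_floor_le {l : ℝ} (hl : 4 ≤ l) :
    1 / (⌊l⌋₊ : ℝ) ≤ 1 / l + 2 / l ^ 2 ∧ 1 / (⌊l⌋₊ : ℝ) ≤ 2 / l := by
  have h1 := Nat.lt_floor_add_one l
  set L : ℝ := ((⌊l⌋₊ : ℕ) : ℝ)
  have hL : 0 < L := by linarith
  constructor
  · rw [div_add_div _ _ (by linarith) (by positivity), div_le_div_iff₀ hL (by positivity)]
    have h2 : 0 ≤ (L - (l - 1)) * (l ^ 2 + 2 * l) := by
      have : 0 ≤ L - (l - 1) := by linarith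
      positivity
    nlinarith
  · rw [div_le_div_iff₀ hL (by linarith)]
    linarith

/-- Rounding l down changes 1/l by at most 2/l². With k ≤ cl, all terms of order k/l² become c/l, so
the coefficient 4 of k is kept. -/
theorem large_factor_le {l c : ℝ} (hl : 4 ≤ l) {k : ℕ} (hc : (k : ℝ) ≤ c * l) :
    (4 * k + 48 * k / (⌊l⌋₊ : ℝ) + 34) / (⌊l⌋₊ : ℝ) ≤ (4 * k + (200 * c + 68)) / l := by
  obtain ⟨h1, h2⟩ := one_div_floor_le hl
  have hl0 : 0 < l := by linarith
  have hk0 : (0 : ℝ) ≤ k := Nat.cast_nonneg k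
  have e1 : (4 * k + 48 * k / (⌊l⌋₊ : ℝ) + 34) / (⌊l⌋₊ : ℝ) =
      4 * k * (1 / (⌊l⌋₊ : ℝ)) + 48 * k * (1 / (⌊l⌋₊ : ℝ)) ^ 2 + 34 * (1 / (⌊l⌋₊ : ℝ)) := by
    ring
  have h0 : 0 ≤ 1 / (⌊l⌋₊ : ℝ) := by positivity
  have h3 : (1 / (⌊l⌋₊ : ℝ)) ^ 2 ≤ (2 / l) ^ 2 := pow_le_pow_left₀ h0 h2 2
  have h4 : (k : ℝ) / l ^ 2 ≤ c / l := by
    rw [div_le_div_iff₀ (by positivity) hl0]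
    nlinarith
  have h5 := mul_le_mul_of_nonneg_left h1 (by positivity : (0 : ℝ) ≤ 4 * k)
  have h6 := mul_le_mul_of_nonneg_left h3 (by positivity : (0 : ℝ) ≤ 48 * k)
  have e2 : 4 * (k : ℝ) * (1 / l + 2 / l ^ 2) = 4 * k / l + 8 * (k / l ^ 2) := by ring
  have e3 : 48 * (k : ℝ) * (2 / l) ^ 2 = 192 * (k / l ^ 2) := by ring
  have e4 : (4 * k + (200 * c + 68)) / l = 4 * k / l + 200 * (c / l) + 34 * (2 / l) := by ring
  rw [e1, e4]
  linarith

theorem distLE_self (V : Type u) (S : SimpleGraph V) (u : V) {x : ℝ} (hx : 0 ≤ x) :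
    DistLE S u u x := ⟨SimpleGraph.Reachable.refl u, by simpa using hx⟩

variable {V : Type u} [Fintype V] [LinearOrder V]

/-- Blocks of length D ≥ 3^k/5 are repeated: at most 6d/3^k of them, each with error at most 6k 3^k.
-/
theorem additive_of_three_pow_le (I : Input V) {k : ℕ} {r : ℝ} (ω : Outcome V k) (hk : 2 ≤ k)
    (hr : 2 ≤ r) {d : ℕ} (hd : 3 ^ k ≤ d) :
    ∃ T : ℕ, Additive I.G (spanner I r ω) d T ∧ (T : ℝ) ≤ 36 * k * d := by
  obtain ⟨D, E, hD, hE, hA⟩ := small_regime I ω hk hr (le_refl (3 ^ k))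
  have h3 : (0 : ℝ) < 3 ^ k := by positivity
  push_cast at hD hE
  have hDpos : 0 < D := by
    have : (0 : ℝ) < D := by linarith
    exact_mod_cast this
  have hdiv : D * (d / D) + d % D = d := Nat.div_add_mod _ _
  have hmod : d % D < D := Nat.mod_lt _ hDpos
  generalize d / D = c at hdiv
  refine ⟨(c + 1) * E, (hA.mul (c + 1)).mono ?_ le_rfl, ?_⟩
  · have : (c + 1) * D = D * c + D := by ring
    omega
  · have hk2 : (2 : ℝ) ≤ k := by exact_mod_cast hk
    have hd' : (3 : ℝ) ^ k ≤ d := by exact_mod_cast hd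
    have h1 : (D : ℝ) * c ≤ d := by exact_mod_cast (by omega : D * c ≤ d)
    have h2 : (3 : ℝ) ^ k * c ≤ 5 * d := by
      have := mul_le_mul_of_nonneg_right hD (by positivity : (0 : ℝ) ≤ c)
      linarith
    have h4 : (E : ℝ) ≤ 6 * k * 3 ^ k := by nlinarith
    have h5 := mul_le_mul_of_nonneg_left h4 (by positivity : (0 : ℝ) ≤ (c : ℝ) + 1)
    have h6 : (3 : ℝ) ^ k * (c + 1) ≤ 6 * d := by linarith
    have h7 := mul_le_mul_of_nonneg_left h6 (by positivity : (0 : ℝ) ≤ 6 * k)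
    push_cast
    linarith

theorem additive_of_le_three_pow (I : Input V) {k : ℕ} {r : ℝ} (ω : Outcome V k) (hk : 2 ≤ k)
    (hr : 2 ≤ r) {d : ℕ} (hd : d ≤ 3 ^ k) :
    ∃ T : ℕ, Additive I.G (spanner I r ω) d T ∧ (T : ℝ) ≤ 5 * k * d + 50 * 3 ^ k := by
  obtain ⟨D, E, hD, hE, hA⟩ := small_regime I ω hk hr hd
  refine ⟨5 * E, (hA.mul 5).mono ?_ le_rfl, ?_⟩
  · have : (d : ℝ) ≤ 5 * D := by linarith
    exact_mod_cast this
  · push_cast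
    linarith

theorem additive_of_two_pow_le (I : Input V) {k : ℕ} {r : ℝ} (ω : Outcome V k) (hk : 2 ≤ k)
    (hr : 2 ≤ r) {d : ℕ} (hd : 2 ^ k ≤ d) :
    ∃ T : ℕ, Additive I.G (spanner I r ω) d T ∧ (T : ℝ) ≤ 72 * (3 / 2) ^ k * d := by
  have hB : (k : ℝ) ≤ 2 * (3 / 2) ^ k := by
    have h := one_add_mul_le_pow (a := (1 / 2 : ℝ)) (by norm_num) k
    norm_num at h
    linarith
  have hd0 : (0 : ℝ) ≤ d := Nat.cast_nonneg d
  have h1 := mul_le_mul_of_nonneg_right hB hd0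
  rcases le_total (3 ^ k) d with h | h
  · obtain ⟨T, hA, hT⟩ := additive_of_three_pow_le I ω hk hr h
    exact ⟨T, hA, by linarith⟩
  · obtain ⟨T, hA, hT⟩ := additive_of_le_three_pow I ω hk hr h
    refine ⟨T, hA, hT.trans ?_⟩
    have h2 : (3 : ℝ) ^ k = (3 / 2) ^ k * 2 ^ k := by rw [← mul_pow]; norm_num
    have h3 : (2 : ℝ) ^ k ≤ d := by exact_mod_cast hd
    have h4 := mul_le_mul_of_nonneg_left h3 (by positivity : (0 : ℝ) ≤ (3 / 2) ^ k)
    have h5 : 0 ≤ (3 / 2 : ℝ) ^ k * d := by positivity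
    rw [h2]
    linarith

theorem additive_of_pow_le (I : Input V) {k : ℕ} {r : ℝ} (ω : Outcome V k) (hk : 2 ≤ k)
    {l : ℝ} (hl : 4 ≤ l) (hlr : l ≤ r) {d : ℕ} (hd : l ^ k ≤ d) :
    ∃ T : ℕ, Additive I.G (spanner I r ω) d T ∧ (T : ℝ) ≤ (4 + 160 / l) * d ∧
      ∀ c : ℝ, (k : ℝ) ≤ c * l → (T : ℝ) ≤ (4 * k + (200 * c + 68)) / l * d := by
  have hL : 4 ≤ ⌊l⌋₊ := Nat.le_floor (by exact_mod_cast hl)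
  have hLl : (⌊l⌋₊ : ℝ) ≤ l := Nat.floor_le (by linarith)
  have hd0 : (0 : ℝ) ≤ d := Nat.cast_nonneg d
  obtain ⟨T, hA, h1, h2⟩ := large_regime I ω hk hL (hLl.trans hlr) (d := d) (by
    have h : ((⌊l⌋₊ : ℝ)) ^ k ≤ d := (pow_le_pow_left₀ (by positivity) hLl k).trans hd
    exact_mod_cast h)
  refine ⟨T, hA, h1.trans (mul_le_mul_of_nonneg_right ?_ hd0), fun c hc =>
    h2.trans (mul_le_mul_of_nonneg_right (large_factor_le hl hc) hd0)⟩
  have h3 := (one_div_floor_le hl).2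
  have e1 : 80 / (⌊l⌋₊ : ℝ) = 80 * (1 / (⌊l⌋₊ : ℝ)) := by ring
  have e2 : 160 / l = 80 * (2 / l) := by ring
  rw [e1, e2]
  linarith

/-- The sublinear error bound with a universal constant. -/
theorem additive_of_le_pow (I : Input V) {k : ℕ} {r : ℝ} (ω : Outcome V k) (hk : 2 ≤ k)
    (hr : 2 ≤ r) {d : ℕ} (hd : (d : ℝ) ≤ r ^ k) :
    ∃ T : ℕ, Additive I.G (spanner I r ω) d T ∧
      (T : ℝ) ≤ 150 * (k * (d : ℝ) ^ (1 - 1 / (k : ℝ)) + 3 ^ k) := by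
  have hk0 : (0 : ℝ) ≤ k := Nat.cast_nonneg k
  have h3 : (0 : ℝ) < 3 ^ k := by positivity
  rcases Nat.eq_zero_or_pos d with rfl | hdpos
  · obtain ⟨T, hA, hT⟩ := additive_of_le_three_pow I ω hk hr (d := 0) (Nat.zero_le _)
    refine ⟨T, hA, hT.trans ?_⟩
    have : (0 : ℝ) ≤ k * ((0 : ℕ) : ℝ) ^ (1 - 1 / (k : ℝ)) := by positivity
    push_cast at this ⊢
    linarith
  obtain ⟨l, hl0, hlk, hlp, -⟩ :=
    exists_root (d := (d : ℝ)) (by exact_mod_cast hdpos) (by omega : 1 ≤ k)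
  rw [hlp]
  set P := l ^ (k - 1) with hP
  have hP0 : 0 < P := by positivity
  have hdP : (d : ℝ) = l * P := by
    rw [hP, ← pow_succ', Nat.sub_add_cancel (by omega), hlk]
  have hlow : ∀ c : ℝ, 0 ≤ c → (d : ℝ) ≤ c ^ k → (k : ℝ) * d ≤ c * (k * P) := by
    intro c hc h
    have : l ≤ c := by
      rw [← hlk] at h
      exact le_of_pow_le_pow_left₀ (by omega) hc h
    rw [hdP]
    have := mul_le_mul_of_nonneg_right this (by positivity : 0 ≤ k * P)
    linarith
  rcases le_total d (3 ^ k) with h | h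
  · obtain ⟨T, hA, hT⟩ := additive_of_le_three_pow I ω hk hr h
    have := hlow 3 (by norm_num) (by exact_mod_cast h)
    have hkP : 0 ≤ k * P := by positivity
    exact ⟨T, hA, by linarith⟩
  rcases le_total (d : ℝ) (4 ^ k) with h4 | h4
  · obtain ⟨T, hA, hT⟩ := additive_of_three_pow_le I ω hk hr h
    have := hlow 4 (by norm_num) h4
    have hkP : 0 ≤ k * P := by positivity
    exact ⟨T, hA, by linarith⟩
  · have hl4 : 4 ≤ l := by
      rw [← hlk] at h4
      exact le_of_pow_le_pow_left₀ (by omega) hl0.le h4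
    have hlr : l ≤ r := by
      rw [← hlk] at hd
      exact le_of_pow_le_pow_left₀ (by omega) (by linarith) hd
    have hL : 4 ≤ ⌊l⌋₊ := Nat.le_floor (by exact_mod_cast hl4)
    have hLl : (⌊l⌋₊ : ℝ) ≤ l := Nat.floor_le (by linarith)
    obtain ⟨T, hA, -, h2⟩ := large_regime I ω hk hL (hLl.trans hlr) (d := d) (by
      have h : ((⌊l⌋₊ : ℝ)) ^ k ≤ d := (pow_le_pow_left₀ (by positivity) hLl k).trans hlk.le
      exact_mod_cast h)
    refine ⟨T, hA, ?_⟩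
    have h5 := (one_div_floor_le hl4).2
    have hL4 : (4 : ℝ) ≤ ⌊l⌋₊ := by exact_mod_cast hL
    have h6 : 48 * k / (⌊l⌋₊ : ℝ) ≤ 12 * k := by
      rw [div_le_iff₀ (by linarith)]
      nlinarith
    have hk2 : (2 : ℝ) ≤ k := by exact_mod_cast hk
    have h7 : (4 * k + 48 * k / (⌊l⌋₊ : ℝ) + 34) * (1 / (⌊l⌋₊ : ℝ)) ≤ 33 * k * (2 / l) :=
      mul_le_mul (by linarith) h5 (by positivity) (by positivity)
    have h8 := mul_le_mul_of_nonneg_right h7 (by positivity : (0 : ℝ) ≤ d)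
    have e1 : 33 * (k : ℝ) * (2 / l) * d = 66 * (k * P) := by
      rw [hdP]; field_simp; ring
    have hkP : 0 ≤ k * P := by positivity
    rw [e1, mul_one_div] at h8
    linarith

theorem stretch_regimes (I : Input V) {k : ℕ} {r : ℝ} (ω : Outcome V k) (hk : 2 ≤ k)
    (hr : 2 ≤ r) (u v : V) (d : ℕ) (huv : I.G.Reachable u v) (hd : I.G.dist u v = d) :
    ((2 : ℝ) ^ k ≤ d → DistLE (spanner I r ω) u v (1000 * (3 / 2) ^ k * d)) ∧
    ((3 : ℝ) ^ k ≤ d → DistLE (spanner I r ω) u v (1000 * k * d)) ∧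
    (∀ l : ℝ, 4 ≤ l → l < k → l ≤ r → l ^ k ≤ d →
      DistLE (spanner I r ω) u v ((5 + 1000 / l) * d)) ∧
    (∀ l : ℝ, k ≤ l → l ≤ r → l ^ k ≤ d →
      DistLE (spanner I r ω) u v ((1 + (4 * k + 1000) / l) * d)) ∧
    ((d : ℝ) ≤ r ^ k → DistLE (spanner I r ω) u v
      (d + 1000 * (k * (d : ℝ) ^ (1 - 1 / (k : ℝ)) + 3 ^ k))) := by
  have hk2 : (2 : ℝ) ≤ k := by exact_mod_cast hk
  have hd0 : (0 : ℝ) ≤ d := Nat.cast_nonneg d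
  refine ⟨fun h => ?_, fun h => ?_, fun l hl hlk hlr h => ?_, fun l hl hlr h => ?_, fun h => ?_⟩
  · obtain ⟨T, hA, hT⟩ := additive_of_two_pow_le I ω hk hr (d := d) (by exact_mod_cast h)
    refine hA.distLE huv hd.le ?_
    rw [hd]
    have h1 : (1 : ℝ) ≤ (3 / 2) ^ k := one_le_pow₀ (by norm_num)
    have := mul_le_mul_of_nonneg_right h1 hd0
    linarith
  · obtain ⟨T, hA, hT⟩ := additive_of_three_pow_le I ω hk hr (d := d) (by exact_mod_cast h)
    refine hA.distLE huv hd.le ?_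
    rw [hd]
    nlinarith
  · obtain ⟨T, hA, hT, -⟩ := additive_of_pow_le I ω hk hl hlr h
    refine hA.distLE huv hd.le ?_
    rw [hd]
    have h1 : 160 / l ≤ 1000 / l := div_le_div_of_nonneg_right (by norm_num) (by linarith)
    have := mul_le_mul_of_nonneg_right h1 hd0
    linarith
  · have hl0 : 0 < l := by linarith
    rcases le_or_gt 4 l with hl4 | hl4
    · obtain ⟨T, hA, -, hT⟩ := additive_of_pow_le I ω hk hl4 hlr h
      refine hA.distLE huv hd.le ?_
      rw [hd]
      have h1 := hT 1 (by linarith)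
      have h2 : (4 * k + (200 * 1 + 68)) / l ≤ (4 * k + 1000) / l :=
        div_le_div_of_nonneg_right (by linarith) hl0.le
      have := mul_le_mul_of_nonneg_right h2 hd0
      linarith
    -- Here k ≤ l < 4, so k ≤ 3: the crude factor 72(3/2)^3 = 243 is below 250, hence below (4k +
    -- 1000)/l.
    · have h2k : (2 : ℝ) ^ k ≤ d :=
        (pow_le_pow_left₀ (by norm_num) (by linarith) k).trans h
      obtain ⟨T, hA, hT⟩ := additive_of_two_pow_le I ω hk hr (d := d) (by exact_mod_cast h2k)
      refine hA.distLE huv hd.le ?_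
      rw [hd]
      have hkl : k < 4 := by exact_mod_cast hl.trans_lt hl4
      have h1 : (3 / 2 : ℝ) ^ k ≤ (3 / 2) ^ 3 :=
        pow_le_pow_right₀ (by norm_num) (by omega)
      have h2 : 250 ≤ (4 * k + 1000) / l := by
        rw [le_div_iff₀ hl0]
        linarith
      have h3 := mul_le_mul_of_nonneg_right h1 hd0
      have h4 := mul_le_mul_of_nonneg_right h2 hd0
      norm_num at h3
      linarith
  · obtain ⟨T, hA, hT⟩ := additive_of_le_pow I ω hk hr h
    refine hA.distLE huv hd.le ?_
    rw [hd]
    have : (0 : ℝ) ≤ k * (d : ℝ) ^ (1 - 1 / (k : ℝ)) + 3 ^ k := by positivity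
    linarith

/-- The cubic Taylor term t³/48 of exp(t/2) exceeds 4t as soon as t² ≥ 192, and 14² = 196. -/
theorem exp_bound {t : ℝ} (ht : 14 ≤ t) : 4 * t * Real.exp (-(t / 2)) ≤ 1 := by
  have h1 := Real.pow_div_factorial_le_exp (t / 2) (by linarith) 3
  have h2 : 4 * t ≤ Real.exp (t / 2) := by
    refine le_trans ?_ h1
    norm_num [Nat.factorial]
    rw [le_div_iff₀ (by norm_num)]
    nlinarith [mul_nonneg (by linarith : 0 ≤ t) (by nlinarith : 0 ≤ t ^ 2 - 192)]
  rw [Real.exp_neg, ← div_eq_mul_inv, div_le_one (Real.exp_pos _)]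
  exact h2

/-- The left side is 4t z^(k-1) with t = k(1 - z). For t ≤ 14 it is at most 56 z^(k-1) ≤ 112 z^k;
for larger t, z^(k-1) ≤ exp(-(k-1)(1-z)) ≤ exp(-t/2) makes it at most 1. -/
theorem pow_sub_pow_bound {k : ℕ} (hk : 2 ≤ k) {z : ℝ} (hz : 1 / 2 ≤ z) (hz1 : z ≤ 1) :
    4 * k * (z ^ (k - 1) - z ^ k) ≤ 1 + 112 * z ^ k := by
  obtain ⟨j, rfl⟩ : ∃ j, k = j + 1 := ⟨k - 1, by omega⟩
  rw [Nat.add_sub_cancel, pow_succ]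
  set p := z ^ j with hp
  have hp0 : 0 < p := by positivity
  have hpz : p ≤ 2 * (p * z) := by nlinarith
  set t : ℝ := (j + 1 : ℕ) * (1 - z) with ht
  have e : 4 * ((j + 1 : ℕ) : ℝ) * (p - p * z) = 4 * t * p := by rw [ht]; ring
  rw [e]
  rcases le_total t 14 with h | h
  · nlinarith
  · have h1 : p ≤ Real.exp (-(t / 2)) := by
      have h2 : z ≤ Real.exp (z - 1) := by
        have := Real.add_one_le_exp (z - 1)
        linarith
      have h3 : p ≤ Real.exp (z - 1) ^ j := pow_le_pow_left₀ (by linarith) h2 j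
      rw [← Real.exp_nat_mul] at h3
      refine h3.trans (Real.exp_le_exp.2 ?_)
      rw [ht]
      push_cast
      have hj : (1 : ℝ) ≤ j := by exact_mod_cast (by omega : 1 ≤ j)
      nlinarith
    have h4 := mul_le_mul_of_nonneg_left h1 (by linarith : 0 ≤ 4 * t)
    have h5 := exp_bound h
    have : 0 ≤ p * z := by nlinarith
    linarith

theorem sq_le_two_mul_two_pow (k : ℕ) : k ^ 2 ≤ 2 * 2 ^ k := by
  induction k with
  | zero => simp
  | succ k ih =>
    rcases Nat.lt_or_ge k 3 with h | h
    · interval_cases k <;> norm_num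
    · rw [pow_succ 2 k]
      nlinarith

/-- Unless Cz ≥ 150k, the bound z < 150k/C helps: z^(k-1) ≤ 2^(-(k-2)) z and k² ≤ 8 · 2^(k-2) bound
the left side by 22500 · 8/C, which is at most 1/2 for C ≥ 360000. -/
theorem sparse_bound {k : ℕ} (hk : 2 ≤ k) {z C : ℝ} (hz0 : 0 ≤ z) (hz : z ≤ 1 / 2)
    (hC : 360000 ≤ C) : 150 * k * z ^ (k - 1) ≤ 1 / 2 + C * z ^ k := by
  obtain ⟨j, rfl⟩ : ∃ j, k = j + 2 := ⟨k - 2, by omega⟩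
  have e1 : j + 2 - 1 = j + 1 := by omega
  rw [e1, pow_succ z (j + 1)]
  have hp : 0 ≤ z ^ (j + 1) := by positivity
  rcases le_total (150 * ((j + 2 : ℕ) : ℝ)) (C * z) with h | h
  · have := mul_le_mul_of_nonneg_right h hp
    linarith
  · have h1 : z ^ (j + 1) ≤ (1 / 2) ^ j * z := by
      rw [pow_succ]
      exact mul_le_mul_of_nonneg_right (pow_le_pow_left₀ hz0 hz j) hz0
    have h2 : (((j + 2 : ℕ) : ℝ)) ^ 2 ≤ 8 * 2 ^ j := by
      have := sq_le_two_mul_two_pow (j + 2)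
      have h3 : (((j + 2 : ℕ) : ℝ)) ^ 2 ≤ 2 * 2 ^ (j + 2) := by exact_mod_cast this
      rw [pow_add] at h3
      linarith
    set K : ℝ := ((j + 2 : ℕ) : ℝ) with hK
    have hK0 : 0 ≤ K := by positivity
    have h4 : (1 / 2 : ℝ) ^ j * K ^ 2 ≤ 8 := by
      have h5 := mul_le_mul_of_nonneg_left h2 (by positivity : (0 : ℝ) ≤ (1 / 2) ^ j)
      have h6 : (1 / 2 : ℝ) ^ j * (8 * 2 ^ j) = 8 := by
        rw [mul_left_comm, ← mul_pow]; norm_num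
      linarith
    have hz' : z ≤ 150 * K / C := by
      rw [le_div_iff₀ (by linarith)]
      linarith
    have h7 : 150 * K * z ^ (j + 1) ≤ 150 * K * ((1 / 2) ^ j * (150 * K / C)) := by
      refine mul_le_mul_of_nonneg_left (h1.trans ?_) (by positivity)
      exact mul_le_mul_of_nonneg_left hz' (by positivity)
    have h8 : 150 * K * ((1 / 2) ^ j * (150 * K / C)) = 22500 * ((1 / 2) ^ j * K ^ 2) / C := by
      ring
    have h9 : 22500 * ((1 / 2) ^ j * K ^ 2) / C ≤ 1 / 2 := by
      rw [div_le_iff₀ (by linarith)]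
      linarith
    have : 0 ≤ C * (z ^ (j + 1) * z) := by
      have : 0 ≤ C := by linarith
      positivity
    linarith

/-- With l = (4k + C)/ε, distances d ≥ l^k have multiplicative stretch 1 + ε. Otherwise d = (zl)^k
with z ≤ 1, and in units of l^(k-1) the allowance is (4k + C)z^k + 1. For z ≥ 1/2 the error is (4k +
C₁)z^(k-1), compared by `pow_sub_pow_bound`; for z ≤ 1/2 the universal bound and `sparse_bound`
suffice. The summand 5000E in C forces l ≥ 5000, which makes the term in 3^k negligible. -/
theorem epsilon_stretch (I : Input V) {k : ℕ} {r : ℝ} (ω : Outcome V k) (hk : 2 ≤ k)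
    (hr : 2 ≤ r) {E : ℝ} (hE : 0 < E) {C : ℝ}
    (hC : 360000 + 5000 * E ≤ C) {ε : ℝ} (hε : 0 < ε) (hεE : ε ≤ E)
    (hεr : (4 * k + C) / ε < r) (u v : V) (huv : I.G.Reachable u v) :
    DistLE (spanner I r ω) u v ((1 + ε) * I.G.dist u v + ((4 * k + C) / ε) ^ (k - 1)) := by
  set l : ℝ := (4 * k + C) / ε with hl
  have hk2 : (2 : ℝ) ≤ k := by exact_mod_cast hk
  have hC0 : 0 < C := by linarith
  have hlE : (4 * k + C) / E ≤ l := div_le_div_of_nonneg_left (by positivity) hε hεE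
  have hεl : ε * l = 4 * k + C := by rw [hl]; field_simp
  have hl5 : 5000 ≤ l := by
    refine le_trans ?_ hlE
    rw [le_div_iff₀ hE]
    linarith
  have hkl : (k : ℝ) ≤ E * l := by
    have := (div_le_iff₀ hE).1 hlE
    linarith
  have hl0 : 0 < l := by linarith
  have hεe : ε = (4 * k + C) / l := by rw [← hεl]; field_simp
  generalize hd : I.G.dist u v = d
  have hd0 : (0 : ℝ) ≤ d := Nat.cast_nonneg d
  have hlp : 0 ≤ l ^ (k - 1) := by positivity
  rcases le_total (l ^ k) d with hdl | hdl
  · obtain ⟨T, hA, -, hT⟩ := additive_of_pow_le I ω hk (by linarith) hεr.le hdl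
    refine hA.distLE huv hd.le ?_
    have h1 := hT E hkl
    have h2 : (4 * k + (200 * E + 68)) / l ≤ ε := by
      rw [hεe]
      exact div_le_div_of_nonneg_right (by linarith) hl0.le
    have h3 := mul_le_mul_of_nonneg_right h2 hd0
    rw [hd]
    linarith
  rcases Nat.eq_zero_or_pos d with rfl | hdpos
  · have : u = v := huv.dist_eq_zero_iff.1 hd
    subst this
    exact distLE_self V _ u (by positivity)
  obtain ⟨s, hs0, hsk, hsp, -⟩ :=
    exists_root (d := (d : ℝ)) (by exact_mod_cast hdpos) (by omega : 1 ≤ k)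
  have hsl : s ≤ l := by
    rw [← hsk] at hdl
    exact le_of_pow_le_pow_left₀ (by omega) hl0.le hdl
  set z := s / l with hz
  have hz0 : 0 < z := by positivity
  have hz1 : z ≤ 1 := (div_le_one hl0).2 hsl
  have hszl : s = z * l := by rw [hz]; field_simp
  set P := l ^ (k - 1) with hP
  have hP0 : 0 < P := by positivity
  have hdz : (d : ℝ) = z ^ k * (l * P) := by
    rw [hP, ← pow_succ', Nat.sub_add_cancel (by omega), ← hsk, hszl, mul_pow]
  have hsz : s ^ (k - 1) = z ^ (k - 1) * P := by rw [hszl, mul_pow]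
  have hεd : ε * d = (4 * k + C) * z ^ k * P := by rw [hdz, ← hεl]; ring
  have hzk : 0 ≤ z ^ k := by positivity
  suffices h : ∃ T : ℕ, Additive I.G (spanner I r ω) d T ∧ (T : ℝ) ≤ ε * d + P by
    obtain ⟨T, hA, hT⟩ := h
    refine hA.distLE huv hd.le ?_
    rw [hd]
    linarith
  rcases le_total (1 / 2) z with hzh | hzh
  · obtain ⟨T, hA, -, hT⟩ := additive_of_pow_le I ω hk (l := s) (r := r) (d := d)
      (by rw [hszl]; nlinarith) (hsl.trans hεr.le) hsk.le
    refine ⟨T, hA, ?_⟩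
    have h1 := hT (2 * E) (by rw [hszl]; nlinarith [mul_pos hE hl0])
    set C₁ : ℝ := 200 * (2 * E) + 68 with hC₁
    have h2 : (4 * k + C₁) / s * d = (4 * k + C₁) * (z ^ (k - 1) * P) := by
      have : (d : ℝ) = s * s ^ (k - 1) := by
        rw [← pow_succ', Nat.sub_add_cancel (by omega), hsk]
      rw [← hsz, this]
      field_simp
    have h3 := pow_sub_pow_bound hk hzh hz1
    have h4 : z ^ (k - 1) ≤ 2 * z ^ k := by
      have e : z ^ k = z * z ^ (k - 1) := by
        rw [← pow_succ', Nat.sub_add_cancel (by omega)]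
      have : 0 < z ^ (k - 1) := by positivity
      rw [e]
      nlinarith
    have hC₁0 : 0 ≤ C₁ := by positivity
    have h5 := mul_le_mul_of_nonneg_left h4 hC₁0
    have h6 : (4 * k + C₁) * z ^ (k - 1) ≤ (4 * k + C) * z ^ k + 1 := by
      have h7 : (112 + 2 * C₁) * z ^ k ≤ C * z ^ k :=
        mul_le_mul_of_nonneg_right (by linarith) hzk
      linarith
    have h8 := mul_le_mul_of_nonneg_right h6 hP0.le
    rw [hεd]
    linarith
  · obtain ⟨T, hA, hT⟩ := additive_of_le_pow I ω hk hr (d := d)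
      (hdl.trans (pow_le_pow_left₀ hl0.le hεr.le k))
    refine ⟨T, hA, hT.trans ?_⟩
    rw [hsp, hsz, hεd]
    have h1 := mul_le_mul_of_nonneg_right (sparse_bound hk hz0.le hzh
      (by linarith : 360000 ≤ C)) hP0.le
    have h2 : 150 * (3 : ℝ) ^ k ≤ 1 / 2 * P := by
      have h3 : (3 : ℝ) ^ k = 3 * 3 ^ (k - 1) := by
        rw [← pow_succ', Nat.sub_add_cancel (by omega)]
      have h4 : P = (l / 3) ^ (k - 1) * 3 ^ (k - 1) := by
        rw [hP, ← mul_pow]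
        congr 1
        field_simp
      have h5 : 900 ≤ (l / 3) ^ (k - 1) := by
        refine le_trans (by linarith : 900 ≤ l / 3) ?_
        exact le_self_pow₀ (by linarith) (by omega)
      have h6 := mul_le_mul_of_nonneg_right h5 (by positivity : (0 : ℝ) ≤ 3 ^ (k - 1))
      rw [h3, h4]
      linarith
    have h3 : 0 ≤ 4 * k * z ^ k * P := by positivity
    linarith

/-- The constant in the sublinear error bound. -/
def sublinearConst (k : ℕ) : ℝ := fineConst k + 8 + 7500 * (1 + 3 ^ k)

/-- With s = d^(1/k), `fine_regime` at scale ⌊s⌋ has error 4k s^(k-1) up to a multiple of s^(k-2)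
depending on k. For s ≤ 50 the universal bound is itself such a multiple; 7500 is 150 · 50. -/
theorem sublinear_stretch (I : Input V) {k : ℕ} {r : ℝ} (ω : Outcome V k) (hk : 2 ≤ k)
    (hr : 2 ≤ r) (u v : V) (d : ℕ) (huv : I.G.Reachable u v) (hd : I.G.dist u v = d)
    (hdr : (d : ℝ) ≤ r ^ k) :
    DistLE (spanner I r ω) u v
      (d + (4 + sublinearConst k / (d : ℝ) ^ (1 / (k : ℝ))) * k * (d : ℝ) ^ (1 - 1 / (k : ℝ)) +
        3 ^ k) := by
  have hF0 : 0 ≤ fineConst k := by unfold fineConst; positivity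
  have hc0 : 0 ≤ sublinearConst k := by unfold sublinearConst; positivity
  have hk2 : (2 : ℝ) ≤ k := by exact_mod_cast hk
  rcases Nat.eq_zero_or_pos d with rfl | hdpos
  · have : u = v := huv.dist_eq_zero_iff.1 hd
    subst this
    exact distLE_self V _ u (by positivity)
  obtain ⟨s, hs0, hsk, hsp, hs⟩ :=
    exists_root (d := (d : ℝ)) (by exact_mod_cast hdpos) (by omega : 1 ≤ k)
  rw [hsp, ← hs]
  obtain ⟨j, rfl⟩ : ∃ j, k = j + 2 := ⟨k - 2, by omega⟩
  have e1 : j + 2 - 1 = j + 1 := by omega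
  have e2 : j + 2 - 2 = j := by omega
  rw [e1]
  set Q := s ^ j with hQ
  have hQ0 : 0 < Q := by positivity
  have hP : s ^ (j + 1) = s * Q := by rw [hQ]; ring
  have hdQ : (d : ℝ) = s ^ 2 * Q := by rw [← hsk, hQ]; ring
  rw [hP]
  set F := fineConst (j + 2) with hF
  set K : ℝ := ((j + 2 : ℕ) : ℝ) with hK
  have e3 : (4 + sublinearConst (j + 2) / s) * K * (s * Q) =
      4 * K * (s * Q) + sublinearConst (j + 2) * K * Q := by
    field_simp
  rw [e3]
  have h3 : (0 : ℝ) < 3 ^ (j + 2) := by positivity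
  suffices h : ∃ T : ℕ, Additive I.G (spanner I r ω) d T ∧
      (T : ℝ) ≤ 4 * K * (s * Q) + sublinearConst (j + 2) * K * Q by
    obtain ⟨T, hA, hT⟩ := h
    refine hA.distLE huv hd.le ?_
    rw [hd]
    linarith
  have hKQ : 0 ≤ K * Q := by positivity
  have hFKQ : 0 ≤ F * (K * Q) := mul_nonneg hF0 hKQ
  rcases le_total 50 s with h50 | h50
  · have hL : 50 ≤ ⌊s⌋₊ := Nat.le_floor (by exact_mod_cast h50)
    have hLs : (⌊s⌋₊ : ℝ) ≤ s := Nat.floor_le hs0.le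
    have hsr : s ≤ r := by
      rw [← hsk] at hdr
      exact le_of_pow_le_pow_left₀ (by omega) (by linarith) hdr
    obtain ⟨T, hA, hT⟩ := fine_regime I ω hk hL (hLs.trans hsr) (n := d) hdr (by
      have h : (d : ℝ) ≤ (⌊s⌋₊ + 1) ^ (j + 2) := by
        rw [← hsk]
        exact pow_le_pow_left₀ hs0.le (Nat.lt_floor_add_one s).le _
      exact_mod_cast h)
    refine ⟨T, hA, hT.trans ?_⟩
    rw [e1, e2]
    have h1 := (one_div_floor_le (by linarith : 4 ≤ s)).1
    have h4 : (d : ℝ) / (⌊s⌋₊ : ℝ) ≤ s * Q + 2 * Q := by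
      have h5 := mul_le_mul_of_nonneg_left h1 (Nat.cast_nonneg (α := ℝ) d)
      rw [mul_one_div] at h5
      refine h5.trans (le_of_eq ?_)
      rw [hdQ]
      field_simp
    have h5 : (⌊s⌋₊ : ℝ) ^ (j + 1) ≤ s * Q := by
      rw [← hP]
      exact pow_le_pow_left₀ (by positivity) hLs _
    have h6 : (⌊s⌋₊ : ℝ) ^ j ≤ Q := pow_le_pow_left₀ (by positivity) hLs _
    have h7 := mul_le_mul_of_nonneg_left h6 hF0
    have h8 := mul_le_mul_of_nonneg_left h4 (by linarith : 0 ≤ 4 * (K - 1))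
    have h9 : F * Q ≤ F * (K * Q) := by
      refine mul_le_mul_of_nonneg_left ?_ hF0
      nlinarith
    have h10 : 0 ≤ 3 ^ (j + 2) * (K * Q) := by positivity
    rw [sublinearConst, ← hF]
    linarith
  · obtain ⟨T, hA, hT⟩ := additive_of_le_pow I ω hk hr hdr
    refine ⟨T, hA, hT.trans ?_⟩
    rw [hsp, e1, hP, ← hK]
    have hs1 : 1 ≤ s := by
      by_contra hs1
      have : s ^ (j + 2) < 1 := pow_lt_one₀ hs0.le (not_le.1 hs1) (by omega)
      rw [hsk] at this
      have : d < 1 := by exact_mod_cast this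
      omega
    have hQ1 : 1 ≤ K * Q := by
      have : 1 ≤ Q := one_le_pow₀ hs1
      nlinarith
    have h4 := mul_le_mul_of_nonneg_right h50 hKQ
    have h5 := mul_le_mul_of_nonneg_left hQ1 h3.le
    have h6 : 0 ≤ K * (s * Q) := by positivity
    rw [sublinearConst, ← hF]
    linarith

theorem tendsto_sublinearConst (k : ℕ) (hk : 2 ≤ k) :
    Tendsto (fun d : ℕ => sublinearConst k / (d : ℝ) ^ (1 / (k : ℝ))) atTop (𝓝 0) := by
  refine Tendsto.div_atTop tendsto_const_nhds ?_
  refine (tendsto_rpow_atTop ?_).comp tendsto_natCast_atTop_atTop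
  have : (0 : ℝ) < k := by exact_mod_cast (by omega : 0 < k)
  positivity

/-- Blocks of length L^k with L = ⌊r⌋. A full block has error about 4k L^(k-1), which is 4k/L of its
length. Only the incomplete block leaves an unmatched term 4L^(k-1), and rounding costs order d/r².
-/
theorem additive_of_pow_le_fine (I : Input V) {k : ℕ} {r : ℝ} (ω : Outcome V k) (hk : 2 ≤ k)
    (hr : 51 ≤ r) {d : ℕ} (hd : r ^ k ≤ d) :
    ∃ T : ℕ, Additive I.G (spanner I r ω) d T ∧
      (T : ℝ) ≤ 4 * (k * d / r) + 4 * r ^ (k - 1) +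
        (8 * k + 8 * fineConst k) * (d / r ^ 2) := by
  have hF0 : 0 ≤ fineConst k := by unfold fineConst; positivity
  have hr0 : 0 < r := by linarith
  have hk2 : (2 : ℝ) ≤ k := by exact_mod_cast hk
  have hL : 50 ≤ ⌊r⌋₊ := Nat.le_floor (by norm_num; linarith)
  have hLr : (⌊r⌋₊ : ℝ) ≤ r := Nat.floor_le hr0.le
  obtain ⟨h1, h2⟩ := one_div_floor_le (by linarith : 4 ≤ r)
  set L := ⌊r⌋₊
  have hL0 : (0 : ℝ) < L := by positivity
  have hLkr : (L : ℝ) ^ k ≤ r ^ k := pow_le_pow_left₀ hL0.le hLr k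
  have hdiv : L ^ k * (d / L ^ k) + d % L ^ k = d := Nat.div_add_mod _ _
  have hmod : d % L ^ k < L ^ k := Nat.mod_lt _ (by positivity)
  generalize d / L ^ k = a at hdiv
  generalize d % L ^ k = b at hdiv hmod
  have hpow : L ^ k ≤ (L + 1) ^ k := Nat.pow_le_pow_left (Nat.le_succ L) k
  obtain ⟨T₁, hA₁, hT₁⟩ := fine_regime I ω hk hL hLr (n := L ^ k) (by push_cast; exact hLkr) hpow
  obtain ⟨T₂, hA₂, hT₂⟩ := fine_regime I ω hk hL hLr (n := b)
    (le_trans (by exact_mod_cast hmod.le) hLkr) (hmod.le.trans hpow)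
  refine ⟨a * T₁ + T₂, ((hA₁.mul a).add hA₂).mono (by rw [mul_comm]; omega) le_rfl, ?_⟩
  obtain ⟨j, rfl⟩ : ∃ j, k = j + 2 := ⟨k - 2, by omega⟩
  have e1 : j + 2 - 1 = j + 1 := by omega
  have e2 : j + 2 - 2 = j := by omega
  rw [e1, e2] at hT₁ hT₂
  rw [e1]
  set F := fineConst (j + 2)
  set K : ℝ := ((j + 2 : ℕ) : ℝ) with hK
  set Q : ℝ := (L : ℝ) ^ j with hQ
  have hQ0 : 0 < Q := by positivity
  have hP : (L : ℝ) ^ (j + 1) = L * Q := by rw [hQ]; ring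
  have hLk : (((L ^ (j + 2) : ℕ) : ℝ)) = L ^ 2 * Q := by rw [hQ]; push_cast; ring
  rw [hP, hLk] at hT₁
  rw [hP] at hT₂
  have e4 : (L : ℝ) ^ 2 * Q / L = L * Q := by field_simp
  rw [e4] at hT₁
  have hd' : (L : ℝ) ^ 2 * Q * a + b = d := by rw [← hLk]; exact_mod_cast hdiv
  have hLd : (L : ℝ) ^ 2 * Q ≤ d := by
    rw [← hLk]; push_cast; exact hLkr.trans hd
  have hb0 : (0 : ℝ) ≤ b := Nat.cast_nonneg b
  have ha0 : (0 : ℝ) ≤ a := Nat.cast_nonneg a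
  have h3 : (L : ℝ) * Q ≤ r ^ (j + 1) := by
    rw [← hP]; exact pow_le_pow_left₀ hL0.le hLr _
  have h4 : ((a : ℝ) + 1) * Q ≤ 8 * (d / r ^ 2) := by
    have h5 : ((a : ℝ) + 1) * Q ≤ 2 * d * (1 / (L : ℝ)) ^ 2 := by
      rw [one_div, inv_pow, ← div_eq_mul_inv, le_div_iff₀ (by positivity)]
      linarith
    have h6 : (1 / (L : ℝ)) ^ 2 ≤ (2 / r) ^ 2 := pow_le_pow_left₀ (by positivity) h2 2
    have h7 := mul_le_mul_of_nonneg_left h6 (by positivity : (0 : ℝ) ≤ 2 * d)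
    have h8 : 2 * (d : ℝ) * (2 / r) ^ 2 = 8 * (d / r ^ 2) := by ring
    linarith
  have h5 : (d : ℝ) / L ≤ d / r + 2 * (d / r ^ 2) := by
    have := mul_le_mul_of_nonneg_left h1 (Nat.cast_nonneg (α := ℝ) d)
    rw [mul_one_div] at this
    refine this.trans (le_of_eq ?_)
    ring
  have h6 : (d : ℝ) / L = L * Q * a + b / L := by
    rw [← hd']
    field_simp
  have h7 := mul_le_mul_of_nonneg_left hT₁ ha0
  have h8 := mul_le_mul_of_nonneg_left h4 hF0
  have h9 := mul_le_mul_of_nonneg_left h5 (by positivity : 0 ≤ 4 * K)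
  have h10 : 0 ≤ (b : ℝ) / L := by positivity
  have h11 : K * (d : ℝ) / r = K * (d / r) := by ring
  rw [h6] at h9
  rw [h11]
  push_cast
  linarith

theorem large_stretch (I : Input V) {k : ℕ} {r : ℝ} (ω : Outcome V k) (hk : 2 ≤ k) {η : ℝ}
    (hη : 0 < η) {T : ℝ} (hT : T = 51 + (16 * k + 16 * fineConst k + 8) / η) (hr : T ≤ r)
    (u v : V) (d : ℕ) (huv : I.G.Reachable u v) (hd : I.G.dist u v = d) (hdr : r ^ k ≤ d) :
    DistLE (spanner I r ω) u v (d + (4 + η) * (k * d / r + r ^ (k - 1))) ∧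
    (T * r ^ k ≤ d → DistLE (spanner I r ω) u v (d + (4 + η) * k * d / r)) := by
  have hF0 : 0 ≤ fineConst k := by unfold fineConst; positivity
  have hk2 : (2 : ℝ) ≤ k := by exact_mod_cast hk
  have hT51 : 51 ≤ T := by
    have : 0 ≤ (16 * k + 16 * fineConst k + 8) / η := by positivity
    linarith
  have hTη : 16 * k + 16 * fineConst k + 8 ≤ T * η := by
    have h1 : (16 * k + 16 * fineConst k + 8) / η ≤ T := by linarith
    exact (div_le_iff₀ hη).1 h1
  have hr0 : 0 < r := by linarith
  have hd0 : (0 : ℝ) ≤ d := Nat.cast_nonneg d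
  obtain ⟨t, hA, ht⟩ := additive_of_pow_le_fine I ω hk (by linarith) hdr
  set A : ℝ := d / r with hAd
  have hA0 : 0 ≤ A := by positivity
  have e1 : (k : ℝ) * d / r = k * A := by rw [hAd]; ring
  have e2 : (d : ℝ) / r ^ 2 = A / r := by rw [hAd]; field_simp
  have e3 : (4 + η) * k * d / r = (4 + η) * (k * A) := by rw [hAd]; ring
  rw [e1, e2] at ht
  rw [e1, e3]
  -- The choice of T serves twice: r ≥ T absorbs the term d/r² into half of η, and d ≥ T r^k absorbs
  -- 4r^(k-1) into the other half.
  have hlow : (8 * k + 8 * fineConst k) * (A / r) ≤ η / 2 * A := by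
    rw [mul_div_assoc', div_le_iff₀ hr0]
    have h1 : T * η ≤ r * η := mul_le_mul_of_nonneg_right hr hη.le
    have h2 : 16 * k + 16 * fineConst k ≤ r * η := by linarith
    have h3 := mul_le_mul_of_nonneg_right h2 hA0
    linarith
  have hηA : η * A ≤ η * (k * A) := by
    refine mul_le_mul_of_nonneg_left ?_ hη.le
    nlinarith
  have hηA0 : 0 ≤ η * A := by positivity
  have hrp : 0 ≤ r ^ (k - 1) := by positivity
  have hηr : 0 ≤ η * r ^ (k - 1) := by positivity
  refine ⟨hA.distLE huv hd.le ?_, fun hTd => hA.distLE huv hd.le ?_⟩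
  · rw [hd]
    linarith
  · rw [hd]
    have h1 : T * r ^ (k - 1) ≤ A := by
      rw [hAd, le_div_iff₀ hr0, mul_assoc, ← pow_succ, Nat.sub_add_cancel (by omega)]
      exact hTd
    have h2 : 4 * r ^ (k - 1) ≤ η / 2 * A := by
      have h3 := mul_le_mul_of_nonneg_left h1 (by positivity : 0 ≤ η / 2)
      have h4 : 8 ≤ T * η := by linarith
      have h5 := mul_le_mul_of_nonneg_right h4 hrp
      linarith
    linarith

end Stretch


/-! ### Deterministic edge counts. -/

section Counting

variable {V : Type u} [Fintype V] [LinearOrder V]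

theorem IsClosest.eq {I : Input V} {A : Finset V} {u p q : V} (hp : IsClosest I A u p)
    (hq : IsClosest I A u q) : p = q := by
  have h1 := hp.2.2 q hq.1 hq.2.1
  have h2 := hq.2.2 p hp.1 hp.2.1
  rcases h1 with h1 | ⟨h1, h1'⟩ <;> rcases h2 with h2 | ⟨h2, h2'⟩
  · omega
  · omega
  · omega
  · exact le_antisymm h1' h2'

/-- A better candidate for a vertex of P(u,p) would also be better for u, after prepending the
initial part of the path. Ties are settled alike because they are broken by one fixed order. -/
theorem IsClosest.pathVert {I : Input V} {A : Finset V} {u p : V} (hp : IsClosest I A u p)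
    {j : ℕ} (hj : j ≤ I.G.dist u p) : IsClosest I A (pathVert I u p j) p := by
  obtain ⟨hr, hd⟩ := pathVert_reachable_dist I hp.2.1 j hj
  refine ⟨hp.1, hr, fun w hw hrw => ?_⟩
  have h1 := edist_pathVert_graph_le (I := I) (u := u) (v := p) (Nat.zero_le j) hj
  rw [pathVert_zero] at h1
  obtain ⟨hr', hd'⟩ := edist_le_coe_iff.1 (edist_triangle_le h1 (edist_eq_coe_dist hrw).le)
  rcases hp.2.2 w hw hr' with h | ⟨h, h'⟩
  · left; omega
  · rcases lt_or_ge (I.G.dist (PathBuying.pathVert I u p j) p)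
      (I.G.dist (PathBuying.pathVert I u p j) w) with h2 | h2
    · exact Or.inl h2
    · exact Or.inr ⟨by omega, h'⟩

/-- The links to one level form a forest. -/
theorem card_linkEdges_le (I : Input V) {k : ℕ} (ω : Outcome V k) (i : ℕ) :
    (linkEdges I ω i).card ≤ Fintype.card V := by
  classical
  -- Every link edge is the first edge of the link of its own tail, so w ↦ (first edge of its link)
  -- covers them all. The value `s(w, w)` is a filler for vertices without a link.
  let f : V → Sym2 V := fun w =>
    if h : ∃ p, IsClosest I (levelSet ω i) w p then s(w, I.paths.step h.choose w) else s(w, w)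
  refine (Finset.card_le_card (t := Finset.univ.image f) ?_).trans Finset.card_image_le
  intro e he
  simp only [linkEdges, Finset.mem_biUnion, Finset.mem_filter, Finset.mem_univ, true_and] at he
  obtain ⟨⟨u, p⟩, hp, he⟩ := he
  obtain ⟨j, hj, rfl⟩ := mem_pathEdges.1 he
  have hc : IsClosest I (levelSet ω i) (pathVert I u p j) p := IsClosest.pathVert hp hj.le
  have hex : ∃ q, IsClosest I (levelSet ω i) (pathVert I u p j) q := ⟨p, hc⟩
  refine Finset.mem_image.2 ⟨pathVert I u p j, Finset.mem_univ _, ?_⟩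
  simp only [f, dif_pos hex]
  rw [hex.choose_spec.eq hc, ← pathVert_succ]

open scoped Classical in
/-- Pairs of different vertices of level `i`, the second one closer to the first one than
level `i + 1`. -/
def ballPairs (I : Input V) {k : ℕ} (ω : Outcome V k) (i : ℕ) : Finset (V × V) :=
  Finset.univ.filter fun p => p.1 ≠ p.2 ∧ p.1 ∈ levelSet ω i ∧ p.2 ∈ levelSet ω i ∧
    InBall I (levelSet ω (i + 1)) p.1 p.2

theorem card_pathEdges_le (I : Input V) (u v : V) :
    (pathEdges I u v).card ≤ I.G.dist u v := by
  unfold pathEdges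
  exact Finset.card_image_le.trans (by simp)

theorem card_ballEdges_le (I : Input V) {k : ℕ} {r : ℝ} (hr : 0 ≤ r) (ω : Outcome V k) (i : ℕ) :
    ((ballEdges I r ω i).card : ℝ) ≤ (r + 2) ^ i * (ballPairs I ω i).card := by
  classical
  have hsub : ballEdges I r ω i ⊆ ((ballPairs I ω i).filter
      fun p => (I.G.dist p.1 p.2 : ℝ) ≤ (r + 2) ^ i).biUnion fun p => pathEdges I p.1 p.2 := by
    intro e he
    simp only [ballEdges, Finset.mem_biUnion, Finset.mem_filter, Finset.mem_univ,
      true_and] at he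
    obtain ⟨p, ⟨h1, h2, h3, h4⟩, he⟩ := he
    refine Finset.mem_biUnion.2 ⟨p, ?_, he⟩
    have hne : p.1 ≠ p.2 := by
      intro h
      obtain ⟨j, hj, -⟩ := mem_pathEdges.1 he
      rw [h, SimpleGraph.dist_self] at hj
      omega
    simp only [ballPairs, Finset.mem_filter, Finset.mem_univ, true_and]
    exact ⟨⟨hne, h1, h2, h3⟩, h4⟩
  have h1 : ((ballEdges I r ω i).card : ℝ) ≤ ∑ p ∈ (ballPairs I ω i).filter
      (fun p => (I.G.dist p.1 p.2 : ℝ) ≤ (r + 2) ^ i), ((pathEdges I p.1 p.2).card : ℝ) := by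
    exact_mod_cast (Finset.card_le_card hsub).trans Finset.card_biUnion_le
  refine h1.trans ?_
  have h2 : ∑ p ∈ (ballPairs I ω i).filter
      (fun p => (I.G.dist p.1 p.2 : ℝ) ≤ (r + 2) ^ i), ((pathEdges I p.1 p.2).card : ℝ) ≤
      ((ballPairs I ω i).filter
        (fun p => (I.G.dist p.1 p.2 : ℝ) ≤ (r + 2) ^ i)).card • ((r + 2) ^ i) := by
    refine Finset.sum_le_card_nsmul _ _ _ fun p hp => ?_
    refine le_trans ?_ (Finset.mem_filter.1 hp).2
    exact_mod_cast card_pathEdges_le I p.1 p.2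
  refine h2.trans ?_
  rw [nsmul_eq_mul, mul_comm]
  refine mul_le_mul_of_nonneg_left ?_ (by positivity)
  exact_mod_cast Finset.card_filter_le _ _

/-- Each demand pair is oriented so that its second vertex lies in the ball of its first; the pair
is recovered from either orientation. -/
theorem card_demandPairs_le (I : Input V) {k : ℕ} (ω : Outcome V k) :
    (demandPairs I ω).card ≤ (ballPairs I ω 1).card := by
  classical
  refine Finset.card_le_card_of_injOn
    (fun p => if InBall I (levelSet ω 2) p.1 p.2 then p else p.swap) ?_ ?_
  · intro p hp
    simp only [demandPairs, Finset.coe_filter, Finset.mem_univ, true_and, Set.mem_ofPred_eq] at hp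
    obtain ⟨hlt, h1, h2, h3⟩ := hp
    simp only [ballPairs, Finset.coe_filter, Finset.mem_univ, true_and, Set.mem_ofPred_eq]
    split_ifs with h
    · exact ⟨hlt.ne, h1, h2, h⟩
    · exact ⟨hlt.ne', h2, h1, h3.resolve_left h⟩
  · intro p hp q hq hpq
    simp only [demandPairs, Finset.coe_filter, Finset.mem_univ, true_and,
      Set.mem_ofPred_eq] at hp hq
    obtain ⟨p1, p2⟩ := p
    obtain ⟨q1, q2⟩ := q
    have hp' : p1 < p2 := hp.1
    have hq' : q1 < q2 := hq.1
    simp only at hpq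
    split_ifs at hpq <;> simp only [Prod.swap_prod_mk, Prod.mk.injEq] at hpq ⊢ <;>
      obtain ⟨rfl, rfl⟩ := hpq
    · exact ⟨rfl, rfl⟩
    · exact absurd hp' hq'.not_gt
    · exact absurd hp' hq'.not_gt
    · exact ⟨rfl, rfl⟩

/-- The size of the spanner in terms of the numbers of pairs inside balls. -/
theorem ncard_spanner_le (I : Input V) {k : ℕ} {r : ℝ} (hr : 0 ≤ r) (ω : Outcome V k) :
    ((spanner I r ω).edgeSet.ncard : ℝ) ≤ (k + 1) * Fintype.card V +
      (ballPairs I ω 0).card + 30 * (ballPairs I ω 1).card +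
      ∑ i ∈ Finset.Icc 2 k, (r + 2) ^ i * ((ballPairs I ω i).card : ℝ) := by
  have h1 : (spanner I r ω).edgeSet.ncard ≤ (spannerEdges I r ω).card := by
    rw [← Set.ncard_coe_finset]
    refine Set.ncard_le_ncard ?_ (Finset.finite_toSet _)
    rw [spanner, SimpleGraph.edgeSet_fromEdgeSet]
    exact Set.sdiff_subset
  have h2 : (spannerEdges I r ω).card ≤ (boughtEdges I r ω).card +
      ∑ i ∈ Finset.Icc 1 k, (linkEdges I ω i).card +
      ∑ i ∈ Finset.Icc 2 k, (ballEdges I r ω i).card := by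
    unfold spannerEdges
    refine (Finset.card_union_le _ _).trans (add_le_add ?_ Finset.card_biUnion_le)
    exact (Finset.card_union_le _ _).trans (add_le_add le_rfl Finset.card_biUnion_le)
  have h3 : ∑ i ∈ Finset.Icc 1 k, (linkEdges I ω i).card ≤ k * Fintype.card V := by
    refine (Finset.sum_le_card_nsmul _ _ _ fun i _ => card_linkEdges_le I ω i).trans ?_
    simp
  have h4 := card_boughtEdges_le I r ω
  have h5 : (initialEdges I r ω).card ≤ (ballEdges I r ω 0).card + Fintype.card V :=
    (Finset.card_union_le _ _).trans (add_le_add le_rfl (card_linkEdges_le I ω 1))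
  have h6 := card_ballEdges_le I hr ω 0
  have h7 := card_demandPairs_le I ω
  have h8 : (∑ i ∈ Finset.Icc 2 k, ((ballEdges I r ω i).card : ℝ)) ≤
      ∑ i ∈ Finset.Icc 2 k, (r + 2) ^ i * ((ballPairs I ω i).card : ℝ) :=
    Finset.sum_le_sum fun i _ => card_ballEdges_le I hr ω i
  have h9 : ((spanner I r ω).edgeSet.ncard : ℝ) ≤ (ballEdges I r ω 0).card +
      (k + 1) * Fintype.card V + 30 * (ballPairs I ω 1).card +
      ∑ i ∈ Finset.Icc 2 k, ((ballEdges I r ω i).card : ℝ) := by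
    have : (spanner I r ω).edgeSet.ncard ≤ (ballEdges I r ω 0).card +
      (k + 1) * Fintype.card V + 30 * (ballPairs I ω 1).card +
      ∑ i ∈ Finset.Icc 2 k, (ballEdges I r ω i).card := by
      have : (k + 1) * Fintype.card V = k * Fintype.card V + Fintype.card V := by ring
      omega
    exact_mod_cast this
  rw [pow_zero, one_mul] at h6
  linarith

end Counting

/-! ### Independent promotions and the expected number of pairs in balls. -/

section Sampling

/-- The sum of the powers of `x` over the ranks of a finite set is a geometric sum. -/
theorem sum_pow_rank {α β : Type*} [DecidableEq α] [LinearOrder β] (key : α → β)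
    (hkey : Function.Injective key) (x : ℝ) (T : Finset α) :
    (1 - x) * ∑ v ∈ T, x ^ (T.filter fun w => key w < key v).card = 1 - x ^ T.card := by
  induction T using Finset.induction_on_max_value key with
  | empty => simp
  | insert a s has hmax ih =>
    rw [Finset.sum_insert has, Finset.card_insert_of_notMem has]
    have h1 : ((insert a s).filter fun w => key w < key a) = s := by
      ext w
      simp only [Finset.mem_filter, Finset.mem_insert]
      constructor
      · rintro ⟨rfl | h, h'⟩
        · exact absurd h' (lt_irrefl _)
        · exact h
      · intro h
        refine ⟨Or.inr h, lt_of_le_of_ne (hmax w h) fun he => has ?_⟩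
        rw [← hkey he]
        exact h
    have h2 : ∀ v ∈ s, ((insert a s).filter fun w => key w < key v) =
        s.filter fun w => key w < key v := by
      intro v hv
      rw [Finset.filter_insert, if_neg (not_lt.2 (hmax v hv))]
    rw [h1, Finset.sum_congr rfl fun v hv => by rw [h2 v hv], mul_add, ih]
    ring

variable {k : ℕ}

/-- The probability of the promotions `b` of a single vertex. -/
def vertexWeight (p : ℕ → ℝ) (b : Fin k → Bool) : ℝ :=
  ∏ j : Fin k, if b j = true then p j else 1 - p j

/-- The probability that a vertex is promoted to level `i`. -/
def reachProb (p : ℕ → ℝ) (i : ℕ) : ℝ := ∏ j ∈ Finset.range i, p j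

open scoped Classical in
/-- The indicator of a statement. -/
def ind (P : Prop) : ℝ := if P then 1 else 0

theorem ind_nonneg (P : Prop) : 0 ≤ ind P := by
  unfold ind; split_ifs <;> norm_num

theorem ind_of {P : Prop} (h : P) : ind P = 1 := if_pos h

theorem ind_not_of {P : Prop} (h : ¬ P) : ind P = 0 := if_neg h

theorem ind_not (P : Prop) : ind (¬ P) = 1 - ind P := by
  unfold ind; split_ifs <;> simp_all

theorem vertexWeight_nonneg {p : ℕ → ℝ} (hp : ∀ j, 0 ≤ p j ∧ p j ≤ 1) (b : Fin k → Bool) :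
    0 ≤ vertexWeight p b := by
  refine Finset.prod_nonneg fun j _ => ?_
  have := hp j
  split_ifs <;> linarith

theorem sum_vertexWeight_up (p : ℕ → ℝ) {i : ℕ} (hi : i ≤ k) :
    ∑ b : Fin k → Bool, vertexWeight p b * ind (∀ j : Fin k, j.val < i → b j = true) =
      reachProb p i := by
  classical
  have h1 : ∀ b : Fin k → Bool, vertexWeight p b * ind (∀ j : Fin k, j.val < i → b j = true) =
      ∏ j : Fin k, ((if b j = true then p j else 1 - p j) *
        ind (j.val < i → b j = true)) := by
    intro b
    rw [Finset.prod_mul_distrib, vertexWeight]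
    congr 1
    unfold ind
    by_cases h : ∀ j : Fin k, j.val < i → b j = true
    · rw [if_pos h, Finset.prod_eq_one]
      intro j _
      rw [if_pos (h j)]
    · rw [if_neg h]
      push Not at h
      obtain ⟨j, hj, hbj⟩ := h
      refine (Finset.prod_eq_zero (Finset.mem_univ j) ?_).symm
      rw [if_neg]
      exact fun h => hbj (h hj)
  rw [Finset.sum_congr rfl fun b _ => h1 b]
  have h2 := Finset.prod_univ_sum (fun _ : Fin k => (Finset.univ : Finset Bool))
    (fun j x => (if x = true then p j else 1 - p j) * ind (j.val < i → x = true))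
  rw [Fintype.piFinset_univ] at h2
  rw [← h2]
  have h3 : ∀ j : Fin k, ∑ x : Bool, (if x = true then p j else 1 - p j) *
      ind (j.val < i → x = true) = if j.val < i then p j else 1 := by
    intro j
    rw [Fintype.sum_bool]
    by_cases h : j.val < i <;> simp [ind, h]
  rw [Finset.prod_congr rfl fun j _ => h3 j, reachProb,
    Fin.prod_univ_eq_prod_range (fun j => if j < i then p j else 1) k, ← Finset.prod_filter]
  congr 1
  ext j
  simp only [Finset.mem_filter, Finset.mem_range]
  omega

theorem sum_vertexWeight (p : ℕ → ℝ) : ∑ b : Fin k → Bool, vertexWeight p b = 1 := by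
  have := sum_vertexWeight_up (k := k) p (Nat.zero_le k)
  simpa [ind, reachProb] using this

variable {V : Type u} [Fintype V] [LinearOrder V]

/-- Vertices are sampled independently. -/
theorem sum_prod_vertexWeight (p : ℕ → ℝ) (g : V → (Fin k → Bool) → ℝ) :
    ∑ ω : Outcome V k, (∏ u, vertexWeight p (ω u)) * ∏ u, g u (ω u) =
      ∏ u, ∑ b, vertexWeight p b * g u b := by
  have h := Finset.prod_univ_sum (fun _ : V => (Finset.univ : Finset (Fin k → Bool)))
    (fun u b => vertexWeight p b * g u b)
  rw [Fintype.piFinset_univ] at h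
  rw [h]
  exact Finset.sum_congr rfl fun ω _ => Finset.prod_mul_distrib.symm

/-- The event is contained in an intersection of conditions on distinct single vertices; by
independence the probability of the latter is a product. -/
theorem sum_ind_le (p : ℕ → ℝ) (hp : ∀ j, 0 ≤ p j ∧ p j ≤ 1) {u v : V} (huv : u ≠ v)
    {W : Finset V} (hu : u ∉ W) (hv : v ∉ W) (A B D : (Fin k → Bool) → Prop)
    (P : Outcome V k → Prop)
    (hP : ∀ ω, P ω → A (ω u) ∧ B (ω v) ∧ ∀ w ∈ W, D (ω w)) :
    ∑ ω : Outcome V k, (∏ u, vertexWeight p (ω u)) * ind (P ω) ≤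
      (∑ b, vertexWeight p b * ind (A b)) * (∑ b, vertexWeight p b * ind (B b)) *
        (∑ b, vertexWeight p b * ind (D b)) ^ W.card := by
  classical
  let g : V → (Fin k → Bool) → ℝ := fun w b =>
    (if w = u then ind (A b) else 1) * (if w = v then ind (B b) else 1) *
      (if w ∈ W then ind (D b) else 1)
  have h1 : ∀ ω : Outcome V k, ind (P ω) ≤ ∏ w, g w (ω w) := by
    intro ω
    by_cases h : P ω
    · obtain ⟨hA, hB, hD⟩ := hP ω h
      rw [ind_of h, Finset.prod_eq_one]
      intro w _
      have e1 : (if w = u then ind (A (ω w)) else 1) = 1 := by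
        split_ifs with h'
        · subst h'; exact ind_of hA
        · rfl
      have e2 : (if w = v then ind (B (ω w)) else 1) = 1 := by
        split_ifs with h'
        · subst h'; exact ind_of hB
        · rfl
      have e3 : (if w ∈ W then ind (D (ω w)) else 1) = 1 := by
        split_ifs with h'
        · exact ind_of (hD w h')
        · rfl
      simp only [g, e1, e2, e3, mul_one]
    · have : ind (P ω) = 0 := if_neg h
      rw [this]
      refine Finset.prod_nonneg fun w _ => ?_
      have := ind_nonneg (A (ω w))
      have := ind_nonneg (B (ω w))
      have := ind_nonneg (D (ω w))
      simp only [g]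
      split_ifs <;> positivity
  refine (Finset.sum_le_sum fun ω _ => mul_le_mul_of_nonneg_left (h1 ω)
    (Finset.prod_nonneg fun w _ => vertexWeight_nonneg hp (ω w))).trans (le_of_eq ?_)
  rw [sum_prod_vertexWeight]
  set a := ∑ b, vertexWeight p b * ind (A b)
  set b' := ∑ b, vertexWeight p b * ind (B b)
  set c := ∑ b, vertexWeight p b * ind (D b)
  have h2 : ∀ w : V, ∑ b, vertexWeight p b * g w b =
      (if w = u then a else 1) * (if w = v then b' else 1) * (if w ∈ W then c else 1) := by
    intro w
    simp only [g]
    by_cases hwu : w = u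
    · subst hwu
      simp [huv, hu, a]
    · by_cases hwv : w = v
      · subst hwv
        simp [hwu, hv, b']
      · by_cases hwW : w ∈ W
        · simp [hwu, hwv, hwW, c]
        · simp [hwu, hwv, hwW, sum_vertexWeight]
  rw [Finset.prod_congr rfl fun w _ => h2 w, Finset.prod_mul_distrib, Finset.prod_mul_distrib,
    Finset.prod_ite_eq' Finset.univ u, Finset.prod_ite_eq' Finset.univ v]
  simp [Finset.prod_ite_mem]

theorem mem_levelSet {ω : Outcome V k} {i : ℕ} (hi : i ≤ k) {u : V} :
    u ∈ levelSet ω i ↔ ∀ j : Fin k, j.val < i → ω u j = true := by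
  simp [levelSet, hi]

/-- The expectation of a function of the outcome. -/
def expect (p : ℕ → ℝ) (f : Outcome V k → ℝ) : ℝ :=
  ∑ ω : Outcome V k, (∏ u, vertexWeight p (ω u)) * f ω

theorem expect_card_ballPairs (p : ℕ → ℝ) (I : Input V) (i : ℕ) :
    expect p (fun ω : Outcome V k => ((ballPairs I ω i).card : ℝ)) =
      ∑ u, ∑ v, expect p (fun ω : Outcome V k => ind (u ≠ v ∧ u ∈ levelSet ω i ∧
        v ∈ levelSet ω i ∧ InBall I (levelSet ω (i + 1)) u v)) := by
  classical
  unfold expect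
  have h : ∀ ω : Outcome V k, ((ballPairs I ω i).card : ℝ) =
      ∑ u, ∑ v, ind (u ≠ v ∧ u ∈ levelSet ω i ∧
        v ∈ levelSet ω i ∧ InBall I (levelSet ω (i + 1)) u v) := by
    intro ω
    rw [ballPairs, Finset.card_filter, ← Fintype.sum_prod_type']
    push_cast
    refine Finset.sum_congr rfl fun x _ => ?_
    unfold ind
    congr
  simp_rw [h, Finset.mul_sum]
  rw [Finset.sum_comm]
  refine Finset.sum_congr rfl fun u _ => ?_
  rw [Finset.sum_comm]

theorem reachProb_bounds {p : ℕ → ℝ} (hp : ∀ j, 0 < p j ∧ p j ≤ 1) (i : ℕ) :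
    0 < reachProb p i ∧ reachProb p i ≤ 1 :=
  ⟨Finset.prod_pos fun j _ => (hp j).1,
    Finset.prod_le_one (fun j _ => (hp j).1.le) fun j _ => (hp j).2⟩

/-- No level lies above k, so balls exclude only unreachable vertices and all pairs of sampled
vertices are counted. -/
theorem expect_ballPairs_top {p : ℕ → ℝ} (hp : ∀ j, 0 < p j ∧ p j ≤ 1) (I : Input V) :
    expect p (fun ω : Outcome V k => ((ballPairs I ω k).card : ℝ)) ≤
      ((Fintype.card V : ℝ) * reachProb p k) ^ 2 := by
  rw [expect_card_ballPairs]
  have hQ := (reachProb_bounds hp k).1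
  have hp' : ∀ j, 0 ≤ p j ∧ p j ≤ 1 := fun j => ⟨(hp j).1.le, (hp j).2⟩
  have h : ∀ u v : V, expect p (fun ω : Outcome V k => ind (u ≠ v ∧ u ∈ levelSet ω k ∧
      v ∈ levelSet ω k ∧ InBall I (levelSet ω (k + 1)) u v)) ≤ reachProb p k ^ 2 := by
    intro u v
    by_cases huv : u = v
    · simp only [expect, huv, ne_eq, not_true_eq_false, false_and]
      simp only [ind, if_false, mul_zero, Finset.sum_const_zero]
      positivity
    · refine (sum_ind_le p hp' huv (W := ∅) (by simp) (by simp)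
        (fun b => ∀ j : Fin k, j.val < k → b j = true)
        (fun b => ∀ j : Fin k, j.val < k → b j = true) (fun _ => True) _ ?_).trans ?_
      · rintro ω ⟨-, h1, h2, -⟩
        exact ⟨(mem_levelSet le_rfl).1 h1, (mem_levelSet le_rfl).1 h2, fun _ _ => trivial⟩
      · rw [sum_vertexWeight_up p le_rfl]
        simp [sq]
  refine (Finset.sum_le_sum fun u _ => Finset.sum_le_sum fun v _ => h u v).trans (le_of_eq ?_)
  simp
  ring

/-- If u has a nonempty ball, it is not in V_{i+1} itself; this yields 1 - p_i in the bound, which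
makes it vanish for certain promotion. The vertices before v in the order of distance must all miss
V_{i+1}, so the sum over v is geometric with ratio 1 - R and total at most 1/R. -/
theorem expect_ballPairs {p : ℕ → ℝ} (hp : ∀ j, 0 < p j ∧ p j ≤ 1) (I : Input V) {i : ℕ}
    (hi : i < k) :
    expect p (fun ω : Outcome V k => ((ballPairs I ω i).card : ℝ)) ≤
      Fintype.card V * (reachProb p i * ((1 - p i) / p i)) := by
  classical
  rw [expect_card_ballPairs]
  obtain ⟨hQ0, hQ1⟩ := reachProb_bounds hp i
  obtain ⟨hR0, hR1⟩ := reachProb_bounds hp (i + 1)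
  have hp' : ∀ j, 0 ≤ p j ∧ p j ≤ 1 := fun j => ⟨(hp j).1.le, (hp j).2⟩
  have hRQ : reachProb p (i + 1) = reachProb p i * p i := Finset.prod_range_succ _ _
  obtain ⟨hpi0, hpi1⟩ := hp i
  set Q := reachProb p i
  set R := reachProb p (i + 1)
  let U : ℕ → (Fin k → Bool) → Prop := fun i b => ∀ j : Fin k, j.val < i → b j = true
  have hup : ∑ b, vertexWeight p b * ind (U i b) = Q := sum_vertexWeight_up p hi.le
  have hup1 : ∑ b, vertexWeight p b * ind (U (i + 1) b) = R :=
    sum_vertexWeight_up p (Nat.succ_le_of_lt hi)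
  have hUU : ∀ b, U (i + 1) b → U i b := fun b h j hj => h j (by omega)
  have hdiff : ∑ b, vertexWeight p b * ind (U i b ∧ ¬ U (i + 1) b) = Q - R := by
    rw [← hup, ← hup1, ← Finset.sum_sub_distrib]
    refine Finset.sum_congr rfl fun b _ => ?_
    rw [← mul_sub]
    congr 1
    have := hUU b
    change _ = ind (U i b) - ind (U (i + 1) b)
    by_cases h : U (i + 1) b
    · simp [ind, h, this h]
    · simp [ind, h]
  have hnot : ∑ b, vertexWeight p b * ind (¬ U (i + 1) b) = 1 - R := by
    rw [← hup1, ← sum_vertexWeight (k := k) p, ← Finset.sum_sub_distrib]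
    refine Finset.sum_congr rfl fun b _ => ?_
    rw [ind_not]
    change _ = vertexWeight p b - vertexWeight p b * ind (U (i + 1) b)
    ring
  have hrow : ∀ u : V, ∑ v, expect p (fun ω : Outcome V k => ind (u ≠ v ∧ u ∈ levelSet ω i ∧
      v ∈ levelSet ω i ∧ InBall I (levelSet ω (i + 1)) u v)) ≤ Q * ((1 - p i) / p i) := by
    intro u
    let T : Finset V := Finset.univ.filter fun v => u ≠ v ∧ I.G.Reachable u v
    -- Ties in distance are broken by the vertex order so that ranks are distinct. Balls are strict,
    -- so an earlier vertex at equal distance must miss V_{i+1} as well.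
    let key : V → ℕ ×ₗ V := fun v => toLex (I.G.dist u v, v)
    have hkey : Function.Injective key := fun v w h => by
      have := congrArg (fun x => (ofLex x).2) h
      simpa [key] using this
    have hterm : ∀ v ∈ T, expect p (fun ω : Outcome V k => ind (u ≠ v ∧ u ∈ levelSet ω i ∧
        v ∈ levelSet ω i ∧ InBall I (levelSet ω (i + 1)) u v)) ≤
        (Q - R) * Q * (1 - R) ^ (T.filter fun w => key w < key v).card := by
      intro v hv
      obtain ⟨-, huv, hruv⟩ := Finset.mem_filter.1 hv
      refine (sum_ind_le p hp' huv (W := T.filter fun w => key w < key v) (by simp [T])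
        (by simp) (fun b => U i b ∧ ¬ U (i + 1) b) (U i) (fun b => ¬ U (i + 1) b) _ ?_).trans
        (le_of_eq ?_)
      · rintro ω ⟨-, h1, h2, -, h3⟩
        refine ⟨⟨(mem_levelSet hi.le).1 h1, fun h => ?_⟩, (mem_levelSet hi.le).1 h2, ?_⟩
        · have := h3 u ((mem_levelSet hi).2 h) (SimpleGraph.Reachable.refl u)
          rw [SimpleGraph.dist_self] at this
          omega
        · intro w hw h
          obtain ⟨hwT, hlt⟩ := Finset.mem_filter.1 hw
          obtain ⟨-, -, hruw⟩ := Finset.mem_filter.1 hwT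
          have := h3 w ((mem_levelSet hi).2 h) hruw
          simp only [key, Prod.Lex.toLex_lt_toLex] at hlt
          omega
      · rw [hdiff, hnot]
        congr 2
    have hzero : ∀ v, v ∉ T → expect p (fun ω : Outcome V k => ind (u ≠ v ∧ u ∈ levelSet ω i ∧
        v ∈ levelSet ω i ∧ InBall I (levelSet ω (i + 1)) u v)) = 0 := by
      intro v hv
      refine Finset.sum_eq_zero fun ω _ => ?_
      have : ¬ (u ≠ v ∧ u ∈ levelSet ω i ∧
        v ∈ levelSet ω i ∧ InBall I (levelSet ω (i + 1)) u v) := by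
        rintro ⟨h1, -, -, h2, -⟩
        exact hv (Finset.mem_filter.2 ⟨Finset.mem_univ _, h1, h2⟩)
      have h0 := ind_not_of this
      simp only [h0, mul_zero]
    rw [← Finset.sum_subset (Finset.subset_univ T) fun v _ hv => hzero v hv]
    refine (Finset.sum_le_sum hterm).trans ?_
    rw [← Finset.mul_sum]
    have hgeo := sum_pow_rank key hkey (1 - R) T
    rw [sub_sub_cancel] at hgeo
    have h1 : 0 ≤ (1 - R) ^ T.card := pow_nonneg (by linarith) _
    set s := ∑ v ∈ T, (1 - R) ^ (T.filter fun w => key w < key v).card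
    have h2 : s ≤ 1 / R := by
      rw [le_div_iff₀ hR0]
      linarith
    have h3 : 0 ≤ (Q - R) * Q := by
      rw [hRQ]
      have : 0 ≤ Q * (1 - p i) := mul_nonneg hQ0.le (by linarith)
      nlinarith
    refine (mul_le_mul_of_nonneg_left h2 h3).trans (le_of_eq ?_)
    rw [hRQ]
    field_simp
  refine (Finset.sum_le_sum fun u _ => hrow u).trans (le_of_eq ?_)
  simp

end Sampling


/-! ### Exponents and the balance between levels. -/

section Exponents

theorem two_pow_sub_one_pos (k : ℕ) : (0 : ℝ) < 2 ^ (k + 1) - 1 := by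
  have : (1 : ℝ) < 2 ^ (k + 1) := one_lt_pow₀ (by norm_num) (by omega)
  linarith

theorem hExp_lt {k : ℕ} (hk : 2 ≤ k) : hExp k < 3 / 4 := by
  obtain ⟨j, rfl⟩ := Nat.exists_eq_add_of_le' hk
  rw [hExp, div_lt_iff₀ (two_pow_sub_one_pos _)]
  have h1 : (2 : ℝ) ^ (j + 2 + 1) = 4 * 2 ^ (j + 2 - 1) := by
    rw [show j + 2 - 1 = j + 1 by omega]; ring
  rw [h1]
  push_cast
  have : (0 : ℝ) ≤ j := Nat.cast_nonneg j
  linarith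

theorem hExp_nonneg {k : ℕ} (hk : 2 ≤ k) : 0 ≤ hExp k := by
  refine div_nonneg ?_ (two_pow_sub_one_pos k).le
  obtain ⟨j, rfl⟩ := Nat.exists_eq_add_of_le' hk
  rw [show j + 2 - 1 = j + 1 by omega]
  have h1 : (j + 1 : ℝ) < 2 ^ (j + 1) := by exact_mod_cast Nat.lt_two_pow_self (n := j + 1)
  have h2 : (1 : ℝ) ≤ 2 ^ j := one_le_pow₀ (by norm_num)
  have h3 : (2 : ℝ) ^ (j + 1) = 2 * 2 ^ j := by ring
  push_cast
  linarith

theorem hSeq_add_two (k j : ℕ) :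
    hSeq k (j + 2) = (2 ^ (j + 2) - 1) * hExp k - (3 * 2 ^ j - j - 3) := by
  induction j with
  | zero => simp only [hSeq]; norm_num
  | succ j ih =>
    rw [show j + 1 + 2 = j + 3 by omega, hSeq, ih]
    push_cast
    ring

theorem hSeq_succ (k : ℕ) {i : ℕ} (hi : 2 ≤ i) :
    hSeq k (i + 1) = 2 * hSeq k i + hExp k - i := by
  obtain ⟨j, rfl⟩ := Nat.exists_eq_add_of_le' hi
  rw [show j + 2 + 1 = j + 3 by omega, hSeq]
  push_cast
  ring

/-- The equation that determines h = h(1): it lets the top level, where all pairs count, cost as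
much as the others. -/
theorem two_mul_hSeq_top {k : ℕ} (hk : 2 ≤ k) : 2 * hSeq k k + hExp k = k := by
  obtain ⟨j, rfl⟩ := Nat.exists_eq_add_of_le' hk
  have hN := two_pow_sub_one_pos (j + 2)
  have h1 : hExp (j + 2) * (2 ^ (j + 2 + 1) - 1) = 3 * 2 ^ (j + 2 - 1) - (((j + 2 : ℕ) : ℝ) + 2) :=
    div_mul_cancel₀ _ hN.ne'
  rw [show j + 2 - 1 = j + 1 by omega] at h1
  rw [hSeq_add_two]
  push_cast at h1 ⊢
  have h2 : (2 : ℝ) ^ (j + 1) = 2 * 2 ^ j := by ring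
  have h3 : (2 : ℝ) ^ (j + 2) = 4 * 2 ^ j := by ring
  have h4 : (2 : ℝ) ^ (j + 2 + 1) = 8 * 2 ^ j := by ring
  rw [h2, h4] at h1
  rw [h3]
  linarith

variable {n k : ℕ} {r : ℝ}

theorem sampleProb_eq_exp (hn : 0 < n) (hr : 0 < r) (i : ℕ) :
    sampleProb n k r i = Real.exp (-((2 ^ i - 1) / (2 ^ (k + 1) - 1) * Real.log n) -
      hSeq k i * Real.log r) := by
  have hn' : (0 : ℝ) < n := Nat.cast_pos.2 hn
  rw [sampleProb, Real.rpow_def_of_pos hn', Real.rpow_def_of_pos hr, ← Real.exp_add]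
  congr 1
  ring

/-- The number of edges that every level of the construction may contribute. -/
def levelBound (n k : ℕ) (r : ℝ) : ℝ :=
  r ^ hExp k * (n : ℝ) ^ (1 + 1 / ((2 : ℝ) ^ (k + 1) - 1))

theorem sizeBound_eq (n k : ℕ) (r : ℝ) : sizeBound n k r = k * levelBound n k r := by
  rw [sizeBound, levelBound]; ring

theorem levelBound_nonneg (hr : 0 ≤ r) : 0 ≤ levelBound n k r := by
  unfold levelBound; positivity

theorem levelBound_eq_exp (hn : 0 < n) (hr : 0 < r) :
    levelBound n k r = Real.exp ((1 + 1 / ((2 : ℝ) ^ (k + 1) - 1)) * Real.log n +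
      hExp k * Real.log r) := by
  have hn' : (0 : ℝ) < n := Nat.cast_pos.2 hn
  rw [levelBound, Real.rpow_def_of_pos hn', Real.rpow_def_of_pos hr, ← Real.exp_add]
  congr 1
  ring

theorem le_levelBound (hn : 0 < n) (hk : 2 ≤ k) (hr : 1 ≤ r) : (n : ℝ) ≤ levelBound n k r := by
  have hn' : (1 : ℝ) ≤ n := Nat.one_le_cast.2 hn
  have h1 : (1 : ℝ) ≤ r ^ hExp k := Real.one_le_rpow hr (hExp_nonneg hk)
  have h2 : (n : ℝ) ≤ (n : ℝ) ^ (1 + 1 / ((2 : ℝ) ^ (k + 1) - 1)) := by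
    refine Real.self_le_rpow_of_one_le hn' ?_
    have := two_pow_sub_one_pos k
    have : 0 ≤ 1 / ((2 : ℝ) ^ (k + 1) - 1) := by positivity
    linarith
  rw [levelBound]
  nlinarith

theorem sampleProb_pos (hn : 0 < n) (hr : 0 < r) (i : ℕ) : 0 < sampleProb n k r i := by
  rw [sampleProb_eq_exp hn hr]
  exact Real.exp_pos _

theorem sampleProb_zero (hn : 0 < n) (hr : 0 < r) : sampleProb n k r 0 = 1 := by
  rw [sampleProb_eq_exp hn hr]
  simp [hSeq]

theorem level_rate_zero (hn : 0 < n) (hr : 0 < r) :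
    n * (sampleProb n k r 0 * (sampleProb n k r 0 / sampleProb n k r 1)) = levelBound n k r := by
  have hn' : (0 : ℝ) < n := Nat.cast_pos.2 hn
  have hN := two_pow_sub_one_pos k
  rw [levelBound_eq_exp hn hr, sampleProb_eq_exp hn hr, sampleProb_eq_exp hn hr, ← Real.exp_sub,
    ← Real.exp_add]
  nth_rewrite 1 [← Real.exp_log hn']
  rw [← Real.exp_add]
  congr 1
  simp only [hSeq]
  field_simp
  ring

/-- There is no factor r, since path buying spends boundedly many edges per pair; hence h(2) =
3h(1), outside the later recursion. -/
theorem level_rate_one (hn : 0 < n) (hr : 0 < r) :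
    n * (sampleProb n k r 1 * (sampleProb n k r 1 / sampleProb n k r 2)) = levelBound n k r := by
  have hn' : (0 : ℝ) < n := Nat.cast_pos.2 hn
  have hN := two_pow_sub_one_pos k
  rw [levelBound_eq_exp hn hr, sampleProb_eq_exp hn hr, sampleProb_eq_exp hn hr, ← Real.exp_sub,
    ← Real.exp_add]
  nth_rewrite 1 [← Real.exp_log hn']
  rw [← Real.exp_add]
  congr 1
  simp only [hSeq]
  field_simp
  ring

/-- The recursion for h(i+1) is this balance, read off from the exponent of r. The exponent of n is
1 + ((2^(i+1)-1) - 2(2^i-1))/(2^(k+1)-1). -/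
theorem level_rate (hn : 0 < n) (hr : 0 < r) {i : ℕ} (hi : 2 ≤ i) :
    r ^ i * (n * (sampleProb n k r i * (sampleProb n k r i / sampleProb n k r (i + 1)))) =
      levelBound n k r := by
  have hn' : (0 : ℝ) < n := Nat.cast_pos.2 hn
  have hN := two_pow_sub_one_pos k
  have hri : r ^ i = Real.exp (i * Real.log r) := by
    rw [Real.exp_nat_mul, Real.exp_log hr]
  rw [levelBound_eq_exp hn hr, sampleProb_eq_exp hn hr, sampleProb_eq_exp hn hr, ← Real.exp_sub,
    ← Real.exp_add, hri]
  nth_rewrite 1 [← Real.exp_log hn']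
  rw [← Real.exp_add, ← Real.exp_add, hSeq_succ k hi]
  congr 1
  field_simp
  ring

theorem level_rate_top (hn : 0 < n) (hr : 0 < r) (hk : 2 ≤ k) :
    r ^ k * (n * sampleProb n k r k) ^ 2 = levelBound n k r := by
  have hn' : (0 : ℝ) < n := Nat.cast_pos.2 hn
  have hN := two_pow_sub_one_pos k
  have hrk : r ^ k = Real.exp (k * Real.log r) := by
    rw [Real.exp_nat_mul, Real.exp_log hr]
  have hh : hExp k = k - 2 * hSeq k k := by linarith [two_mul_hSeq_top hk]
  have hnn : (n : ℝ) ^ 2 = Real.exp ((2 : ℕ) * Real.log n) := by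
    rw [Real.exp_nat_mul, Real.exp_log hn']
  rw [levelBound_eq_exp hn hr, sampleProb_eq_exp hn hr, hrk, hh, mul_pow, hnn, ← Real.exp_nat_mul,
    ← Real.exp_add, ← Real.exp_add]
  congr 1
  push_cast
  field_simp
  ring

theorem promoteProb_bounds (hn : 0 < n) (hr : 0 < r) (i : ℕ) :
    0 < promoteProb n k r i ∧ promoteProb n k r i ≤ 1 :=
  ⟨lt_min one_pos (div_pos (sampleProb_pos hn hr _) (sampleProb_pos hn hr _)), min_le_left _ _⟩

theorem reachProb_promoteProb_le (hn : 0 < n) (hr : 0 < r) (i : ℕ) :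
    reachProb (promoteProb n k r) i ≤ sampleProb n k r i := by
  induction i with
  | zero => simp [reachProb, sampleProb_zero hn hr]
  | succ i ih =>
    have h1 := sampleProb_pos (k := k) hn hr i
    rw [reachProb, Finset.prod_range_succ]
    refine (mul_le_mul ih (min_le_right _ _) (promoteProb_bounds hn hr i).1.le h1.le).trans
      (le_of_eq ?_)
    field_simp

/-- When the ratio is truncated to 1, the reciprocal of the probability may exceed q_i/q_{i+1}, but
the odds against promotion are 0. This is why the odds appear in `expect_ballPairs`. -/
theorem promoteProb_odds_le (hn : 0 < n) (hr : 0 < r) (i : ℕ) :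
    (1 - promoteProb n k r i) / promoteProb n k r i ≤
      sampleProb n k r i / sampleProb n k r (i + 1) := by
  have h1 := sampleProb_pos (k := k) hn hr i
  have h2 := sampleProb_pos (k := k) hn hr (i + 1)
  have h3 := promoteProb_bounds (k := k) hn hr i
  rcases min_choice 1 (sampleProb n k r (i + 1) / sampleProb n k r i) with h | h
  · have h' : promoteProb n k r i = 1 := h
    rw [h', sub_self, zero_div]
    positivity
  · have h' : promoteProb n k r i = sampleProb n k r (i + 1) / sampleProb n k r i := h
    rw [← inv_div (sampleProb n k r (i + 1)), ← h', ← one_div]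
    exact div_le_div_of_nonneg_right (by linarith [h3.1]) h3.1.le

end Exponents

/-! ### Linearity and monotonicity of expectation. -/

section Expectation

variable {V : Type u} [Fintype V] [LinearOrder V] {k : ℕ} {p : ℕ → ℝ}

theorem expect_mono (hp : ∀ j, 0 ≤ p j ∧ p j ≤ 1) {f g : Outcome V k → ℝ} (h : ∀ ω, f ω ≤ g ω) :
    expect p f ≤ expect p g :=
  Finset.sum_le_sum fun ω _ => mul_le_mul_of_nonneg_left (h ω)
    (Finset.prod_nonneg fun u _ => vertexWeight_nonneg hp (ω u))

theorem expect_add (f g : Outcome V k → ℝ) :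
    expect p (fun ω => f ω + g ω) = expect p f + expect p g := by
  simp only [expect, mul_add, Finset.sum_add_distrib]

theorem expect_const_mul (c : ℝ) (f : Outcome V k → ℝ) :
    expect p (fun ω => c * f ω) = c * expect p f := by
  simp only [expect, Finset.mul_sum]
  exact Finset.sum_congr rfl fun ω _ => by ring

theorem expect_sum {ι : Type*} (s : Finset ι) (f : ι → Outcome V k → ℝ) :
    expect p (fun ω => ∑ i ∈ s, f i ω) = ∑ i ∈ s, expect p (f i) := by
  simp only [expect, Finset.mul_sum]
  exact Finset.sum_comm

theorem expect_const (c : ℝ) : expect p (fun _ : Outcome V k => c) = c := by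
  have h := sum_prod_vertexWeight (V := V) (k := k) p fun _ _ => 1
  simp only [Finset.prod_const_one, mul_one, sum_vertexWeight] at h
  rw [expect, ← Finset.sum_mul, h, one_mul]

end Expectation

/-! ### The expected size of the spanner. -/

section Size

variable {V : Type u} [Fintype V] [LinearOrder V]

theorem expect_ballPairs_level (I : Input V) {k : ℕ} {r : ℝ} (hn : 0 < Fintype.card V)
    (hr : 0 < r) {i : ℕ} (hi : i < k) :
    expect (promoteProb (Fintype.card V) k r)
      (fun ω : Outcome V k => ((ballPairs I ω i).card : ℝ)) ≤
    Fintype.card V * (sampleProb (Fintype.card V) k r i *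
      (sampleProb (Fintype.card V) k r i / sampleProb (Fintype.card V) k r (i + 1))) := by
  have hp := fun j => promoteProb_bounds (k := k) hn hr j
  refine (expect_ballPairs hp I hi).trans ?_
  refine mul_le_mul_of_nonneg_left ?_ (Nat.cast_nonneg _)
  refine mul_le_mul (reachProb_promoteProb_le hn hr i) (promoteProb_odds_le hn hr i) ?_
    (sampleProb_pos hn hr i).le
  exact div_nonneg (by linarith [(hp i).2]) (hp i).1.le

/-- The expected size before the dependence on `k` is simplified. -/
theorem expectedSize_le_of_pos (I : Input V) {k : ℕ} {r : ℝ} (hn : 0 < Fintype.card V)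
    (hk : 2 ≤ k) (hr : 2 ≤ r) :
    expectedSize I k r ≤
      (k + 32 + k * (1 + 2 / r) ^ k) * levelBound (Fintype.card V) k r := by
  have hr0 : 0 < r := by linarith
  set n := Fintype.card V with hn_def
  set p := promoteProb n k r with hp_def
  have hp : ∀ j, 0 < p j ∧ p j ≤ 1 := fun j => promoteProb_bounds hn hr0 j
  set B := levelBound n k r with hB_def
  have hB : 0 ≤ B := levelBound_nonneg hr0.le
  have hM : 1 ≤ 1 + 2 / r := by
    have : 0 ≤ 2 / r := by positivity
    linarith
  have e1 : expectedSize I k r =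
      expect p (fun ω : Outcome V k => ((spanner I r ω).edgeSet.ncard : ℝ)) := rfl
  have e2 := expect_mono (V := V) (k := k) (p := p) (fun j => ⟨(hp j).1.le, (hp j).2⟩)
    fun ω => ncard_spanner_le I hr0.le ω
  rw [expect_add, expect_add, expect_add, expect_const, expect_const_mul, expect_sum] at e2
  have t0 : expect p (fun ω : Outcome V k => ((ballPairs I ω 0).card : ℝ)) ≤ B :=
    (expect_ballPairs_level I hn hr0 (by omega)).trans (level_rate_zero hn hr0).le
  have t1 : expect p (fun ω : Outcome V k => ((ballPairs I ω 1).card : ℝ)) ≤ B :=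
    (expect_ballPairs_level I hn hr0 (by omega)).trans (level_rate_one hn hr0).le
  have ti : ∀ i ∈ Finset.Icc 2 k,
      r ^ i * expect p (fun ω : Outcome V k => ((ballPairs I ω i).card : ℝ)) ≤ B := by
    intro i hi
    obtain ⟨h2, hik⟩ := Finset.mem_Icc.1 hi
    rcases hik.lt_or_eq with h | rfl
    · exact (mul_le_mul_of_nonneg_left (expect_ballPairs_level I hn hr0 h) (by positivity)).trans
        (level_rate hn hr0 h2).le
    · refine le_trans ?_ (level_rate_top hn hr0 h2).le
      refine mul_le_mul_of_nonneg_left ((expect_ballPairs_top hp I).trans ?_) (by positivity)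
      have hQ := (reachProb_bounds hp i).1.le
      gcongr
      exact reachProb_promoteProb_le hn hr0 i
  have ts : ∑ i ∈ Finset.Icc 2 k, expect p (fun ω : Outcome V k =>
      (r + 2) ^ i * ((ballPairs I ω i).card : ℝ)) ≤ k * ((1 + 2 / r) ^ k * B) := by
    have h : ∀ i ∈ Finset.Icc 2 k, expect p (fun ω : Outcome V k =>
        (r + 2) ^ i * ((ballPairs I ω i).card : ℝ)) ≤ (1 + 2 / r) ^ k * B := by
      intro i hi
      -- Path lengths up to (r+2)^i exceed the balanced r^i by the factor (1 + 2/r)^i.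
      have hrr : r + 2 = (1 + 2 / r) * r := by field_simp
      rw [expect_const_mul, hrr, mul_pow, mul_assoc]
      exact mul_le_mul (pow_le_pow_right₀ hM (Finset.mem_Icc.1 hi).2) (ti i hi)
        (mul_nonneg (by positivity) (Finset.sum_nonneg fun ω _ => mul_nonneg
          (Finset.prod_nonneg fun u _ => vertexWeight_nonneg
            (fun j => ⟨(hp j).1.le, (hp j).2⟩) (ω u)) (Nat.cast_nonneg _))) (by positivity)
    refine (Finset.sum_le_card_nsmul _ _ _ h).trans ?_
    rw [nsmul_eq_mul]
    refine mul_le_mul_of_nonneg_right ?_ (by positivity)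
    rw [Nat.card_Icc]
    exact_mod_cast (by omega : k + 1 - 2 ≤ k)
  have hnB : (n : ℝ) ≤ B := le_levelBound hn hk (by linarith)
  have h3 : ((k : ℝ) + 1) * n ≤ (k + 1) * B := mul_le_mul_of_nonneg_left hnB (by positivity)
  rw [e1]
  linarith

theorem expectedSize_of_isEmpty [IsEmpty V] (I : Input V) (k : ℕ) (r : ℝ) :
    expectedSize I k r = 0 := by
  refine Finset.sum_eq_zero fun ω _ => ?_
  have : (spanner I r ω).edgeSet = ∅ := Set.eq_empty_of_isEmpty _
  rw [this, Set.ncard_empty, Nat.cast_zero, mul_zero]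

theorem expectedSize_le (I : Input V) {k : ℕ} {r : ℝ} (hk : 2 ≤ k) (hr : 2 ≤ r) :
    expectedSize I k r ≤ 18 * (1 + 2 / r) ^ k * sizeBound (Fintype.card V) k r := by
  have hr0 : 0 < r := by linarith
  have hB : 0 ≤ levelBound (Fintype.card V) k r := levelBound_nonneg hr0.le
  rw [sizeBound_eq]
  rcases isEmpty_or_nonempty V with hV | hV
  · rw [expectedSize_of_isEmpty]
    positivity
  · refine (expectedSize_le_of_pos I Fintype.card_pos hk hr).trans ?_
    rw [← mul_assoc]
    refine mul_le_mul_of_nonneg_right ?_ hB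
    have hM : 1 ≤ (1 + 2 / r) ^ k := by
      refine one_le_pow₀ ?_
      have : 0 ≤ 2 / r := by positivity
      linarith
    -- For k ≥ 2, k + 32 ≤ 17k; together with the last summand this gives 18.
    have hk' : (2 : ℝ) ≤ k := by exact_mod_cast hk
    nlinarith

/-- For k ≤ r, (1 + 2/r)^k ≤ exp(2k/r) ≤ e² ≤ 9, and 18 · 9 = 162. -/
theorem expectedSize_le_of_le (I : Input V) {k : ℕ} {r : ℝ} (hk : 2 ≤ k) (hr : 2 ≤ r)
    (hkr : (k : ℝ) ≤ r) :
    expectedSize I k r ≤ 162 * sizeBound (Fintype.card V) k r := by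
  have hr0 : 0 < r := by linarith
  have hS : 0 ≤ sizeBound (Fintype.card V) k r := by unfold sizeBound; positivity
  refine (expectedSize_le I hk hr).trans (mul_le_mul_of_nonneg_right ?_ hS)
  have h1 : (1 + 2 / r) ^ k ≤ Real.exp 2 := by
    calc (1 + 2 / r) ^ k ≤ Real.exp (2 / r) ^ k := by
          gcongr
          linarith [Real.add_one_le_exp (2 / r)]
      _ = Real.exp (k * (2 / r)) := (Real.exp_nat_mul _ _).symm
      _ ≤ Real.exp 2 := by
          rw [Real.exp_le_exp, mul_div_assoc', div_le_iff₀ hr0]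
          linarith
  have h2 : Real.exp 2 ≤ 9 := by
    have h3 : Real.exp 2 = Real.exp 1 ^ 2 := by rw [← Real.exp_nat_mul]; norm_num
    have h4 : Real.exp 1 ≤ 3 := by linarith [Real.exp_one_lt_d9]
    rw [h3]
    nlinarith [Real.exp_pos 1]
  linarith

end Size

end PathBuying

end

/-! ### The theorem, assembled with explicit constants. -/

theorem mainTheorem4 :
    -- the exponent of `r`
    (∀ k : ℕ, 2 ≤ k → PathBuying.hExp k < 3 / 4) ∧
    -- expected size
    (∃ C : ℝ, 0 < C ∧ ∀ (V : Type u) [Fintype V] [LinearOrder V] (I : PathBuying.Input V)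
      (k : ℕ) (r : ℝ), 2 ≤ k → 2 ≤ r →
        ((k : ℝ) ≤ r →
          PathBuying.expectedSize I k r ≤ C * PathBuying.sizeBound (Fintype.card V) k r) ∧
        PathBuying.expectedSize I k r ≤
          C * (1 + 2 / r) ^ k * PathBuying.sizeBound (Fintype.card V) k r) ∧
    -- `S(k,r)` is a subgraph; stretch regimes, for every outcome of the sampling
    (∃ C : ℝ, 0 < C ∧ ∀ (V : Type u) [Fintype V] [LinearOrder V] (I : PathBuying.Input V)
      (k : ℕ) (r : ℝ) (ω : PathBuying.Outcome V k), 2 ≤ k → 2 ≤ r →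
        PathBuying.spanner I r ω ≤ I.G ∧
        ∀ (u v : V) (d : ℕ), I.G.Reachable u v → I.G.dist u v = d →
          ((2 : ℝ) ^ k ≤ d →
            PathBuying.DistLE (PathBuying.spanner I r ω) u v (C * (3 / 2) ^ k * d)) ∧
          ((3 : ℝ) ^ k ≤ d →
            PathBuying.DistLE (PathBuying.spanner I r ω) u v (C * k * d)) ∧
          (∀ l : ℝ, 4 ≤ l → l < k → l ≤ r → l ^ k ≤ d →
            PathBuying.DistLE (PathBuying.spanner I r ω) u v ((5 + C / l) * d)) ∧
          (∀ l : ℝ, k ≤ l → l ≤ r → l ^ k ≤ d →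
            PathBuying.DistLE (PathBuying.spanner I r ω) u v ((1 + (4 * k + C) / l) * d)) ∧
          ((d : ℝ) ≤ r ^ k →
            PathBuying.DistLE (PathBuying.spanner I r ω) u v
              (d + C * (k * (d : ℝ) ^ (1 - 1 / (k : ℝ)) + 3 ^ k)))) ∧
    -- `(1 + ε, ((4k + O(1))/ε)^(k-1))`-stretch, simultaneously for all admissible `ε`
    (∀ E : ℝ, 0 < E → ∃ C : ℝ, 0 < C ∧
      ∀ (V : Type u) [Fintype V] [LinearOrder V] (I : PathBuying.Input V)
        (k : ℕ) (r : ℝ) (ω : PathBuying.Outcome V k), 2 ≤ k → 2 ≤ r →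
          ∀ ε : ℝ, 0 < ε → ε ≤ E → (4 * k + C) / ε < r →
            ∀ u v : V, I.G.Reachable u v →
              PathBuying.DistLE (PathBuying.spanner I r ω) u v
                ((1 + ε) * I.G.dist u v + ((4 * k + C) / ε) ^ (k - 1))) ∧
    -- sublinear additive stretch for `d ≤ r^k`
    (∀ k : ℕ, 2 ≤ k → ∃ o : ℕ → ℝ, Tendsto o atTop (𝓝 0) ∧
      ∀ (V : Type u) [Fintype V] [LinearOrder V] (I : PathBuying.Input V)
        (r : ℝ) (ω : PathBuying.Outcome V k), 2 ≤ r →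
          ∀ (u v : V) (d : ℕ), I.G.Reachable u v → I.G.dist u v = d → (d : ℝ) ≤ r ^ k →
            PathBuying.DistLE (PathBuying.spanner I r ω) u v
              (d + (4 + o d) * k * (d : ℝ) ^ (1 - 1 / (k : ℝ)) + 3 ^ k)) ∧
    -- stretch for larger `d`
    (∀ k : ℕ, 2 ≤ k → ∀ η : ℝ, 0 < η → ∃ T : ℝ, 0 < T ∧
      ∀ (V : Type u) [Fintype V] [LinearOrder V] (I : PathBuying.Input V)
        (r : ℝ) (ω : PathBuying.Outcome V k), 2 ≤ r → T ≤ r →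
          ∀ (u v : V) (d : ℕ), I.G.Reachable u v → I.G.dist u v = d → r ^ k ≤ d →
            PathBuying.DistLE (PathBuying.spanner I r ω) u v
              (d + (4 + η) * (k * d / r + r ^ (k - 1))) ∧
            (T * r ^ k ≤ d →
              PathBuying.DistLE (PathBuying.spanner I r ω) u v (d + (4 + η) * k * d / r))) := by
  refine ⟨fun k hk => PathBuying.hExp_lt hk, ⟨162, by norm_num, ?_⟩, ⟨1000, by norm_num, ?_⟩, ?_,
    ?_, ?_⟩
  · intro V _ _ I k r hk hr
    refine ⟨fun hkr => PathBuying.expectedSize_le_of_le I hk hr hkr,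
      (PathBuying.expectedSize_le I hk hr).trans ?_⟩
    have hr0 : 0 < r := by linarith
    have hS : 0 ≤ PathBuying.sizeBound (Fintype.card V) k r := by
      unfold PathBuying.sizeBound; positivity
    gcongr
    norm_num
  · intro V _ _ I k r ω hk hr
    exact ⟨PathBuying.spanner_le I r ω, PathBuying.stretch_regimes I ω hk hr⟩
  · intro E hE
    refine ⟨360000 + 5000 * E, by positivity, ?_⟩
    intro V _ _ I k r ω hk hr ε hε hεE hεr u v huv
    exact PathBuying.epsilon_stretch I ω hk hr hE le_rfl hε hεE hεr u v huv
  · intro k hk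
    refine ⟨_, PathBuying.tendsto_sublinearConst k hk, ?_⟩
    intro V _ _ I r ω hr u v d huv hd hdr
    exact PathBuying.sublinear_stretch I ω hk hr u v d huv hd hdr
  · intro k hk η hη
    have hF : 0 ≤ PathBuying.fineConst k := by unfold PathBuying.fineConst; positivity
    refine ⟨51 + (16 * k + 16 * PathBuying.fineConst k + 8) / η, by positivity, ?_⟩
    intro V _ _ I r ω _ hT u v d huv hd hdr
    exact PathBuying.large_stretch I ω hk hη rfl hT u v d huv hd hdr
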